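/- **Six-vertex ensembles.** An arrow configuration is a quadruple $(i_1,j_1;i_2,j_2)\in\{0,1\}^4$ with $i_1+j_1=i_2+j_2$, where $i_1,j_1$ (resp. $i_2,j_2$) are the numbers of vertical and horizontal arrows entering (resp. exiting) a vertex. For $\Lambda\subseteq\mathbb Z^2$, let $\mathfrak E(\Lambda)$ be the set of six-vertex ensembles on $\Lambda$: assignments of an arrow configuration to each vertex of $\Lambda$ such that $i_2(v)=i_1(v+(0,1))$ and $j_2(v)=j_1(v+(1,0))$ whenever both vertices lie in $\Lambda$; it carries the $\sigma$-algebra generated by cylinder sets. Two ensembles on disjoint vertex sets are consistent if these relations also hold along the edges joining the two sets. **Weights.** Fix $0<B_1<B_2<1$. The $(B_1,B_2)$-stochastic six-vertex model has vertex weights $w(0,0;0,0)=w(1,1;1,1)=1$, $w(1,0;1,0)=B_1$, $w(1,0;0,1)=1-B_1$, $w(0,1;0,1)=B_2$, $w(0,1;1,0)=1-B_2$. The weight $w(\mathcal E)$ of an ensemble on a finite set is the product of its vertex weights. **Pure states.** A probability measure $\mu$ on $\mathfrak E(\mathbb Z^2)$ is a Gibbs measure if for every finite connected $\Lambda'\subset\mathbb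 Z^2$, conditionally on the restriction $\mathcal H$ of the ensemble to $\mathbb Z^2\setminus\Lambda'$, its restriction to $\Lambda'$ equals each $\mathcal E'\in\mathfrak E(\Lambda')$ consistent with $\mathcal H$ with probability proportional to $w(\mathcal E')$. A pure state is a translation-invariant Gibbs measure that is ergodic (every measurable event invariant under all translations of $\mathbb Z^2$ has probability $0$ or $1$). Its slope is $(s,t)$, where $s=\mu[i_2(0,0)=1]$ and $t=\mu[j_2(0,0)=1]$. **Partition function stochastic lower bound.** For $N\ge1$ let $\Lambda_N=[1,N]\times[1,N]\subset\mathbb Z^2$ and let $\nu_N$ be the marginal of $\mu$ on $\mathfrak E(\mathbb Z^2\setminus\Lambda_N)$. An ensemble $\mathcal H$ on $\mathbb Z^2\setminus\Lambda_N$ induces boundary data on $\Lambda_N$: the vertices adjacent to $\Lambda_N$ from which an arrow of $\mathcal H$ enters $\Lambda_N$, and those into which an arrow of $\mathcal H$ exits from $\Lambda_N$. Let $Z(\mathcal H)=\sum_{\mathcal E}w(\mathcal E)$, over all $\mathcal E\in\mathfrak E(\Lambda_N)$ with exactly this boundary data. Then $\mu$ satisfies a partition function stochastic lower bound if for every real $\delta>0$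 there is a constant $C_0=C_0(\delta,\mu)>1$ such that, for every integer $N>C_0$, $$\mathbb P_{\nu_N}\big[Z(\mathcal H)\ge e^{-\delta N^2}\big]\ge 1-\delta .$$ **Proposition.** Let $0<B_1<B_2<1$, set $\kappa=\frac{1-B_1}{1-B_2}$ and $\varphi(z)=\frac{\kappa z}{(\kappa-1)z+1}$, and let $(s,t)\in(0,1]^2$ satisfy $s\le t\le\varphi(s)$. Let $\mu$ be a pure state of slope $(s,t)$ for the $(B_1,B_2)$-stochastic six-vertex model. Then $\mu$ satisfies a partition function stochastic lower bound. -/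

import Mathlib

open MeasureTheory ProbabilityTheory

namespace SixVertex

/-! ### Six-vertex ensembles -/

/-- The square lattice `ℤ²`, as a graph: edges join nearest neighbours. -/
noncomputable abbrev lattice : SimpleGraph (ℤ × ℤ) :=
  (SimpleGraph.hasse ℤ).boxProd (SimpleGraph.hasse ℤ)

/-- A domain is a connected induced subgraph of `ℤ²`, recorded through its vertex set. -/
def IsDomain (Λ : Set (ℤ × ℤ)) : Prop := (lattice.induce Λ).Connected

/-- An arrow configuration `(i₁, j₁; i₂, j₂)`: `i₁, j₁` are the numbers of vertical and horizontal
arrows entering a vertex, `i₂, j₂` the numbers of vertical and horizontal arrows exiting it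
(`true` stands for `1`, `false` for `0`), subject to arrow conservation. -/
abbrev ArrowConfig : Type :=
  {c : Bool × Bool × Bool × Bool //
    c.1.toNat + c.2.1.toNat = c.2.2.1.toNat + c.2.2.2.toNat}

/-- Vertical arrow entering. -/
def ArrowConfig.i₁ (c : ArrowConfig) : Bool := c.1.1

/-- Horizontal arrow entering. -/
def ArrowConfig.j₁ (c : ArrowConfig) : Bool := c.1.2.1

/-- Vertical arrow exiting. -/
def ArrowConfig.i₂ (c : ArrowConfig) : Bool := c.1.2.2.1

/-- Horizontal arrow exiting. -/
def ArrowConfig.j₂ (c : ArrowConfig) : Bool := c.1.2.2.2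

/-- The arrow configurations `f` on `Λ` and `g` on `Γ` agree along every edge of `ℤ²` directed
(upwards or to the right) from a vertex of `Λ` to a vertex of `Γ`. -/
def AgreeAlong {Λ Γ : Set (ℤ × ℤ)} (f : Λ → ArrowConfig) (g : Γ → ArrowConfig) : Prop :=
  ∀ (v : Λ) (u : Γ),
    ((u : ℤ × ℤ) = (v : ℤ × ℤ) + (0, 1) → (f v).i₂ = (g u).i₁) ∧
    ((u : ℤ × ℤ) = (v : ℤ × ℤ) + (1, 0) → (f v).j₂ = (g u).j₁)

/-- Six-vertex ensembles on a set `Λ` of vertices: assignments of arrow configurations to the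
vertices of `Λ` such that adjacent configurations are consistent. -/
abbrev Ensemble (Λ : Set (ℤ × ℤ)) : Type :=
  {f : Λ → ArrowConfig // AgreeAlong f f}

namespace Ensemble

variable {Λ Γ : Set (ℤ × ℤ)}

/-- The arrow configuration at a vertex. -/
def config (E : Ensemble Λ) (v : Λ) : ArrowConfig := E.1 v

/-- Restriction of an ensemble to a subset of its vertices. -/
def restrict (h : Γ ⊆ Λ) (E : Ensemble Λ) : Ensemble Γ :=
  ⟨fun v => E.config ⟨v, h v.2⟩, fun v u => E.2 ⟨v, h v.2⟩ ⟨u, h u.2⟩⟩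

/-- Ensembles on two (disjoint) vertex sets are consistent if they agree along every edge that
joins the two sets. -/
def Consistent (E : Ensemble Λ) (H : Ensemble Γ) : Prop :=
  AgreeAlong E.1 H.1 ∧ AgreeAlong H.1 E.1

/- The σ-algebra on `Ensemble Λ` is the instance for subtypes of a product of finite discrete
spaces. The two facts below show that it is the one generated by the cylinder sets and that
restriction maps are measurable. -/

theorem measurable_config (v : Λ) : Measurable fun E : Ensemble Λ => E.config v :=
  (measurable_pi_apply v).comp measurable_subtype_coe

theorem measurable_restrict (h : Γ ⊆ Λ) : Measurable (restrict h) :=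
  Measurable.subtype_mk (measurable_pi_lambda _ fun v : Γ => measurable_config ⟨v, h v.2⟩)

theorem measurableSpace_eq_generateFrom_cylinders (Λ : Set (ℤ × ℤ)) :
    (inferInstance : MeasurableSpace (Ensemble Λ)) =
      MeasurableSpace.generateFrom
        {A | ∃ (Γ : Set (ℤ × ℤ)) (h : Γ ⊆ Λ) (F : Ensemble Γ),
          Γ.Finite ∧ IsDomain Γ ∧ A = {E | restrict h E = F}} := by
  apply le_antisymm
  · have key : ∀ v : Λ, @Measurable (Ensemble Λ) ArrowConfig (MeasurableSpace.generateFrom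
        {A | ∃ (Γ : Set (ℤ × ℤ)) (h : Γ ⊆ Λ) (F : Ensemble Γ),
          Γ.Finite ∧ IsDomain Γ ∧ A = {E | restrict h E = F}}) _ (fun E => E.config v) := by
      intro v
      refine @measurable_to_countable' _ _ _ _ (_) _ fun c => ?_
      have hself : AgreeAlong (Λ := {(v : ℤ × ℤ)}) (Γ := {(v : ℤ × ℤ)})
          (fun _ => c) (fun _ => c) := by
        rintro ⟨a, ha⟩ ⟨b, hb⟩
        simp only [Set.mem_singleton_iff] at ha hb
        subst ha
        subst hb
        constructor <;> intro h <;> simp at h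
      have hsub : ({(v : ℤ × ℤ)} : Set (ℤ × ℤ)) ⊆ Λ := Set.singleton_subset_iff.2 v.2
      apply MeasurableSpace.measurableSet_generateFrom
      refine ⟨{(v : ℤ × ℤ)}, hsub, ⟨fun _ => c, hself⟩, Set.finite_singleton _, ?_, ?_⟩
      · have : Subsingleton ({(v : ℤ × ℤ)} : Set (ℤ × ℤ)) := inferInstance
        exact { preconnected := SimpleGraph.Preconnected.of_subsingleton
                nonempty := ⟨⟨v, rfl⟩⟩ }
      · ext E
        simp only [Set.mem_preimage, Set.mem_singleton_iff, Set.mem_ofPred_eq]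
        constructor
        · intro h
          apply Subtype.ext
          funext u
          have hu : (⟨(u : ℤ × ℤ), hsub u.2⟩ : Λ) = v := Subtype.ext u.2
          change E.config ⟨(u : ℤ × ℤ), hsub u.2⟩ = c
          rw [hu, h]
        · intro h
          have := congrFun (congrArg Subtype.val h) ⟨v, rfl⟩
          exact this
    have hpi := @measurable_pi_lambda (Ensemble Λ) Λ (fun _ => ArrowConfig) (_) _
      (fun E => E.1) key
    exact hpi.comap_le
  · apply MeasurableSpace.generateFrom_le
    rintro A ⟨Γ, h, F, hfin, -, rfl⟩
    have := hfin.to_subtype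
    have hA : {E : Ensemble Λ | restrict h E = F} =
        ⋂ v : Γ, (fun E : Ensemble Λ => E.config ⟨v, h v.2⟩) ⁻¹' {F.config v} := by
      ext E
      simp only [Set.mem_ofPred_eq, Set.mem_iInter, Set.mem_preimage, Set.mem_singleton_iff]
      constructor
      · rintro rfl v
        rfl
      · intro hE
        exact Subtype.ext (funext hE)
    rw [hA]
    exact MeasurableSet.iInter fun v =>
      measurable_config _ (measurableSet_singleton _)

/-- The translation `𝔗_u`, which moves an ensemble on `ℤ²` by `-u`. -/
def translate (u : ℤ × ℤ) (E : Ensemble Set.univ) : Ensemble Set.univ :=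
  ⟨fun v => E.config ⟨v + u, Set.mem_univ _⟩, fun v w =>
    ⟨fun h => (E.2 ⟨v + u, Set.mem_univ _⟩ ⟨w + u, Set.mem_univ _⟩).1
        (by simp only [h]; exact add_right_comm _ _ _),
      fun h => (E.2 ⟨v + u, Set.mem_univ _⟩ ⟨w + u, Set.mem_univ _⟩).2
        (by simp only [h]; exact add_right_comm _ _ _)⟩⟩

/-- Indicator `χ⁽ᵛ⁾(v)` that an arrow vertically exits from `v`. -/
def chiV (E : Ensemble Λ) (v : Λ) : ℝ := if (E.config v).i₂ = true then 1 else 0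

/-- Indicator `χ⁽ʰ⁾(v)` that an arrow horizontally exits from `v`. -/
def chiH (E : Ensemble Λ) (v : Λ) : ℝ := if (E.config v).j₂ = true then 1 else 0

end Ensemble

/-! ### Weights and Gibbs measures -/

/-- The six-vertex weights `w(i₁, j₁; i₂, j₂)` with parameters `(a₁, a₂, b₁, b₂, c₁, c₂)`. -/
def sixVertexWeight (a₁ a₂ b₁ b₂ c₁ c₂ : ℝ) (c : ArrowConfig) : ℝ :=
  match c.i₁, c.j₁, c.i₂, c.j₂ with
  | false, false, false, false => a₁
  | true, true, true, true => a₂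
  | true, false, true, false => b₁
  | false, true, false, true => b₂
  | true, false, false, true => c₁
  | false, true, true, false => c₂
  | _, _, _, _ => 0

/-- The weights of the `(B₁, B₂)`-stochastic six-vertex model. -/
def stochasticWeight (B₁ B₂ : ℝ) : ArrowConfig → ℝ :=
  sixVertexWeight 1 1 B₁ B₂ (1 - B₁) (1 - B₂)

noncomputable instance (Λ : Finset (ℤ × ℤ)) : Fintype (Ensemble (Λ : Set (ℤ × ℤ))) :=
  Fintype.ofFinite _

/-- The weight of an ensemble on a finite set: the product of the weights of its vertices. -/
noncomputable def Ensemble.weight (w : ArrowConfig → ℝ) {Λ : Finset (ℤ × ℤ)}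
    (E : Ensemble (Λ : Set (ℤ × ℤ))) : ℝ :=
  ∏ v : (Λ : Set (ℤ × ℤ)), w (E.config v)

open Classical in
/-- The probability, proportional to the weights, of `E'` among all the ensembles on the finite
set `Λ'` that are consistent with the outside ensemble `H`. -/
noncomputable def gibbsProb (w : ArrowConfig → ℝ) {Λ' : Finset (ℤ × ℤ)} {Γ : Set (ℤ × ℤ)}
    (H : Ensemble Γ) (E' : Ensemble (Λ' : Set (ℤ × ℤ))) : ℝ :=
  (if E'.Consistent H then E'.weight w else 0) /
    ∑ F : Ensemble (Λ' : Set (ℤ × ℤ)), if F.Consistent H then F.weight w else 0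

/-- The Gibbs property: for every finite subdomain `Λ' ⊆ Λ`, conditionally on the restriction of
the ensemble to `Λ \ Λ'`, its restriction to `Λ'` is distributed over the consistent ensembles on
`Λ'` proportionally to their weights. -/
def IsGibbs (w : ArrowConfig → ℝ) {Λ : Set (ℤ × ℤ)} (μ : Measure (Ensemble Λ)) : Prop :=
  ∀ (Λ' : Finset (ℤ × ℤ)) (h : (Λ' : Set (ℤ × ℤ)) ⊆ Λ), IsDomain (Λ' : Set (ℤ × ℤ)) →
    ∀ E' : Ensemble (Λ' : Set (ℤ × ℤ)),
      μ⟦{E : Ensemble Λ | E.restrict h = E'} |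
          MeasurableSpace.comap
            (Ensemble.restrict (Set.sdiff_subset : Λ \ (Λ' : Set (ℤ × ℤ)) ⊆ Λ)) inferInstance⟧
        =ᵐ[μ] fun E => gibbsProb w
          (E.restrict (Set.sdiff_subset : Λ \ (Λ' : Set (ℤ × ℤ)) ⊆ Λ)) E'

/-- Translation-invariance of a measure on ensembles on `ℤ²`. -/
def IsTranslationInvariant (μ : Measure (Ensemble Set.univ)) : Prop :=
  ∀ u : ℤ × ℤ, μ.map (Ensemble.translate u) = μ

/-- A pure state: a translation-invariant, ergodic Gibbs probability measure on the six-vertex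
ensembles on `ℤ²`. -/
structure IsPureState (w : ArrowConfig → ℝ) (μ : Measure (Ensemble Set.univ)) : Prop where
  isProbabilityMeasure : IsProbabilityMeasure μ
  isGibbs : IsGibbs w μ
  isTranslationInvariant : IsTranslationInvariant μ
  ergodic : ∀ A : Set (Ensemble Set.univ), MeasurableSet A →
    (∀ u : ℤ × ℤ, Ensemble.translate u '' A = A) → μ A = 0 ∨ μ A = 1

/-- The slope of a measure: the probabilities that the vertical, respectively horizontal, edge
exiting the origin is occupied. -/
noncomputable def slope (μ : Measure (Ensemble Set.univ)) : ℝ × ℝ :=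
  (∫ E, E.chiV ⟨(0, 0), Set.mem_univ _⟩ ∂μ, ∫ E, E.chiH ⟨(0, 0), Set.mem_univ _⟩ ∂μ)

/-! ### Partition function stochastic lower bounds -/

/-- The square `Λ_N = [1, N] × [1, N]`. -/
noncomputable def square (N : ℕ) : Finset (ℤ × ℤ) := Finset.Icc 1 (N : ℤ) ×ˢ Finset.Icc 1 (N : ℤ)

/-- Boundary data of a six-vertex ensemble on a rectangular domain `Λ`: the boundary vertices
through which paths enter `Λ`, and those through which paths exit `Λ`. As the paths are ordered
along the boundary, these sets determine the corresponding ordered tuples. -/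
@[ext]
structure BoundaryData where
  entrance : Set (ℤ × ℤ)
  exit : Set (ℤ × ℤ)

/-- The boundary data of an ensemble on a rectangular domain `Λ`. -/
def Ensemble.boundaryData {Λ : Set (ℤ × ℤ)} (E : Ensemble Λ) : BoundaryData where
  entrance := {z | z ∉ Λ ∧
    ((∃ v : Λ, (v : ℤ × ℤ) = z + (0, 1) ∧ (E.config v).i₁ = true) ∨
      (∃ v : Λ, (v : ℤ × ℤ) = z + (1, 0) ∧ (E.config v).j₁ = true))}
  exit := {z | z ∉ Λ ∧
    ((∃ v : Λ, z = (v : ℤ × ℤ) + (0, 1) ∧ (E.config v).i₂ = true) ∨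
      (∃ v : Λ, z = (v : ℤ × ℤ) + (1, 0) ∧ (E.config v).j₂ = true))}

/-- The boundary data `𝐮(H) ∪ 𝐯(H)` that an ensemble `H` on `ℤ² \ Λ` induces on a rectangular
domain `Λ`. -/
def Ensemble.inducedBoundaryData {Λ : Set (ℤ × ℤ)} (H : Ensemble (Set.univ \ Λ)) :
    BoundaryData where
  entrance := {z | ∃ v : (Set.univ \ Λ : Set (ℤ × ℤ)), (v : ℤ × ℤ) = z ∧
    ((z + (0, 1) ∈ Λ ∧ (H.config v).i₂ = true) ∨ (z + (1, 0) ∈ Λ ∧ (H.config v).j₂ = true))}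
  exit := {z | ∃ v : (Set.univ \ Λ : Set (ℤ × ℤ)), (v : ℤ × ℤ) = z ∧
    ((z - (0, 1) ∈ Λ ∧ (H.config v).i₁ = true) ∨ (z - (1, 0) ∈ Λ ∧ (H.config v).j₁ = true))}

open Classical in
/-- The partition function `Z(H)` on the square `Λ_N` with boundary data induced by `H`. -/
noncomputable def partitionFunction (w : ArrowConfig → ℝ) {N : ℕ}
    (H : Ensemble (Set.univ \ (square N : Set (ℤ × ℤ)))) : ℝ :=
  ∑ E : Ensemble (square N : Set (ℤ × ℤ)),
    if E.boundaryData = H.inducedBoundaryData then E.weight w else 0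

/-- The marginal distribution `ν_N` of `μ` on the ensembles on `ℤ² \ Λ_N`. -/
noncomputable def outerMarginal (μ : Measure (Ensemble Set.univ)) (N : ℕ) :
    Measure (Ensemble (Set.univ \ (square N : Set (ℤ × ℤ)))) :=
  μ.map (Ensemble.restrict Set.sdiff_subset)

/-- The partition function stochastic lower bound for `μ`, with respect to the
`(B₁, B₂)`-stochastic six-vertex model. -/
def PartitionFunctionStochasticLowerBound (B₁ B₂ : ℝ) (μ : Measure (Ensemble Set.univ)) : Prop :=
  ∀ δ : ℝ, 0 < δ → ∃ C₀ : ℝ, 1 < C₀ ∧ ∀ N : ℕ, C₀ < N →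
    1 - δ ≤ (outerMarginal μ N).real
      {H | Real.exp (-δ * (N : ℝ) ^ 2) ≤ partitionFunction (stochasticWeight B₁ B₂) H}

/-- `κ = (1 - B₁) / (1 - B₂)`. -/
noncomputable def kappa (B₁ B₂ : ℝ) : ℝ := (1 - B₁) / (1 - B₂)

/-- `φ(z) = κ z / ((κ - 1) z + 1)`. -/
noncomputable def phi (B₁ B₂ : ℝ) (z : ℝ) : ℝ :=
  kappa B₁ B₂ * z / ((kappa B₁ B₂ - 1) * z + 1)

end SixVertex

namespace SixVertex

/-! ### Height functions -/

/-! An ensemble on a box is encoded by a height function with increments 0 or 1, increasing to the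
right and decreasing upwards; the paths are its level lines. The theorem splits into a probabilistic
half about `μ` and a deterministic half about partition functions.

Probabilistic half. By the mean ergodic theorem, arrow densities averaged over large rectangles
converge to the slope. Row sums at vertical distance `l` differ by at most `l`, so flat rectangles
give the same law of large numbers along single lines. Controlling boundedly many lines and using
the Lipschitz property, the height on `Λ_N` is within `ηN` of `s x - t y` with probability close to
1 (`IsPureState.measure_not_nearLinear`).

Deterministic half. If the height is nearly linear, then `Z ≥ exp(-δN²)`. When the slopes lie
strictly between 0 and 1, any nearly linear ensemble on a concentric inner box can be joined to the
given boundary heights by Lipschitz extension; this costs a factor only for the `O(mN)` vertices of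
a frame of width `m` (`partitionFunction_ge`). It remains to show that nearly linear ensembles of
slope `(s, t)` have total weight not exponentially small in the area.

For slopes `(a, φ(a))` this comes from the stationary measure: vertical and horizontal arrows enter
independently with probabilities `a` and `φ(a)`. The total mass is 1 because the weights are
stochastic, and detailed balance makes the arrows leaving every row independent again, so second
moments give nearly linear profiles (`sum_entranceMass_deviation_le`).

For other slopes, `φ(a)/a` decreases to 1 as `a` increases to 1, so `(s, t)` is a multiple `l (a,
φ(a))` with `l ≤ 1`, up to a small error when `s = t` (`exists_scaling`). One keeps about `lM` out
of every `M` consecutive paths. Where paths are erased the vertices become empty and have weight 1,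
while the stochastic weights of all that could have been there sum to at most 1. So weight is lost
only at vertices where the pattern switches between keeping and erasing, and some shift of the
pattern has at most `6n²/M` of them (`sum_entranceMass_le_sum_thin`).

The case `t = 1`, where the gluing has no room, forces `s = 1`: every edge is occupied almost surely
and the weight is 1. -/

/-- Height functions of six-vertex ensembles. -/
def IsHeight (h : ℤ × ℤ → ℤ) : Prop :=
  ∀ x y : ℤ, h (x, y) ≤ h (x + 1, y) ∧ h (x + 1, y) ≤ h (x, y) + 1 ∧
    h (x, y + 1) ≤ h (x, y) ∧ h (x, y) ≤ h (x, y + 1) + 1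

/-- The largest possible increase of a height function from `q` to `p`. -/
def gap (q p : ℤ × ℤ) : ℤ := max (p.1 - q.1) 0 + max (q.2 - p.2) 0

theorem IsHeight.right {h : ℤ × ℤ → ℤ} (hh : IsHeight h) (x y : ℤ) (n : ℕ) :
    h (x, y) ≤ h (x + n, y) ∧ h (x + n, y) ≤ h (x, y) + n := by
  induction n with
  | zero => simp
  | succ n ih =>
    have := hh (x + n) y
    push_cast
    rw [← add_assoc]
    omega

theorem IsHeight.up {h : ℤ × ℤ → ℤ} (hh : IsHeight h) (x y : ℤ) (n : ℕ) :
    h (x, y + n) ≤ h (x, y) ∧ h (x, y) ≤ h (x, y + n) + n := by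
  induction n with
  | zero => simp
  | succ n ih =>
    have := hh x (y + n)
    push_cast
    rw [← add_assoc]
    omega

/-- Moving from `q` to `p` first horizontally and then vertically, only steps to the right and steps
downwards can raise the height, each by at most 1. -/
theorem IsHeight.le_add_gap {h : ℤ × ℤ → ℤ} (hh : IsHeight h) (q p : ℤ × ℤ) :
    h p ≤ h q + gap q p := by
  obtain ⟨qx, qy⟩ := q
  obtain ⟨px, py⟩ := p
  have h1 : h (px, py) ≤ h (qx, py) + max (px - qx) 0 := by
    rcases le_total qx px with hx | hx
    · have := (hh.right qx py (px - qx).toNat).2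
      rw [Int.toNat_of_nonneg (by omega), add_sub_cancel] at this
      exact this.trans (by gcongr; exact le_max_left _ _)
    · have := (hh.right px py (qx - px).toNat).1
      rw [Int.toNat_of_nonneg (by omega), add_sub_cancel] at this
      have := le_max_right (px - qx) 0
      omega
  have h2 : h (qx, py) ≤ h (qx, qy) + max (qy - py) 0 := by
    rcases le_total py qy with hx | hx
    · have := (hh.up qx py (qy - py).toNat).2
      rw [Int.toNat_of_nonneg (by omega), add_sub_cancel] at this
      exact this.trans (by gcongr; exact le_max_left _ _)
    · have := (hh.up qx qy (py - qy).toNat).1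
      rw [Int.toNat_of_nonneg (by omega), add_sub_cancel] at this
      have := le_max_right (qy - py) 0
      omega
  simp only [gap]
  omega

/-- With `IsHeight.le_add_gap`, this identifies height functions with the functions that are
1-Lipschitz for the asymmetric distance `gap`, the form in which Lipschitz extension applies. -/
theorem isHeight_of_le_add_gap {h : ℤ × ℤ → ℤ} (hh : ∀ q p, h p ≤ h q + gap q p) :
    IsHeight h := by
  intro x y
  have h1 := hh (x + 1, y) (x, y)
  have h2 := hh (x, y) (x + 1, y)
  have h3 := hh (x, y) (x, y + 1)
  have h4 := hh (x, y + 1) (x, y)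
  simp only [gap] at h1 h2 h3 h4
  omega

theorem gap_triangle (a b c : ℤ × ℤ) : gap a c ≤ gap a b + gap b c := by
  simp only [gap]; omega

theorem gap_self (a : ℤ × ℤ) : gap a a = 0 := by simp [gap]

theorem IsHeight.sup {h k : ℤ × ℤ → ℤ} (hh : IsHeight h) (hk : IsHeight k) :
    IsHeight fun p => max (h p) (k p) := by
  intro x y
  have := hh x y
  have := hk x y
  simp only
  omega

theorem IsHeight.inf {h k : ℤ × ℤ → ℤ} (hh : IsHeight h) (hk : IsHeight k) :
    IsHeight fun p => min (h p) (k p) := by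
  intro x y
  have := hh x y
  have := hk x y
  simp only
  omega

theorem IsHeight.add_const {h : ℤ × ℤ → ℤ} (hh : IsHeight h) (k : ℤ) :
    IsHeight fun p => h p + k := by
  intro x y
  have := hh x y
  simp only
  omega

/-- The arrow configuration `c` is the one determined at the vertex `v` by the height
function `h`. -/
def Fits (h : ℤ × ℤ → ℤ) (v : ℤ × ℤ) (c : ArrowConfig) : Prop :=
  (c.i₁.toNat : ℤ) = h (v.1, v.2 - 1) - h (v.1 - 1, v.2 - 1) ∧
  (c.j₁.toNat : ℤ) = h (v.1 - 1, v.2 - 1) - h (v.1 - 1, v.2) ∧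
  (c.i₂.toNat : ℤ) = h (v.1, v.2) - h (v.1 - 1, v.2) ∧
  (c.j₂.toNat : ℤ) = h (v.1, v.2 - 1) - h (v.1, v.2)

theorem ArrowConfig.ext' {c d : ArrowConfig} (h₁ : c.i₁ = d.i₁) (h₂ : c.j₁ = d.j₁)
    (h₃ : c.i₂ = d.i₂) (h₄ : c.j₂ = d.j₂) : c = d :=
  Subtype.ext (Prod.ext h₁ (Prod.ext h₂ (Prod.ext h₃ h₄)))

theorem bool_eq_of_toNat {a b : Bool} (h : (a.toNat : ℤ) = b.toNat) : a = b := by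
  cases a <;> cases b <;> simp_all

theorem Fits.unique {h : ℤ × ℤ → ℤ} {v : ℤ × ℤ} {c d : ArrowConfig} (hc : Fits h v c)
    (hd : Fits h v d) : c = d := by
  obtain ⟨h1, h2, h3, h4⟩ := hc
  obtain ⟨k1, k2, k3, k4⟩ := hd
  exact ArrowConfig.ext' (bool_eq_of_toNat (h1.trans k1.symm)) (bool_eq_of_toNat (h2.trans k2.symm))
    (bool_eq_of_toNat (h3.trans k3.symm)) (bool_eq_of_toNat (h4.trans k4.symm))

theorem Fits.add_const {h : ℤ × ℤ → ℤ} {v : ℤ × ℤ} {c : ArrowConfig} (hc : Fits h v c) (k : ℤ) :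
    Fits (fun p => h p + k) v c := by
  simp only [Fits] at *
  omega

theorem toNat_decide_lt {a b : ℤ} (h₁ : a ≤ b) (h₂ : b ≤ a + 1) :
    ((decide (a < b)).toNat : ℤ) = b - a := by
  rcases h₁.lt_or_eq with h | h
  · simp only [h, decide_true, Bool.toNat_true]
    push_cast
    omega
  · subst h
    simp

/-- The arrow configuration at a vertex of a height function. -/
noncomputable def IsHeight.config {h : ℤ × ℤ → ℤ} (hh : IsHeight h) (v : ℤ × ℤ) : ArrowConfig :=
  ⟨(decide (h (v.1 - 1, v.2 - 1) < h (v.1, v.2 - 1)), decide (h (v.1 - 1, v.2) < h (v.1 - 1, v.2 - 1)),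
    decide (h (v.1 - 1, v.2) < h (v.1, v.2)), decide (h (v.1, v.2) < h (v.1, v.2 - 1))), by
    have h1 := hh (v.1 - 1) (v.2 - 1)
    have h2 := hh (v.1 - 1) v.2
    have h3 := hh v.1 (v.2 - 1)
    simp only [sub_add_cancel] at h1 h2 h3
    have e1 := toNat_decide_lt h1.1 h1.2.1
    have e2 := toNat_decide_lt h1.2.2.1 h1.2.2.2
    have e3 := toNat_decide_lt h2.1 h2.2.1
    have e4 := toNat_decide_lt h3.2.2.1 h3.2.2.2
    zify
    rw [e1, e2, e3, e4]
    ring⟩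

theorem IsHeight.fits_config {h : ℤ × ℤ → ℤ} (hh : IsHeight h) (v : ℤ × ℤ) :
    Fits h v (hh.config v) := by
  have h1 := hh (v.1 - 1) (v.2 - 1)
  have h2 := hh (v.1 - 1) v.2
  have h3 := hh v.1 (v.2 - 1)
  simp only [sub_add_cancel] at h1 h2 h3
  exact ⟨toNat_decide_lt h1.1 h1.2.1, toNat_decide_lt h1.2.2.1 h1.2.2.2,
    toNat_decide_lt h2.1 h2.2.1, toNat_decide_lt h3.2.2.1 h3.2.2.2⟩

/-- The ensemble of a height function. -/
noncomputable def IsHeight.ensemble {h : ℤ × ℤ → ℤ} (hh : IsHeight h) (Λ : Set (ℤ × ℤ)) : Ensemble Λ :=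
  ⟨fun v => hh.config v, by
    rintro ⟨v, hv⟩ ⟨u, hu⟩
    constructor
    · rintro rfl
      simp [IsHeight.config, ArrowConfig.i₂, ArrowConfig.i₁]
    · rintro rfl
      simp [IsHeight.config, ArrowConfig.j₂, ArrowConfig.j₁]⟩

/-! ### Boxes, and the height function of an ensemble on a box -/

/-- The square of side `n` of vertices with south-west corner `(m, m)`. -/
noncomputable def box (m : ℤ) (n : ℕ) : Finset (ℤ × ℤ) :=
  Finset.Icc (m + 1) (m + n) ×ˢ Finset.Icc (m + 1) (m + n)

/-- The corners of the vertices in a box. -/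
noncomputable def grid (m : ℤ) (n : ℕ) : Finset (ℤ × ℤ) :=
  Finset.Icc m (m + n) ×ˢ Finset.Icc m (m + n)

theorem mem_box {m : ℤ} {n : ℕ} {v : ℤ × ℤ} :
    v ∈ box m n ↔ (m < v.1 ∧ v.1 ≤ m + n) ∧ (m < v.2 ∧ v.2 ≤ m + n) := by
  simp only [box, Finset.mem_product, Finset.mem_Icc]
  omega

theorem mem_grid {m : ℤ} {n : ℕ} {v : ℤ × ℤ} :
    v ∈ grid m n ↔ (m ≤ v.1 ∧ v.1 ≤ m + n) ∧ (m ≤ v.2 ∧ v.2 ≤ m + n) := by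
  simp only [grid, Finset.mem_product, Finset.mem_Icc]

theorem box_zero (N : ℕ) : box 0 N = square N := by simp [box, square]

theorem card_box (m : ℤ) (n : ℕ) : (box m n).card = n ^ 2 := by
  simp [box, sq]

/-- Two height functions of the same ensemble that agree at one corner of a box agree on the
whole box. -/
theorem height_unique {m : ℤ} {n : ℕ} {h k : ℤ × ℤ → ℤ} {c : ℤ × ℤ → ArrowConfig}
    (hh : ∀ v ∈ box m n, Fits h v (c v)) (hk : ∀ v ∈ box m n, Fits k v (c v))
    (h0 : h (m, m) = k (m, m)) : ∀ p ∈ grid m n, h p = k p := by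
  -- The left side is climbed through `j₁` and the bottom side is followed through `i₁`; every other
  -- point is the north-east corner of a vertex and is reached through its `i₂`.
  have key : ∀ a b : ℕ, a ≤ n → b ≤ n → 0 < n → h (m + a, m + b) = k (m + a, m + b) := by
    intro a
    induction a with
    | zero =>
      intro b
      induction b with
      | zero => intros; simpa using h0
      | succ b ih =>
        intro ha hb hn
        have ih := ih ha (by omega) hn
        have hm : (m + 1, m + (b + 1 : ℕ)) ∈ box m n := by
          rw [mem_box]; push_cast; constructor <;> constructor <;> omega
        have e1 := (hh _ hm).2.1
        have e2 := (hk _ hm).2.1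
        push_cast at *
        simp only [add_sub_cancel_right, ← add_assoc, add_zero] at *
        omega
    | succ a iha =>
      intro b ha hb hn
      have ih := iha b (by omega) hb hn
      rcases b with _ | b
      · have hm : (m + (a + 1 : ℕ), m + 1) ∈ box m n := by
          rw [mem_box]; push_cast; constructor <;> constructor <;> omega
        have e1 := (hh _ hm).1
        have e2 := (hk _ hm).1
        push_cast at *
        simp only [add_sub_cancel_right, ← add_assoc, add_zero] at *
        omega
      · have hm : (m + (a + 1 : ℕ), m + (b + 1 : ℕ)) ∈ box m n := by
          rw [mem_box]; push_cast; constructor <;> constructor <;> omega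
        have e1 := (hh _ hm).2.2.1
        have e2 := (hk _ hm).2.2.1
        push_cast at *
        simp only [add_sub_cancel_right, ← add_assoc] at *
        omega
  rintro ⟨x, y⟩ hp
  rw [mem_grid] at hp
  simp only at hp
  rcases Nat.eq_zero_or_pos n with rfl | hn
  · have : x = m := by push_cast at hp; omega
    have : y = m := by push_cast at hp; omega
    subst_vars
    exact h0
  · have := key (x - m).toNat (y - m).toNat (by omega) (by omega) hn
    rwa [Int.toNat_of_nonneg (by omega), Int.toNat_of_nonneg (by omega), add_sub_cancel,
      add_sub_cancel] at this

/-- The configurations of an ensemble, extended by the empty configuration. -/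
noncomputable def Ensemble.total {Λ : Set (ℤ × ℤ)} (E : Ensemble Λ) (v : ℤ × ℤ) : ArrowConfig :=
  open Classical in
  if hv : v ∈ Λ then E.config ⟨v, hv⟩ else ⟨(false, false, false, false), rfl⟩

theorem Ensemble.total_of_mem {Λ : Set (ℤ × ℤ)} (E : Ensemble Λ) {v : ℤ × ℤ} (hv : v ∈ Λ) :
    E.total v = E.config ⟨v, hv⟩ := by
  simp [Ensemble.total, hv]

theorem Ensemble.total_up {Λ : Set (ℤ × ℤ)} (E : Ensemble Λ) {x y : ℤ} (hv : (x, y) ∈ Λ)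
    (hu : (x, y + 1) ∈ Λ) : (E.total (x, y)).i₂ = (E.total (x, y + 1)).i₁ := by
  rw [E.total_of_mem hv, E.total_of_mem hu]
  exact (E.2 ⟨_, hv⟩ ⟨_, hu⟩).1 (by simp)

theorem Ensemble.total_right {Λ : Set (ℤ × ℤ)} (E : Ensemble Λ) {x y : ℤ} (hv : (x, y) ∈ Λ)
    (hu : (x + 1, y) ∈ Λ) : (E.total (x, y)).j₂ = (E.total (x + 1, y)).j₁ := by
  rw [E.total_of_mem hv, E.total_of_mem hu]
  exact (E.2 ⟨_, hv⟩ ⟨_, hu⟩).2 (by simp)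

theorem ArrowConfig.conserve (c : ArrowConfig) :
    (c.i₁.toNat : ℤ) + c.j₁.toNat = c.i₂.toNat + c.j₂.toNat := by
  exact_mod_cast c.2

/-- Arrow conservation says that the increments around each vertex sum to zero, so they can be
integrated over the box. Clamping the coordinates to the box extends the result to a height function
on the whole lattice. -/
theorem Ensemble.exists_height {Λ : Set (ℤ × ℤ)} (E : Ensemble Λ) (m : ℤ) (n : ℕ)
    (hΛ : (box m n : Set (ℤ × ℤ)) ⊆ Λ) :
    ∃ h : ℤ × ℤ → ℤ, IsHeight h ∧ h (m, m) = 0 ∧ ∀ v ∈ box m n, Fits h v (E.total v) := by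
  set c : ℕ → ℕ → ArrowConfig := fun k l => E.total (m + 1 + k, m + 1 + l) with hc
  have hmem : ∀ k l : ℕ, k < n → l < n → ((m + 1 + k, m + 1 + l) : ℤ × ℤ) ∈ Λ := by
    intro k l hk hl
    apply hΛ
    rw [Finset.mem_coe, mem_box]
    constructor <;> constructor <;> push_cast <;> omega
  have hup : ∀ k l : ℕ, k < n → l + 1 < n → (c k l).i₂ = (c k (l + 1)).i₁ := by
    intro k l hk hl
    have := E.total_up (hmem k l hk (by omega))
      (by have := hmem k (l + 1) hk hl; push_cast at this; rwa [← add_assoc] at this)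
    simp only [hc]
    push_cast
    rwa [← add_assoc (m + 1) (l : ℤ) 1]
  have hri : ∀ k l : ℕ, k + 1 < n → l < n → (c k l).j₂ = (c (k + 1) l).j₁ := by
    intro k l hk hl
    have := E.total_right (hmem k l (by omega) hl)
      (by have := hmem (k + 1) l hk hl; push_cast at this; rwa [← add_assoc] at this)
    simp only [hc]
    push_cast
    rwa [← add_assoc (m + 1) (k : ℤ) 1]
  -- The arrow crossing level `l` of column `k`. It is read from the vertex below the level, so that
  -- the top level `n` is covered; only level 0 needs an entering arrow.
  set V : ℕ → ℕ → ℤ := fun k l => match l with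
    | 0 => ((c k 0).i₁.toNat : ℤ)
    | l + 1 => ((c k l).i₂.toNat : ℤ) with hV
  have hVi : ∀ k l, k < n → l < n → V k l = (c k l).i₁.toNat := by
    intro k l hk hl
    rcases l with _ | l
    · rfl
    · simp only [hV]
      rw [hup k l hk hl]
  -- Integration up the left side of the box and then along level `l`.
  set g : ℕ → ℕ → ℤ := fun k l =>
    ∑ i ∈ Finset.range k, V i l - ∑ j ∈ Finset.range l, ((c 0 j).j₁.toNat : ℤ) with hg
  have gx : ∀ k l, g (k + 1) l = g k l + V k l := by
    intro k l
    simp only [hg, Finset.sum_range_succ]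
    ring
  have gy : ∀ k l, k < n → l < n → g k l - g k (l + 1) = (c k l).j₁.toNat := by
    intro k l hk hl
    induction k with
    | zero => simp [hg, Finset.sum_range_succ]
    | succ k ih =>
      have ih := ih (by omega)
      rw [gx k l, gx k (l + 1), ← hri k l hk hl]
      have e1 := hVi k l (by omega) hl
      have e2 : V k (l + 1) = (c k l).i₂.toNat := rfl
      have := (c k l).conserve
      omega
  have gy' : ∀ k l, k < n → l < n → g (k + 1) l - g (k + 1) (l + 1) = (c k l).j₂.toNat := by
    intro k l hk hl
    have ih := gy k l hk hl
    rw [gx k l, gx k (l + 1)]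
    have e1 := hVi k l (by omega) hl
    have e2 : V k (l + 1) = (c k l).i₂.toNat := rfl
    have := (c k l).conserve
    omega
  have bnd : ∀ b : Bool, 0 ≤ (b.toNat : ℤ) ∧ (b.toNat : ℤ) ≤ 1 := by
    intro b; cases b <;> simp
  have hVb : ∀ k l, 0 ≤ V k l ∧ V k l ≤ 1 := by
    intro k l
    rcases l with _ | l <;> exact bnd _
  have gyb : ∀ k l, k ≤ n → l < n → 0 ≤ g k l - g k (l + 1) ∧ g k l - g k (l + 1) ≤ 1 := by
    intro k l hk hl
    rcases k with _ | k
    · have : g 0 l - g 0 (l + 1) = (c 0 l).j₁.toNat := by simp [hg, Finset.sum_range_succ]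
      rw [this]; exact bnd _
    · rw [gy' k l hk hl]; exact bnd _
  set cl : ℤ → ℕ := fun z => min n (z - m).toNat with hcl
  have hcln : ∀ z, cl z ≤ n := fun z => min_le_left _ _
  have hcl' : ∀ z, cl (z + 1) = cl z ∨ (cl (z + 1) = cl z + 1 ∧ cl z < n) := by
    intro z; simp only [hcl]; omega
  refine ⟨fun p => g (cl p.1) (cl p.2), ?_, ?_, ?_⟩
  · intro x y
    simp only
    refine ⟨?_, ?_, ?_, ?_⟩
    · rcases hcl' x with h | ⟨h, -⟩ <;> rw [h]
      rw [gx]; have := hVb (cl x) (cl y); omega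
    · rcases hcl' x with h | ⟨h, -⟩ <;> rw [h]
      · omega
      rw [gx]; have := hVb (cl x) (cl y); omega
    · rcases hcl' y with h | ⟨h, h2⟩ <;> rw [h]
      have := gyb (cl x) (cl y) (hcln x) h2; omega
    · rcases hcl' y with h | ⟨h, h2⟩ <;> rw [h]
      · omega
      have := gyb (cl x) (cl y) (hcln x) h2; omega
  · simp [hcl, hg]
  · rintro ⟨x, y⟩ hv
    rw [mem_box] at hv
    obtain ⟨k, hk⟩ : ∃ k : ℕ, x = m + 1 + k := ⟨(x - m - 1).toNat, by simp only at hv; omega⟩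
    obtain ⟨l, hl⟩ : ∃ l : ℕ, y = m + 1 + l := ⟨(y - m - 1).toNat, by simp only at hv; omega⟩
    subst hk hl
    simp only at hv
    have hkn : k < n := by omega
    have hln : l < n := by omega
    have c1 : cl (m + 1 + k) = k + 1 := by simp only [hcl]; omega
    have c2 : cl (m + 1 + k - 1) = k := by simp only [hcl]; omega
    have c3 : cl (m + 1 + l) = l + 1 := by simp only [hcl]; omega
    have c4 : cl (m + 1 + l - 1) = l := by simp only [hcl]; omega
    simp only [Fits, c1, c2, c3, c4]
    change ((c k l).i₁.toNat : ℤ) = _ ∧ ((c k l).j₁.toNat : ℤ) = _ ∧ ((c k l).i₂.toNat : ℤ) = _ ∧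
      ((c k l).j₂.toNat : ℤ) = _
    refine ⟨?_, (gy k l hkn hln).symm, ?_, (gy' k l hkn hln).symm⟩
    · rw [gx, ← hVi k l hkn hln]; ring
    · rw [gx k (l + 1)]; simp only [hV]; ring

/-- An ensemble is nearly linear on a box, with slope `(s, t)` and error `r`. -/
def NearLinear (s t r : ℝ) (m : ℤ) (n : ℕ) {Λ : Set (ℤ × ℤ)} (E : Ensemble Λ) : Prop :=
  ∃ h : ℤ × ℤ → ℤ, IsHeight h ∧ (∀ v ∈ box m n, Fits h v (E.total v)) ∧
    ∀ p ∈ grid m n, |(h p : ℝ) - (s * p.1 - t * p.2)| ≤ r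

/-! ### Gluing -/

/-- Slopes at distance at least `c` from 0 and 1 leave a slack of `c` per unit of `ℓ¹` distance in
the Lipschitz bound; in the gluing it pays for two errors `r`. -/
theorem linear_le_gap {s t c : ℝ} (hs : c ≤ s) (hs' : c ≤ 1 - s) (ht : c ≤ t) (ht' : c ≤ 1 - t)
    (q p : ℤ × ℤ) :
    (s * p.1 - t * p.2) - (s * q.1 - t * q.2) + c * (|(p.1 : ℝ) - q.1| + |(p.2 : ℝ) - q.2|)
      ≤ gap q p := by
  have key : ∀ (u z : ℝ), c ≤ u → c ≤ 1 - u → u * z + c * |z| ≤ max z 0 := by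
    intro u z h1 h2
    rcases le_total 0 z with hz | hz
    · rw [abs_of_nonneg hz, max_eq_left hz]; nlinarith
    · rw [abs_of_nonpos hz, max_eq_right hz]; nlinarith
  have h1 := key s (p.1 - q.1) hs hs'
  have h2 := key t (q.2 - p.2) ht ht'
  rw [abs_sub_comm (q.2 : ℝ)] at h2
  simp only [gap]
  push_cast
  linarith

/-- Let `U` and `L` be the largest and the smallest height functions equal to `k` on the boundary of
the large square, and take `max L (min h₀ U)`. On the boundary `L = U = k`. A point of the inner
grid is at distance at least `m` from the boundary, so the slack `c m ≥ 2 r` gives `L ≤ h₀ ≤ U`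
there. -/
theorem exists_glued_height {s t c r : ℝ} (hs : c ≤ s) (hs' : c ≤ 1 - s) (ht : c ≤ t)
    (ht' : c ≤ 1 - t) (hc : 0 ≤ c) {m n N : ℕ} (hN : N = n + 2 * m) (hr : 2 * r ≤ c * m)
    {k h₀ : ℤ × ℤ → ℤ} (hk : IsHeight k) (hh₀ : IsHeight h₀)
    (hkl : ∀ p ∈ grid 0 N, |(k p : ℝ) - (s * p.1 - t * p.2)| ≤ r)
    (hhl : ∀ p ∈ grid m n, |(h₀ p : ℝ) - (s * p.1 - t * p.2)| ≤ r) :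
    ∃ h : ℤ × ℤ → ℤ, IsHeight h ∧
      (∀ p ∈ grid 0 N, (p.1 = 0 ∨ p.1 = N ∨ p.2 = 0 ∨ p.2 = N) → h p = k p) ∧
      ∀ p ∈ grid m n, h p = h₀ p := by
  set B := (grid 0 N).filter fun p => p.1 = 0 ∨ p.1 = (N : ℤ) ∨ p.2 = 0 ∨ p.2 = (N : ℤ) with hB
  have hBne : B.Nonempty := ⟨(0, 0), by simp [hB, mem_grid]⟩
  set U : ℤ × ℤ → ℤ := fun p => B.inf' hBne fun q => k q + gap q p with hU
  set L : ℤ × ℤ → ℤ := fun p => B.sup' hBne fun q => k q - gap p q with hL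
  have hUh : IsHeight U := by
    apply isHeight_of_le_add_gap
    intro q p
    obtain ⟨b, hb, hbe⟩ := Finset.exists_mem_eq_inf' hBne fun b => k b + gap b q
    have h1 : U p ≤ k b + gap b p := Finset.inf'_le _ hb
    have h2 := gap_triangle b q p
    have h3 : U q = k b + gap b q := hbe
    omega
  have hLh : IsHeight L := by
    apply isHeight_of_le_add_gap
    intro q p
    obtain ⟨b, hb, hbe⟩ := Finset.exists_mem_eq_sup' hBne fun b => k b - gap p b
    have h1 : k b - gap q b ≤ L q := Finset.le_sup' (fun b => k b - gap q b) hb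
    have h2 := gap_triangle q p b
    have h3 : L p = k b - gap p b := hbe
    omega
  refine ⟨_, hLh.sup (hh₀.inf hUh), ?_, ?_⟩
  · intro p hp hpb
    have hpB : p ∈ B := Finset.mem_filter.2 ⟨hp, hpb⟩
    have h1 : U p ≤ k p := by
      have : U p ≤ k p + gap p p := Finset.inf'_le _ hpB
      rwa [gap_self, add_zero] at this
    have h2 : k p ≤ L p := by
      have : k p - gap p p ≤ L p := Finset.le_sup' (fun b => k b - gap p b) hpB
      rwa [gap_self, sub_zero] at this
    have h4 : L p ≤ k p := by
      refine Finset.sup'_le _ _ fun b _ => ?_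
      have := hk.le_add_gap p b
      omega
    change max (L p) (min (h₀ p) (U p)) = _
    omega
  · intro p hp
    have dist : ∀ q ∈ B, (m : ℝ) ≤ |(p.1 : ℝ) - q.1| + |(p.2 : ℝ) - q.2| := by
      intro q hq
      have : (m : ℤ) ≤ |p.1 - q.1| + |p.2 - q.2| := by
        simp only [hB, Finset.mem_filter, mem_grid] at hq
        rw [mem_grid] at hp
        simp only [abs_eq_max_neg]
        omega
      exact_mod_cast this
    have hpl := abs_le.1 (hhl p hp)
    have h1 : h₀ p ≤ U p := by
      refine Finset.le_inf' _ _ fun q hq => ?_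
      have h2 := abs_le.1 (hkl q (Finset.filter_subset _ _ hq))
      have h3 := linear_le_gap hs hs' ht ht' q p
      have h4 := mul_le_mul_of_nonneg_left (dist q hq) hc
      have : (h₀ p : ℝ) ≤ k q + gap q p := by linarith
      exact_mod_cast this
    have h5 : L p ≤ h₀ p := by
      refine Finset.sup'_le _ _ fun q hq => ?_
      have h2 := abs_le.1 (hkl q (Finset.filter_subset _ _ hq))
      have h3 := linear_le_gap hs hs' ht ht' p q
      rw [abs_sub_comm (q.1 : ℝ), abs_sub_comm (q.2 : ℝ)] at h3
      have h4 := mul_le_mul_of_nonneg_left (dist q hq) hc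
      have : (k q : ℝ) - gap p q ≤ h₀ p := by linarith
      exact_mod_cast this
    change max (L p) (min (h₀ p) (U p)) = _
    omega

/-! ### Boundary data, and comparison of a square with an inner box -/

/-- Boundary data only see the edges that cross the boundary of `Λ`, and along such an edge the two
end vertices carry the same arrow of `ω`. -/
theorem boundaryData_eq {Λ : Set (ℤ × ℤ)} (E : Ensemble Λ) (ω : Ensemble Set.univ)
    (h₁ : ∀ v ∈ Λ, v - (0, 1) ∉ Λ → (E.total v).i₁ = (ω.total v).i₁)
    (h₂ : ∀ v ∈ Λ, v - (1, 0) ∉ Λ → (E.total v).j₁ = (ω.total v).j₁)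
    (h₃ : ∀ v ∈ Λ, v + (0, 1) ∉ Λ → (E.total v).i₂ = (ω.total v).i₂)
    (h₄ : ∀ v ∈ Λ, v + (1, 0) ∉ Λ → (E.total v).j₂ = (ω.total v).j₂) :
    E.boundaryData =
      (ω.restrict (Set.sdiff_subset : Set.univ \ Λ ⊆ Set.univ)).inducedBoundaryData := by
  have up : ∀ z, (ω.total z).i₂ = (ω.total (z + (0, 1))).i₁ := fun z => by
    have := ω.total_up (Set.mem_univ (z.1, z.2)) (Set.mem_univ (z.1, z.2 + 1))
    convert this using 3
    exact Prod.ext (by simp) rfl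
  have ri : ∀ z, (ω.total z).j₂ = (ω.total (z + (1, 0))).j₁ := fun z => by
    have := ω.total_right (Set.mem_univ (z.1, z.2)) (Set.mem_univ (z.1 + 1, z.2))
    convert this using 3
    exact Prod.ext rfl (by simp)
  have hω : ∀ v : (Set.univ \ Λ : Set (ℤ × ℤ)),
      (ω.restrict (Set.sdiff_subset : Set.univ \ Λ ⊆ Set.univ)).config v = ω.total v := by
    intro v
    rw [ω.total_of_mem (Set.mem_univ _)]
    rfl
  have hE : ∀ v : Λ, E.config v = E.total v := fun v => (E.total_of_mem v.2).symm
  ext z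
  · simp only [Ensemble.boundaryData, Ensemble.inducedBoundaryData, Set.mem_ofPred_eq, hω, hE,
      Subtype.exists, exists_prop]
    constructor
    · rintro ⟨hz, ⟨v, hv, rfl, h⟩ | ⟨v, hv, rfl, h⟩⟩
      · refine ⟨z, by simpa using hz, rfl, Or.inl ⟨hv, ?_⟩⟩
        rw [up, ← h₁ _ hv (by simpa using hz), h]
      · refine ⟨z, by simpa using hz, rfl, Or.inr ⟨hv, ?_⟩⟩
        rw [ri, ← h₂ _ hv (by simpa using hz), h]
    · rintro ⟨v, hz, rfl, ⟨hv, h⟩ | ⟨hv, h⟩⟩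
      · refine ⟨by simpa using hz, Or.inl ⟨_, hv, rfl, ?_⟩⟩
        rw [h₁ _ hv (by simpa using hz), ← up, h]
      · refine ⟨by simpa using hz, Or.inr ⟨_, hv, rfl, ?_⟩⟩
        rw [h₂ _ hv (by simpa using hz), ← ri, h]
  · simp only [Ensemble.boundaryData, Ensemble.inducedBoundaryData, Set.mem_ofPred_eq, hω, hE,
      Subtype.exists, exists_prop]
    constructor
    · rintro ⟨hz, ⟨v, hv, rfl, h⟩ | ⟨v, hv, rfl, h⟩⟩
      · refine ⟨_, by simpa using hz, rfl, Or.inl ⟨by simpa using hv, ?_⟩⟩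
        rw [← up, ← h₃ _ hv (by simpa using hz), h]
      · refine ⟨_, by simpa using hz, rfl, Or.inr ⟨by simpa using hv, ?_⟩⟩
        rw [← ri, ← h₄ _ hv (by simpa using hz), h]
    · rintro ⟨v, hz, rfl, ⟨hv, h⟩ | ⟨hv, h⟩⟩
      · refine ⟨by simpa using hz, Or.inl ⟨_, hv, by simp, ?_⟩⟩
        rw [h₃ _ hv (by simpa using hz), up]
        simpa using h
      · refine ⟨by simpa using hz, Or.inr ⟨_, hv, by simp, ?_⟩⟩
        rw [h₄ _ hv (by simpa using hz), ri]
        simpa using h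

theorem Ensemble.weight_eq_prod_total (w : ArrowConfig → ℝ) {Λ : Finset (ℤ × ℤ)}
    (E : Ensemble (Λ : Set (ℤ × ℤ))) : E.weight w = ∏ v ∈ Λ, w (E.total v) := by
  rw [Ensemble.weight, Finset.prod_subtype Λ (p := fun v => v ∈ (Λ : Set (ℤ × ℤ)))
    (fun v => Finset.mem_coe.symm)]
  exact Finset.prod_congr rfl fun v _ => by rw [E.total_of_mem v.2]

theorem Ensemble.total_ext {Λ : Set (ℤ × ℤ)} {E F : Ensemble Λ}
    (h : ∀ v ∈ Λ, E.total v = F.total v) : E = F := by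
  apply Subtype.ext
  funext v
  have := h v v.2
  rwa [E.total_of_mem v.2, F.total_of_mem v.2] at this

theorem IsHeight.fits_ensemble {h : ℤ × ℤ → ℤ} (hh : IsHeight h) {Λ : Set (ℤ × ℤ)} {v : ℤ × ℤ}
    (hv : v ∈ Λ) : Fits h v ((hh.ensemble Λ).total v) := by
  rw [Ensemble.total_of_mem _ hv]
  exact hh.fits_config v

theorem Fits.congr {h k : ℤ × ℤ → ℤ} {v : ℤ × ℤ} {c : ArrowConfig} (hc : Fits h v c)
    (h1 : h (v.1, v.2) = k (v.1, v.2)) (h2 : h (v.1 - 1, v.2) = k (v.1 - 1, v.2))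
    (h3 : h (v.1, v.2 - 1) = k (v.1, v.2 - 1))
    (h4 : h (v.1 - 1, v.2 - 1) = k (v.1 - 1, v.2 - 1)) : Fits k v c := by
  simp only [Fits] at *
  omega

open Classical in
-- Gluing sends each nearly linear ensemble of the inner box to an ensemble of the square with the
-- required boundary data. The map is injective, since restriction to the inner box inverts it, and
-- it adds at most `4mN` vertices, each of weight at least `b`.
theorem partitionFunction_ge {s t c r : ℝ} (hs : c ≤ s) (hs' : c ≤ 1 - s) (ht : c ≤ t)
    (ht' : c ≤ 1 - t) (hc : 0 ≤ c) {m n N : ℕ} (hN : N = n + 2 * m) (hr : 2 * r ≤ c * m)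
    {w : ArrowConfig → ℝ} {b : ℝ} (hb : 0 ≤ b) (hb1 : b ≤ 1) (hw : ∀ c, b ≤ w c)
    (ω : Ensemble Set.univ) (hω : NearLinear s t r 0 N ω) :
    b ^ (4 * m * N) * ∑ E : Ensemble (box m n : Set (ℤ × ℤ)),
        (if NearLinear s t r m n E then E.weight w else 0)
      ≤ partitionFunction w (N := N) (ω.restrict Set.sdiff_subset) := by
  obtain ⟨k, hk, hkf, hkl⟩ := hω
  have hsub : box m n ⊆ square N := by
    intro v
    rw [← box_zero, mem_box, mem_box]
    push_cast [hN]
    omega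
  have main : ∀ E : Ensemble (box m n : Set (ℤ × ℤ)), NearLinear s t r m n E →
      ∃ F : Ensemble (square N : Set (ℤ × ℤ)), F.boundaryData = (ω.restrict
        (Set.sdiff_subset : Set.univ \ (square N : Set (ℤ × ℤ)) ⊆ Set.univ)).inducedBoundaryData ∧
        ∀ v ∈ box m n, F.total v = E.total v := by
    rintro E ⟨h₀, hh₀, h₀f, h₀l⟩
    obtain ⟨h, hh, h1, h2⟩ := exists_glued_height hs hs' ht ht' hc hN hr hk hh₀ hkl h₀l
    refine ⟨hh.ensemble _, ?_, ?_⟩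
    · have hf : ∀ v ∈ square N, Fits h v ((hh.ensemble (square N : Set (ℤ × ℤ))).total v) :=
        fun v hv => hh.fits_ensemble hv
      have hg : ∀ v ∈ square N, Fits k v (ω.total v) := fun v hv =>
        hkf v (by rwa [box_zero])
      have hg1 : ∀ p : ℤ × ℤ, (0 ≤ p.1 ∧ p.1 ≤ N) → (0 ≤ p.2 ∧ p.2 ≤ N) →
          (p.1 = 0 ∨ p.1 = N ∨ p.2 = 0 ∨ p.2 = N) → h p = k p := by
        intro p hp hp' hb
        exact h1 p (by rw [mem_grid]; simp only [zero_add]; exact ⟨hp, hp'⟩) hb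
      have mem : ∀ v : ℤ × ℤ, v ∈ (square N : Set (ℤ × ℤ)) ↔
          (0 < v.1 ∧ v.1 ≤ N) ∧ (0 < v.2 ∧ v.2 ≤ N) := by
        intro v
        rw [← box_zero, Finset.mem_coe, mem_box]
        simp
      apply boundaryData_eq
      · intro v hv hv'
        apply bool_eq_of_toNat
        rw [(hf v hv).1, (hg v hv).1]
        simp only [mem, Prod.fst_sub, Prod.snd_sub] at hv hv'
        rw [hg1, hg1] <;> simp only <;> omega
      · intro v hv hv'
        apply bool_eq_of_toNat
        rw [(hf v hv).2.1, (hg v hv).2.1]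
        simp only [mem, Prod.fst_sub, Prod.snd_sub] at hv hv'
        rw [hg1, hg1] <;> simp only <;> omega
      · intro v hv hv'
        apply bool_eq_of_toNat
        rw [(hf v hv).2.2.1, (hg v hv).2.2.1]
        simp only [mem, Prod.fst_add, Prod.snd_add] at hv hv'
        rw [hg1, hg1] <;> simp only <;> omega
      · intro v hv hv'
        apply bool_eq_of_toNat
        rw [(hf v hv).2.2.2, (hg v hv).2.2.2]
        simp only [mem, Prod.fst_add, Prod.snd_add] at hv hv'
        rw [hg1, hg1] <;> simp only <;> omega
    · intro v hv
      refine (hh.fits_ensemble (hsub hv)).unique ((h₀f v hv).congr ?_ ?_ ?_ ?_) <;>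
      · rw [mem_box] at hv
        refine (h2 _ ?_).symm
        rw [mem_grid]
        simp only
        omega
  have : Nonempty (Ensemble (square N : Set (ℤ × ℤ))) := ⟨hk.ensemble _⟩
  choose! F hF1 hF2 using main
  rw [Finset.mul_sum, ← Finset.sum_filter_add_sum_filter_not Finset.univ
    (fun E => NearLinear s t r m n E)]
  rw [Finset.sum_eq_zero (s := Finset.univ.filter fun E => ¬ NearLinear s t r m n E), add_zero]
  swap
  · intro E hE
    rw [if_neg (Finset.mem_filter.1 hE).2, mul_zero]
  have hw0 : ∀ c, 0 ≤ w c := fun c => hb.trans (hw c)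
  have hinj : Set.InjOn F ((Finset.univ.filter fun E => NearLinear s t r m n E :
      Finset (Ensemble (box m n : Set (ℤ × ℤ)))) : Set (Ensemble (box m n : Set (ℤ × ℤ)))) := by
    intro E hE E' hE' h
    simp only [Finset.coe_filter, Finset.mem_univ, true_and, Set.mem_ofPred_eq] at hE hE'
    apply Ensemble.total_ext
    intro v hv
    rw [← hF2 E hE v hv, ← hF2 E' hE' v hv, h]
  calc _ ≤ ∑ E ∈ Finset.univ.filter (fun E : Ensemble (box m n : Set (ℤ × ℤ)) =>
        NearLinear s t r m n E), (F E).weight w := by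
        refine Finset.sum_le_sum fun E hE => ?_
        have hE := (Finset.mem_filter.1 hE).2
        rw [if_pos hE, Ensemble.weight_eq_prod_total, Ensemble.weight_eq_prod_total,
          ← Finset.prod_sdiff hsub]
        refine mul_le_mul ?_ (le_of_eq (Finset.prod_congr rfl fun v hv => by rw [hF2 E hE v hv]))
          (Finset.prod_nonneg fun v _ => hw0 _) (Finset.prod_nonneg fun v _ => hw0 _)
        · have hcard : (square N \ box m n).card ≤ 4 * m * N := by
            rw [Finset.card_sdiff_of_subset hsub, ← box_zero, card_box, card_box, hN]
            have : (n + 2 * m) ^ 2 = n ^ 2 + (4 * m * n + 4 * m ^ 2) := by ring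
            rw [this, Nat.add_sub_cancel_left]
            nlinarith
          calc b ^ (4 * m * N) ≤ b ^ (square N \ box m n).card :=
                pow_le_pow_of_le_one hb hb1 hcard
            _ = ∏ v ∈ square N \ box m n, b := by rw [Finset.prod_const]
            _ ≤ _ := Finset.prod_le_prod (fun _ _ => hb) fun _ _ => hw _
    _ = ∑ G ∈ (Finset.univ.filter (fun E : Ensemble (box m n : Set (ℤ × ℤ)) =>
        NearLinear s t r m n E)).image F, G.weight w := (Finset.sum_image hinj).symm
    _ ≤ ∑ G ∈ Finset.univ.filter (fun G : Ensemble (square N : Set (ℤ × ℤ)) => G.boundaryData =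
        (ω.restrict (Set.sdiff_subset : Set.univ \ (square N : Set (ℤ × ℤ)) ⊆
          Set.univ)).inducedBoundaryData), G.weight w := by
        refine Finset.sum_le_sum_of_subset_of_nonneg ?_ ?_
        · intro G hG
          obtain ⟨E, hE, rfl⟩ := Finset.mem_image.1 hG
          exact Finset.mem_filter.2 ⟨Finset.mem_univ _, hF1 E (Finset.mem_filter.1 hE).2⟩
        · intro G _ _
          exact Finset.prod_nonneg fun v _ => hw0 _
    _ = _ := by rw [partitionFunction, Finset.sum_filter]

/-! ### The mean ergodic theorem for translations of the square lattice -/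

open Filter Topology in
-- The limit is obtained by projecting on the fixed space of `U`, then on that of `V`. It is still
-- fixed by `U` because `U` commutes with the averages of `V`. These averages are nonexpansive, so
-- the error of the inner average is not amplified and the two lengths may tend to infinity
-- independently. An invariant functional takes the same value on all averages, which identifies its
-- value on the limit.
theorem mean_ergodic_commuting {H : Type*} [NormedAddCommGroup H] [InnerProductSpace ℝ H]
    [CompleteSpace H] (U V : H →L[ℝ] H) (hU : ‖U‖ ≤ 1) (hV : ‖V‖ ≤ 1)
    (hUV : ∀ x, U (V x) = V (U x)) (f : H) (φ : H →L[ℝ] ℝ) (hφU : ∀ x, φ (U x) = φ x)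
    (hφV : ∀ x, φ (V x) = φ x) :
    ∃ g, U g = g ∧ V g = g ∧ φ g = φ f ∧
      Tendsto (fun i : ℕ × ℕ => birkhoffAverage ℝ V id i.2 (birkhoffAverage ℝ U id i.1 f))
        (atTop ×ˢ atTop) (𝓝 g) := by
  set P := (U.eqLocus (1 : H →L[ℝ] H)).orthogonalProjectionOnto f with hP
  set Q := (V.eqLocus (1 : H →L[ℝ] H)).orthogonalProjectionOnto (P : H) with hQ
  have hPt := U.tendsto_birkhoffAverage_orthogonalProjection hU f
  have hQt := V.tendsto_birkhoffAverage_orthogonalProjection hV (P : H)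
  have hPU : U P = P := by have := P.2; simpa using this
  have hQV : V Q = Q := by have := Q.2; simpa using this
  have fixφ : ∀ (W : H →L[ℝ] H), (∀ x, φ (W x) = φ x) → ∀ x y : H,
      Tendsto (fun n => birkhoffAverage ℝ W id n x) atTop (𝓝 y) → φ y = φ x := by
    intro W hW x y h
    have h1 := (φ.continuous.tendsto y).comp h
    have h2 : Tendsto (fun n => φ (birkhoffAverage ℝ W id n x)) atTop (𝓝 (φ x)) := by
      refine tendsto_const_nhds.congr' ?_
      filter_upwards [eventually_ne_atTop 0] with n hn
      rw [map_birkhoffAverage ℝ ℝ φ]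
      have : birkhoffSum W (φ ∘ id) n x = n • φ x := by
        have hit : ∀ k, φ (W^[k] x) = φ x := by
          intro k
          induction k with
          | zero => rfl
          | succ k ih => rw [Function.iterate_succ_apply', hW, ih]
        simp [birkhoffSum, hit]
      rw [birkhoffAverage, this]
      field_simp
      simp [hn]
    exact tendsto_nhds_unique h1 h2
  refine ⟨Q, ?_, hQV, ?_, ?_⟩
  · have h1 : Tendsto (fun n => U (birkhoffAverage ℝ V id n (P : H))) atTop (𝓝 (U Q)) :=
      (U.continuous.tendsto _).comp hQt
    refine tendsto_nhds_unique (h1.congr fun n => ?_) hQt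
    rw [map_birkhoffAverage ℝ ℝ U]
    simp only [birkhoffAverage, birkhoffSum]
    congr 1
    refine Finset.sum_congr rfl fun k _ => ?_
    change U (V^[k] (P : H)) = V^[k] (P : H)
    clear * - hPU hUV
    induction k with
    | zero => exact hPU
    | succ k ih => rw [Function.iterate_succ_apply', hUV, ih]
  · rw [fixφ V hφV _ _ hQt, fixφ U hφU _ _ hPt]
  · have nonexp : ∀ n (x y : H), dist (birkhoffAverage ℝ V id n x) (birkhoffAverage ℝ V id n y)
        ≤ dist x y := by
      intro n x y
      refine (dist_birkhoffAverage_birkhoffAverage_le ℝ V id n x y).trans ?_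
      rcases Nat.eq_zero_or_pos n with rfl | hn
      · simp
      rw [div_le_iff₀ (by positivity), mul_comm, ← nsmul_eq_mul]
      calc _ ≤ ∑ _k ∈ Finset.range n, dist x y := Finset.sum_le_sum fun k _ => by
            have := ((V.lipschitz.weaken (K' := 1) hV).iterate k).dist_le_mul x y
            simpa using this
        _ = _ := by simp
    rw [tendsto_iff_dist_tendsto_zero]
    have h1 : Tendsto (fun i : ℕ × ℕ => dist (birkhoffAverage ℝ U id i.1 f) (P : H) +
        dist (birkhoffAverage ℝ V id i.2 (P : H)) (Q : H)) (atTop ×ˢ atTop) (𝓝 (0 + 0)) :=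
      ((tendsto_iff_dist_tendsto_zero.1 hPt).comp tendsto_fst).add
        ((tendsto_iff_dist_tendsto_zero.1 hQt).comp tendsto_snd)
    rw [add_zero] at h1
    refine squeeze_zero (fun _ => dist_nonneg) (fun i => ?_) h1
    exact (dist_triangle _ (birkhoffAverage ℝ V id i.2 (P : H)) _).trans
      (add_le_add_left (nonexp _ _ _) _)

/-! ### Translations of ensembles and convergence of spatial averages -/

theorem Ensemble.measurable_translate (u : ℤ × ℤ) : Measurable (Ensemble.translate u) := by
  have h : Measurable fun (E : Ensemble Set.univ) => (Ensemble.translate u E).1 :=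
    measurable_pi_lambda _ fun v =>
      Ensemble.measurable_config ⟨(v : ℤ × ℤ) + u, Set.mem_univ _⟩
  exact h.subtype_mk

theorem Ensemble.translate_total (u v : ℤ × ℤ) (E : Ensemble Set.univ) :
    (Ensemble.translate u E).total v = E.total (v + u) := by
  rw [Ensemble.total_of_mem _ (Set.mem_univ _), Ensemble.total_of_mem _ (Set.mem_univ _)]
  rfl

theorem Ensemble.translate_translate (u v : ℤ × ℤ) (E : Ensemble Set.univ) :
    Ensemble.translate u (Ensemble.translate v E) = Ensemble.translate (u + v) E :=
  Ensemble.total_ext fun w _ => by simp only [Ensemble.translate_total, add_assoc]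

theorem Ensemble.translate_zero (E : Ensemble Set.univ) : Ensemble.translate 0 E = E :=
  Ensemble.total_ext fun w _ => by simp only [Ensemble.translate_total, add_zero]

theorem IsTranslationInvariant.measurePreserving {μ : Measure (Ensemble Set.univ)}
    (h : IsTranslationInvariant μ) (u : ℤ × ℤ) : MeasurePreserving (Ensemble.translate u) μ μ :=
  ⟨Ensemble.measurable_translate u, h u⟩

theorem Ensemble.translate_iterate (u : ℤ × ℤ) (k : ℕ) :
    (Ensemble.translate u)^[k] = Ensemble.translate (k • u) := by
  induction k with
  | zero => funext E; simp [Ensemble.translate_zero]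
  | succ k ih =>
    funext E
    rw [Function.iterate_succ_apply', ih, Ensemble.translate_translate, succ_nsmul']

open Filter in
/-- An almost everywhere translation-invariant function is almost everywhere constant. -/
theorem ae_const_of_invariant {μ : Measure (Ensemble Set.univ)}
    [IsProbabilityMeasure μ] (hinv : IsTranslationInvariant μ)
    (herg : ∀ A : Set (Ensemble Set.univ), MeasurableSet A →
      (∀ u : ℤ × ℤ, Ensemble.translate u '' A = A) → μ A = 0 ∨ μ A = 1)
    {g : Ensemble Set.univ → ℝ} (hg : Measurable g)
    (h₁ : g ∘ Ensemble.translate (1, 0) =ᵐ[μ] g) (h₂ : g ∘ Ensemble.translate (0, 1) =ᵐ[μ] g) :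
    ∃ c, g =ᵐ[μ] fun _ => c := by
  -- The translations that fix `g` almost everywhere form a subgroup, so the two generators suffice.
  let S : AddSubgroup (ℤ × ℤ) :=
    { carrier := {u | g ∘ Ensemble.translate u =ᵐ[μ] g}
      zero_mem' := by
        change g ∘ Ensemble.translate 0 =ᵐ[μ] g
        filter_upwards with E
        rw [Function.comp_apply, Ensemble.translate_zero]
      add_mem' := by
        intro u v hu hv
        change g ∘ Ensemble.translate (u + v) =ᵐ[μ] g
        have := (hinv.measurePreserving v).quasiMeasurePreserving.ae_eq_comp hu
        filter_upwards [this, hv] with E h1 h2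
        simp only [Function.comp_apply, Ensemble.translate_translate] at h1 h2 ⊢
        rw [h1, h2]
      neg_mem' := by
        intro u hu
        change g ∘ Ensemble.translate (-u) =ᵐ[μ] g
        have := (hinv.measurePreserving (-u)).quasiMeasurePreserving.ae_eq_comp hu
        filter_upwards [this] with E h1
        simp only [Function.comp_apply, Ensemble.translate_translate, add_neg_cancel,
          Ensemble.translate_zero] at h1 ⊢
        exact h1.symm }
  have hS : ∀ u : ℤ × ℤ, g ∘ Ensemble.translate u =ᵐ[μ] g := by
    intro u
    have : u ∈ S := by
      have h1 : u = u.1 • ((1, 0) : ℤ × ℤ) + u.2 • ((0, 1) : ℤ × ℤ) := by ext <;> simp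
      rw [h1]
      exact S.add_mem (S.zsmul_mem h₁ _) (S.zsmul_mem h₂ _)
    exact this
  refine exists_eventuallyEq_const_of_forall_separating (f := g) MeasurableSet fun B hB => ?_
  -- Ergodicity is assumed for strictly invariant sets only. Intersecting all translates of the
  -- preimage of `B` gives such a set, and as there are countably many translations it differs from
  -- the preimage by a null set.
  set A : Set (Ensemble Set.univ) := ⋂ u : ℤ × ℤ, (g ∘ Ensemble.translate u) ⁻¹' B with hA
  have hAm : MeasurableSet A := MeasurableSet.iInter fun u =>
    (hg.comp (Ensemble.measurable_translate u)) hB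
  have hAmem : ∀ E, E ∈ A ↔ ∀ u, g (Ensemble.translate u E) ∈ B := fun E => by
    simp [hA]
  have hAi : ∀ u : ℤ × ℤ, Ensemble.translate u '' A = A := by
    intro u
    ext E
    constructor
    · rintro ⟨F, hF, rfl⟩
      rw [hAmem] at hF ⊢
      intro v
      rw [Ensemble.translate_translate]
      exact hF _
    · intro hE
      refine ⟨Ensemble.translate (-u) E, ?_, ?_⟩
      · rw [hAmem] at hE ⊢
        intro v
        rw [Ensemble.translate_translate]
        exact hE _
      · rw [Ensemble.translate_translate, add_neg_cancel, Ensemble.translate_zero]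
  have hae : ∀ᵐ E ∂μ, (E ∈ A ↔ g E ∈ B) := by
    have : ∀ᵐ E ∂μ, ∀ u : ℤ × ℤ, g (Ensemble.translate u E) = g E := ae_all_iff.2 hS
    filter_upwards [this] with E hE
    simp [hAmem, hE]
  rcases herg A hAm hAi with h | h
  · right
    have : ∀ᵐ E ∂μ, E ∉ A := by rwa [← measure_eq_zero_iff_ae_notMem]
    filter_upwards [this, hae] with E h1 h2
    rwa [← h2]
  · left
    have : ∀ᵐ E ∂μ, E ∈ A := (mem_ae_iff_prob_eq_one hAm).2 h
    filter_upwards [this, hae] with E h1 h2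
    rwa [← h2]

theorem coeFn_birkhoffAverage {α : Type*} [MeasurableSpace α] {μ : Measure α} (T : α → α)
    (hT : MeasurePreserving T μ μ) {x : Lp ℝ 2 μ} {F : α → ℝ} (hx : x =ᵐ[μ] F) (N : ℕ) :
    (birkhoffAverage ℝ (Lp.compMeasurePreservingₗᵢ ℝ (E := ℝ) (p := 2) T hT) id N x : Lp ℝ 2 μ)
      =ᵐ[μ] fun a => (N : ℝ)⁻¹ * ∑ k ∈ Finset.range N, F (T^[k] a) := by
  have hit : ∀ k : ℕ, (((Lp.compMeasurePreservingₗᵢ ℝ (E := ℝ) (p := 2) T hT)^[k] x : Lp ℝ 2 μ))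
      =ᵐ[μ] fun a => F (T^[k] a) := by
    intro k
    induction k with
    | zero => exact hx
    | succ k ih =>
      rw [Function.iterate_succ_apply']
      refine (Lp.coeFn_compMeasurePreserving _ hT).trans ?_
      have := hT.quasiMeasurePreserving.ae_eq_comp ih
      exact this
  have hsum : ((birkhoffSum (Lp.compMeasurePreservingₗᵢ ℝ (E := ℝ) (p := 2) T hT) id N x :
      Lp ℝ 2 μ)) =ᵐ[μ] fun a => ∑ k ∈ Finset.range N, F (T^[k] a) := by
    induction N with
    | zero =>
      filter_upwards [Lp.coeFn_zero ℝ 2 μ] with a ha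
      simpa using ha
    | succ N ih =>
      rw [birkhoffSum_succ]
      filter_upwards [Lp.coeFn_add (birkhoffSum (Lp.compMeasurePreservingₗᵢ ℝ (E := ℝ) (p := 2)
        T hT) id N x) ((Lp.compMeasurePreservingₗᵢ ℝ (E := ℝ) (p := 2) T hT)^[N] x), ih, hit N]
        with a h1 h2 h3
      rw [id, h1, Pi.add_apply, h2, h3, Finset.sum_range_succ]
  rw [birkhoffAverage]
  filter_upwards [Lp.coeFn_smul (N : ℝ)⁻¹ (birkhoffSum (Lp.compMeasurePreservingₗᵢ ℝ (E := ℝ)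
    (p := 2) T hT) id N x), hsum] with a h1 h2
  rw [h1, Pi.smul_apply, h2, smul_eq_mul]

open Filter Topology in
-- The mean ergodic theorem is applied to the Koopman operators of the two unit translations on
-- `L²`. The limit is invariant, hence constant by ergodicity; pairing with the constant 1 shows
-- that the constant is the mean. Convergence in `L²` then yields convergence in measure.
theorem tendsto_measure_average {μ : Measure (Ensemble Set.univ)}
    [IsProbabilityMeasure μ] (hinv : IsTranslationInvariant μ)
    (herg : ∀ A : Set (Ensemble Set.univ), MeasurableSet A →
      (∀ u : ℤ × ℤ, Ensemble.translate u '' A = A) → μ A = 0 ∨ μ A = 1)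
    {F : Ensemble Set.univ → ℝ} (hF : MemLp F 2 μ) {ε : ℝ} (hε : 0 < ε) :
    Tendsto (fun i : ℕ × ℕ => μ {E | ε ≤ |(i.2 : ℝ)⁻¹ * ∑ l ∈ Finset.range i.2, ((i.1 : ℝ)⁻¹ *
      ∑ k ∈ Finset.range i.1, F (Ensemble.translate (k, l) E)) - ∫ E, F E ∂μ|})
      (atTop ×ˢ atTop) (𝓝 0) := by
  set T₁ := Ensemble.translate (1, 0)
  set T₂ := Ensemble.translate (0, 1)
  have m₁ : MeasurePreserving T₁ μ μ := hinv.measurePreserving _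
  have m₂ : MeasurePreserving T₂ μ μ := hinv.measurePreserving _
  set U := (Lp.compMeasurePreservingₗᵢ ℝ (E := ℝ) (p := 2) T₁ m₁).toContinuousLinearMap
  set V := (Lp.compMeasurePreservingₗᵢ ℝ (E := ℝ) (p := 2) T₂ m₂).toContinuousLinearMap
  set φ : Lp ℝ 2 μ →L[ℝ] ℝ := innerSL ℝ (indicatorConstLp 2 MeasurableSet.univ
    (measure_ne_top μ _) (1 : ℝ)) with hφ
  have hφi : ∀ x : Lp ℝ 2 μ, φ x = ∫ E, x E ∂μ := by
    intro x
    rw [hφ, innerSL_apply_apply, L2.inner_indicatorConstLp_one, setIntegral_univ]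
  have hUc : ∀ x : Lp ℝ 2 μ, U x =ᵐ[μ] x ∘ T₁ := fun x => Lp.coeFn_compMeasurePreserving x m₁
  have hVc : ∀ x : Lp ℝ 2 μ, V x =ᵐ[μ] x ∘ T₂ := fun x => Lp.coeFn_compMeasurePreserving x m₂
  have hint : ∀ (T : Ensemble Set.univ → Ensemble Set.univ) (hT : MeasurePreserving T μ μ)
      (x : Lp ℝ 2 μ), ∫ E, x (T E) ∂μ = ∫ E, x E ∂μ := by
    intro T hT x
    have := integral_map (μ := μ) hT.measurable.aemeasurable (f := fun E => x E)
      (by rw [hT.map_eq]; exact Lp.aestronglyMeasurable x)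
    rw [hT.map_eq] at this
    exact this.symm
  obtain ⟨g, hgU, hgV, hgφ, hg⟩ := mean_ergodic_commuting U V
    (LinearIsometry.norm_toContinuousLinearMap_le _) (LinearIsometry.norm_toContinuousLinearMap_le _)
    (by
      intro x
      apply Lp.ext
      filter_upwards [hUc (V x), hVc (U x), m₁.quasiMeasurePreserving.ae_eq_comp (hVc x),
        m₂.quasiMeasurePreserving.ae_eq_comp (hUc x)] with E h1 h2 h3 h4
      simp only [Function.comp_apply] at h1 h2 h3 h4
      rw [h1, h2, h3, h4]
      simp only [T₁, T₂]
      rw [Ensemble.translate_translate, Ensemble.translate_translate, add_comm])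
    (hF.toLp F) φ
    (by intro x; rw [hφi, hφi, integral_congr_ae (hUc x)]; exact hint _ m₁ x)
    (by intro x; rw [hφi, hφi, integral_congr_ae (hVc x)]; exact hint _ m₂ x)
  have hgs := Lp.aestronglyMeasurable g
  obtain ⟨c, hc⟩ : ∃ c, hgs.mk =ᵐ[μ] fun _ => c := by
    refine ae_const_of_invariant hinv herg hgs.stronglyMeasurable_mk.measurable ?_ ?_
    · have h1 := hUc g
      rw [hgU] at h1
      exact ((m₁.quasiMeasurePreserving.ae_eq_comp hgs.ae_eq_mk).symm.trans h1.symm).trans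
        hgs.ae_eq_mk
    · have h1 := hVc g
      rw [hgV] at h1
      exact ((m₂.quasiMeasurePreserving.ae_eq_comp hgs.ae_eq_mk).symm.trans h1.symm).trans
        hgs.ae_eq_mk
  have hgc : g =ᵐ[μ] fun _ => c := hgs.ae_eq_mk.trans hc
  have hcF : c = ∫ E, F E ∂μ := by
    rw [hφi, hφi, integral_congr_ae hgc, integral_congr_ae hF.coeFn_toLp] at hgφ
    simpa using hgφ
  have h3 := tendstoInMeasure_iff_norm.1 ((tendstoInMeasure_of_tendsto_Lp hg).congr_right hgc) ε hε
  refine h3.congr fun i => ?_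
  have e1 := coeFn_birkhoffAverage T₁ m₁ hF.coeFn_toLp i.1
  have e2 := coeFn_birkhoffAverage T₂ m₂ e1 i.2
  refine measure_congr (Filter.Eventually.set_eq ?_)
  filter_upwards [e2] with E hE
  change (ε ≤ ‖(birkhoffAverage ℝ (Lp.compMeasurePreservingₗᵢ ℝ (E := ℝ) (p := 2) T₂ m₂) id i.2
    (birkhoffAverage ℝ (Lp.compMeasurePreservingₗᵢ ℝ (E := ℝ) (p := 2) T₁ m₁) id i.1
      (hF.toLp F))) E - c‖) ↔ _
  rw [hE, hcF, Real.norm_eq_abs]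
  simp only [T₁, T₂, Ensemble.translate_iterate, Ensemble.translate_translate]
  simp

/-! ### Pure states are nearly linear -/

theorem IsHeight.abs_sub_le {h : ℤ × ℤ → ℤ} (hh : IsHeight h) (p q : ℤ × ℤ) :
    |h p - h q| ≤ |p.1 - q.1| + |p.2 - q.2| := by
  have h1 := hh.le_add_gap q p
  have h2 := hh.le_add_gap p q
  simp only [gap, abs_eq_max_neg] at *
  omega

/-- Each point has a control point at distance at most `m` in each coordinate, and between the two
both the height and the linear profile vary by at most `2m`. -/
theorem near_linear_of_subgrid {s t r : ℝ} (hs : 0 ≤ s) (hs1 : s ≤ 1) (ht : 0 ≤ t) (ht1 : t ≤ 1)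
    {h : ℤ × ℤ → ℤ} (hh : IsHeight h) {c : ℤ} {m n : ℕ} (hm : 0 < m)
    (hg : ∀ i j : ℕ, i * m ≤ n → j * m ≤ n →
      |(h (c + (i * m : ℕ), c + (j * m : ℕ)) : ℝ) -
        (s * (c + (i * m : ℕ) : ℝ) - t * (c + (j * m : ℕ) : ℝ))| ≤ r)
    (p : ℤ × ℤ) (hp : p ∈ grid c n) :
    |(h p : ℝ) - (s * p.1 - t * p.2)| ≤ r + 4 * m := by
  rw [mem_grid] at hp
  obtain ⟨k, hk⟩ : ∃ k : ℕ, p.1 = c + k := ⟨(p.1 - c).toNat, by omega⟩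
  obtain ⟨l, hl⟩ : ∃ l : ℕ, p.2 = c + l := ⟨(p.2 - c).toNat, by omega⟩
  have hkd := Nat.div_add_mod k m
  have hld := Nat.div_add_mod l m
  have hkm := Nat.mod_lt k hm
  have hlm := Nat.mod_lt l hm
  have hi : k / m * m ≤ n := by rw [mul_comm]; omega
  have hj : l / m * m ≤ n := by rw [mul_comm]; omega
  have h1 := hg (k / m) (l / m) hi hj
  set i := k / m * m with hidef
  set j := l / m * m with hjdef
  have hi' : i ≤ k ∧ k ≤ i + m := by rw [hidef, mul_comm]; omega
  have hj' : j ≤ l ∧ l ≤ j + m := by rw [hjdef, mul_comm]; omega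
  have h2 : |(h p : ℝ) - h (c + i, c + j)| ≤ 2 * m := by
    have := hh.abs_sub_le p (c + i, c + j)
    have h3 : |h p - h (c + i, c + j)| ≤ 2 * m := by
      refine this.trans ?_
      simp only [abs_eq_max_neg]
      omega
    exact_mod_cast h3
  have e1 : (p.1 : ℝ) = c + k := by exact_mod_cast hk
  have e2 : (p.2 : ℝ) = c + l := by exact_mod_cast hl
  have ki1 : (i : ℝ) ≤ k := by exact_mod_cast hi'.1
  have ki2 : (k : ℝ) ≤ i + m := by exact_mod_cast hi'.2
  have lj1 : (j : ℝ) ≤ l := by exact_mod_cast hj'.1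
  have lj2 : (l : ℝ) ≤ j + m := by exact_mod_cast hj'.2
  rw [e1, e2]
  rw [abs_le] at h1 h2 ⊢
  have a1 : s * (k - i) ≤ m := by nlinarith
  have a2 : 0 ≤ s * (k - i) := mul_nonneg hs (by linarith)
  have a3 : t * (l - j) ≤ m := by nlinarith
  have a4 : 0 ≤ t * (l - j) := mul_nonneg ht (by linarith)
  constructor <;> nlinarith

theorem sum_i₂_eq {h : ℤ × ℤ → ℤ} {c : ℤ × ℤ → ArrowConfig} {a b : ℤ} {N : ℕ}
    (hf : ∀ k : ℕ, k < N → Fits h (a + k, b) (c (a + k, b))) :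
    ∑ k ∈ Finset.range N, ((c (a + k, b)).i₂.toNat : ℤ) = h (a + N - 1, b) - h (a - 1, b) := by
  induction N with
  | zero => simp
  | succ N ih =>
    rw [Finset.sum_range_succ, ih fun k hk => hf k (by omega), (hf N (by omega)).2.2.1]
    simp only
    push_cast
    rw [← add_assoc, add_sub_cancel_right]
    ring

theorem sum_j₂_eq {h : ℤ × ℤ → ℤ} {c : ℤ × ℤ → ArrowConfig} {a b : ℤ} {N : ℕ}
    (hf : ∀ k : ℕ, k < N → Fits h (a, b + k) (c (a, b + k))) :
    ∑ k ∈ Finset.range N, ((c (a, b + k)).j₂.toNat : ℤ) = h (a, b - 1) - h (a, b + N - 1) := by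
  induction N with
  | zero => simp
  | succ N ih =>
    rw [Finset.sum_range_succ, ih fun k hk => hf k (by omega), (hf N (by omega)).2.2.2]
    simp only
    push_cast
    rw [← add_assoc, add_sub_cancel_right]
    ring

/-- A row sum is the difference of the heights at the two ends of the row. Moving up by `l` lowers
both heights by amounts between 0 and `l`. -/
theorem abs_rowSum_sub_le (E : Ensemble Set.univ) (N l : ℕ) :
    |∑ k ∈ Finset.range N, ((E.total (k, 0)).i₂.toNat : ℝ) -
      ∑ k ∈ Finset.range N, ((E.total (k, l)).i₂.toNat : ℝ)| ≤ l := by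
  obtain ⟨h, hh, -, hf⟩ := E.exists_height (-1) (N + l + 1) (Set.subset_univ _)
  have key : ∀ b : ℕ, b ≤ l → ∑ k ∈ Finset.range N, ((E.total (k, b)).i₂.toNat : ℤ) =
      h (0 + N - 1, b) - h (0 - 1, b) := by
    intro b hb
    rw [← sum_i₂_eq (h := h) (c := E.total)]
    · simp
    · intro k hk
      apply hf
      rw [mem_box]
      push_cast
      constructor <;> constructor <;> omega
  have h0 := key 0 (by omega)
  have h1 := key l le_rfl
  have e2 := hh.le_add_gap (0 + N - 1, (0 : ℕ)) (0 + N - 1, l)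
  have e3 := hh.le_add_gap (0 + N - 1, l) (0 + N - 1, (0 : ℕ))
  have e4 := hh.le_add_gap (0 - 1, (0 : ℕ)) (0 - 1, l)
  have e5 := hh.le_add_gap (0 - 1, l) (0 - 1, (0 : ℕ))
  simp only [gap] at e2 e3 e4 e5
  have : |∑ k ∈ Finset.range N, ((E.total (k, 0)).i₂.toNat : ℤ) -
      ∑ k ∈ Finset.range N, ((E.total (k, l)).i₂.toNat : ℤ)| ≤ l := by
    push_cast at h0
    rw [h0, h1]
    rw [abs_eq_max_neg]
    push_cast at *
    omega
  exact_mod_cast this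

theorem abs_colSum_sub_le (E : Ensemble Set.univ) (N l : ℕ) :
    |∑ k ∈ Finset.range N, ((E.total (0, k)).j₂.toNat : ℝ) -
      ∑ k ∈ Finset.range N, ((E.total (l, k)).j₂.toNat : ℝ)| ≤ l := by
  obtain ⟨h, hh, -, hf⟩ := E.exists_height (-1) (N + l + 1) (Set.subset_univ _)
  have key : ∀ b : ℕ, b ≤ l → ∑ k ∈ Finset.range N, ((E.total (b, k)).j₂.toNat : ℤ) =
      h (b, 0 - 1) - h (b, 0 + N - 1) := by
    intro b hb
    rw [← sum_j₂_eq (h := h) (c := E.total)]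
    · simp
    · intro k hk
      apply hf
      rw [mem_box]
      push_cast
      constructor <;> constructor <;> omega
  have h0 := key 0 (by omega)
  have h1 := key l le_rfl
  have e2 := hh.le_add_gap ((0 : ℕ), 0 + N - 1) (l, 0 + N - 1)
  have e3 := hh.le_add_gap (l, 0 + N - 1) ((0 : ℕ), 0 + N - 1)
  have e4 := hh.le_add_gap ((0 : ℕ), 0 - 1) (l, 0 - 1)
  have e5 := hh.le_add_gap (l, 0 - 1) ((0 : ℕ), 0 - 1)
  simp only [gap] at e2 e3 e4 e5
  have : |∑ k ∈ Finset.range N, ((E.total (0, k)).j₂.toNat : ℤ) -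
      ∑ k ∈ Finset.range N, ((E.total (l, k)).j₂.toNat : ℤ)| ≤ l := by
    push_cast at h0
    rw [h0, h1]
    rw [abs_eq_max_neg]
    push_cast at *
    omega
  exact_mod_cast this

open Filter Topology in
-- The ergodic theorem averages over rectangles. A rectangle of height a small multiple of `N` is
-- still large, while all its row sums are close to the bottom one, which therefore obeys the same
-- law.
theorem tendsto_measure_line {Ω : Type*} [MeasurableSpace Ω] {μ : Measure Ω} {s : ℝ}
    {R : ℕ → ℕ → Ω → ℝ} (hR : ∀ N l E, |R N 0 E - R N l E| ≤ l)
    (h : ∀ ε > 0, Tendsto (fun i : ℕ × ℕ => μ {E | ε ≤ |(i.2 : ℝ)⁻¹ *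
      ∑ l ∈ Finset.range i.2, ((i.1 : ℝ)⁻¹ * R i.1 l E) - s|}) (atTop ×ˢ atTop) (𝓝 0))
    {ε : ℝ} (hε : 0 < ε) :
    Tendsto (fun N : ℕ => μ {E | ε * N ≤ |R N 0 E - s * N|}) atTop (𝓝 0) := by
  have hL : Tendsto (fun N : ℕ => ⌈ε / 2 * N⌉₊) atTop atTop :=
    tendsto_nat_ceil_atTop.comp (tendsto_natCast_atTop_atTop.const_mul_atTop (by positivity))
  have h1 := (h (ε / 4) (by positivity)).comp (tendsto_id.prodMk hL)
  refine tendsto_of_tendsto_of_tendsto_of_le_of_le' tendsto_const_nhds h1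
    (Eventually.of_forall fun _ => zero_le) ?_
  have h2 : ∀ᶠ N : ℕ in atTop, 4 / ε ≤ N := tendsto_natCast_atTop_atTop.eventually_ge_atTop _
  filter_upwards [h2, eventually_gt_atTop 0] with N hN hN0
  refine measure_mono fun E hE => ?_
  simp only [Set.mem_ofPred_eq, id] at hE ⊢
  set L := ⌈ε / 2 * N⌉₊ with hLdef
  have hN0' : (0 : ℝ) < N := by exact_mod_cast hN0
  have hL0 : 0 < L := Nat.ceil_pos.2 (by positivity)
  have hL0' : (0 : ℝ) < L := by exact_mod_cast hL0
  have hL1 : (L : ℝ) < ε / 2 * N + 1 := Nat.ceil_lt_add_one (by positivity)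
  have hNε : 4 ≤ ε * N := by rw [div_le_iff₀ hε] at hN; linarith
  have h3 : |R N 0 E - N * ((L : ℝ)⁻¹ * ∑ l ∈ Finset.range L, ((N : ℝ)⁻¹ * R N l E))| ≤ L := by
    have e : R N 0 E - N * ((L : ℝ)⁻¹ * ∑ l ∈ Finset.range L, ((N : ℝ)⁻¹ * R N l E)) =
        (L : ℝ)⁻¹ * ∑ l ∈ Finset.range L, (R N 0 E - R N l E) := by
      rw [← Finset.mul_sum, Finset.sum_sub_distrib]
      simp only [Finset.sum_const, Finset.card_range, nsmul_eq_mul]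
      field_simp
    rw [e, abs_mul, abs_of_pos (inv_pos.2 hL0'), inv_mul_le_iff₀ hL0']
    calc _ ≤ ∑ l ∈ Finset.range L, |R N 0 E - R N l E| := Finset.abs_sum_le_sum_abs _ _
      _ ≤ ∑ l ∈ Finset.range L, (L : ℝ) := Finset.sum_le_sum fun l hl => (hR N l E).trans (by
          exact_mod_cast (Finset.mem_range.1 hl).le)
      _ = _ := by simp
  set A := (L : ℝ)⁻¹ * ∑ l ∈ Finset.range L, ((N : ℝ)⁻¹ * R N l E)
  have h4 : |R N 0 E - s * N| ≤ |R N 0 E - N * A| + N * |A - s| := by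
    rw [← abs_of_pos hN0', ← abs_mul, abs_of_pos hN0']
    refine le_trans (le_of_eq ?_) (abs_add_le _ _)
    ring_nf
  have h5 : ε / 4 * N ≤ N * |A - s| := by linarith
  rw [mul_comm] at h5
  exact le_of_mul_le_mul_left h5 hN0'

theorem Ensemble.chiV_eq (E : Ensemble Set.univ) (v : ℤ × ℤ) :
    E.chiV ⟨v, Set.mem_univ _⟩ = ((E.total v).i₂.toNat : ℝ) := by
  rw [Ensemble.chiV, E.total_of_mem (Set.mem_univ _)]
  cases (E.config ⟨v, Set.mem_univ _⟩).i₂ <;> simp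

theorem Ensemble.chiH_eq (E : Ensemble Set.univ) (v : ℤ × ℤ) :
    E.chiH ⟨v, Set.mem_univ _⟩ = ((E.total v).j₂.toNat : ℝ) := by
  rw [Ensemble.chiH, E.total_of_mem (Set.mem_univ _)]
  cases (E.config ⟨v, Set.mem_univ _⟩).j₂ <;> simp

theorem measurable_of_total {β : Type*} [MeasurableSpace β] (v : ℤ × ℤ) (f : ArrowConfig → β) :
    Measurable fun E : Ensemble Set.univ => f (E.total v) := by
  have : (fun E : Ensemble Set.univ => f (E.total v)) =
      fun E => f (E.config ⟨v, Set.mem_univ _⟩) := by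
    funext E
    rw [E.total_of_mem (Set.mem_univ _)]
  rw [this]
  exact (measurable_of_finite f).comp (Ensemble.measurable_config _)

open Filter Topology in
-- Translation invariance makes the threshold `n₀` independent of the starting point `(a, b)`, as
-- the union bound over many lines requires.
theorem IsPureState.measure_row {w : ArrowConfig → ℝ} {μ : Measure (Ensemble Set.univ)}
    (hμ : IsPureState w μ) {ε δ : ℝ} (hε : 0 < ε) (hδ : 0 < δ) :
    ∃ n₀ : ℕ, ∀ N ≥ n₀, ∀ a b : ℤ, μ {E | ε * N ≤ |∑ k ∈ Finset.range N,
      ((E.total (a + k, b)).i₂.toNat : ℝ) - (slope μ).1 * N|} ≤ ENNReal.ofReal δ := by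
  have := hμ.isProbabilityMeasure
  have hinv := hμ.isTranslationInvariant
  set F : Ensemble Set.univ → ℝ := fun E => ((E.total (0, 0)).i₂.toNat : ℝ) with hF
  have hFm : Measurable F := measurable_of_total (0, 0) fun c => (c.i₂.toNat : ℝ)
  have hF2 : MemLp F 2 μ := MemLp.of_bound hFm.aestronglyMeasurable 1 (by
    filter_upwards with E
    simp only [hF]
    cases (E.total (0, 0)).i₂ <;> simp)
  have hs : (slope μ).1 = ∫ E, F E ∂μ := by
    simp only [slope]
    exact integral_congr_ae (by filter_upwards with E; exact E.chiV_eq _)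
  have h1 := tendsto_measure_line (μ := μ) (s := (slope μ).1)
    (R := fun N l E => ∑ k ∈ Finset.range N, ((E.total (k, l)).i₂.toNat : ℝ))
    (fun N l E => abs_rowSum_sub_le E N l) (fun ε hε => by
      rw [hs]
      refine (tendsto_measure_average hinv hμ.ergodic hF2 hε).congr fun i => ?_
      simp only [hF, Ensemble.translate_total, zero_add, Prod.mk_zero_zero]) hε
  obtain ⟨n₀, hn₀⟩ := eventually_atTop.1 (h1.eventually (gt_mem_nhds (ENNReal.ofReal_pos.2 hδ)))
  refine ⟨n₀, fun N hN a b => ?_⟩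
  refine le_trans (le_of_eq ?_) (hn₀ N hN).le
  refine Eq.trans ?_ ((hinv.measurePreserving (a, b)).measure_preimage ?_)
  · refine congrArg μ (Set.ext fun E => ?_)
    simp only [Set.mem_ofPred_eq, Set.mem_preimage, Ensemble.translate_total, Prod.mk_add_mk,
      Nat.cast_zero, zero_add, add_comm a]
  · exact (measurableSet_le measurable_const ((Finset.measurable_sum _ fun k _ =>
      measurable_of_total _ fun c => (c.i₂.toNat : ℝ)).sub_const _).abs).nullMeasurableSet

open Filter Topology in
theorem IsPureState.measure_col {w : ArrowConfig → ℝ} {μ : Measure (Ensemble Set.univ)}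
    (hμ : IsPureState w μ) {ε δ : ℝ} (hε : 0 < ε) (hδ : 0 < δ) :
    ∃ n₀ : ℕ, ∀ N ≥ n₀, ∀ a b : ℤ, μ {E | ε * N ≤ |∑ k ∈ Finset.range N,
      ((E.total (a, b + k)).j₂.toNat : ℝ) - (slope μ).2 * N|} ≤ ENNReal.ofReal δ := by
  have := hμ.isProbabilityMeasure
  have hinv := hμ.isTranslationInvariant
  set F : Ensemble Set.univ → ℝ := fun E => ((E.total (0, 0)).j₂.toNat : ℝ) with hF
  have hFm : Measurable F := measurable_of_total (0, 0) fun c => (c.j₂.toNat : ℝ)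
  have hF2 : MemLp F 2 μ := MemLp.of_bound hFm.aestronglyMeasurable 1 (by
    filter_upwards with E
    simp only [hF]
    cases (E.total (0, 0)).j₂ <;> simp)
  have hs : (slope μ).2 = ∫ E, F E ∂μ := by
    simp only [slope]
    exact integral_congr_ae (by filter_upwards with E; exact E.chiH_eq _)
  have h1 := tendsto_measure_line (μ := μ) (s := (slope μ).2)
    (R := fun N l E => ∑ k ∈ Finset.range N, ((E.total (l, k)).j₂.toNat : ℝ))
    (fun N l E => abs_colSum_sub_le E N l) (fun ε hε => by
      rw [hs]
      -- For columns the two side lengths of the rectangle exchange roles, and the order of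
      -- summation is swapped accordingly.
      refine ((tendsto_measure_average hinv hμ.ergodic hF2 hε).comp
        (tendsto_snd.prodMk tendsto_fst)).congr fun i => ?_
      refine congrArg μ (Set.ext fun E => ?_)
      simp only [hF, Ensemble.translate_total, zero_add, Prod.mk_zero_zero, Set.mem_ofPred_eq]
      have : (i.1 : ℝ)⁻¹ * ∑ l ∈ Finset.range i.1, ((i.2 : ℝ)⁻¹ *
          ∑ k ∈ Finset.range i.2, ((E.total (k, l)).j₂.toNat : ℝ)) = (i.2 : ℝ)⁻¹ *
          ∑ l ∈ Finset.range i.2, ((i.1 : ℝ)⁻¹ *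
            ∑ k ∈ Finset.range i.1, ((E.total (l, k)).j₂.toNat : ℝ)) := by
        rw [← Finset.mul_sum, ← Finset.mul_sum, Finset.sum_comm]
        ring
      rw [this]) hε
  obtain ⟨n₀, hn₀⟩ := eventually_atTop.1 (h1.eventually (gt_mem_nhds (ENNReal.ofReal_pos.2 hδ)))
  refine ⟨n₀, fun N hN a b => ?_⟩
  refine le_trans (le_of_eq ?_) (hn₀ N hN).le
  refine Eq.trans ?_ ((hinv.measurePreserving (a, b)).measure_preimage ?_)
  · refine congrArg μ (Set.ext fun E => ?_)
    simp only [Set.mem_ofPred_eq, Set.mem_preimage, Ensemble.translate_total, Prod.mk_add_mk,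
      Nat.cast_zero, zero_add, add_comm b]
  · exact (measurableSet_le measurable_const ((Finset.measurable_sum _ fun k _ =>
      measurable_of_total _ fun c => (c.j₂.toNat : ℝ)).sub_const _).abs).nullMeasurableSet

/-- Heights at points with coordinates multiples of `m ≈ θN` are obtained by going up the left side
and then along a row. The number of such points is bounded independently of `N`, so a union bound
applies; the Lipschitz property covers all other points. -/
theorem IsPureState.measure_not_nearLinear {w : ArrowConfig → ℝ}
    {μ : Measure (Ensemble Set.univ)} (hμ : IsPureState w μ) (hs : 0 ≤ (slope μ).1)
    (hs1 : (slope μ).1 ≤ 1) (ht : 0 ≤ (slope μ).2) (ht1 : (slope μ).2 ≤ 1)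
    {η δ : ℝ} (hη : 0 < η) (hδ : 0 < δ) :
    ∃ N₀ : ℕ, ∀ N ≥ N₀, μ {E | ¬ NearLinear (slope μ).1 (slope μ).2 (η * N) 0 N E}
      ≤ ENNReal.ofReal δ := by
  set s := (slope μ).1
  set t := (slope μ).2
  -- The column and the row cost `2θN`, and interpolation costs `4m ≤ 4θN + 4 ≤ 5θN`.
  set θ := η / 7 with hθ
  have hθ0 : 0 < θ := by positivity
  set K := ⌈1 / θ⌉₊ + 1 with hK
  have hK0 : 0 < K := by omega
  have hKR : (0 : ℝ) < K := by exact_mod_cast hK0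
  set δ' := δ / (2 * K * K) with hδ'
  have hδ'0 : 0 < δ' := by positivity
  obtain ⟨n₁, hn₁⟩ := hμ.measure_row hθ0 hδ'0
  obtain ⟨n₂, hn₂⟩ := hμ.measure_col hθ0 hδ'0
  refine ⟨max (⌈max n₁ n₂ / θ⌉₊) (⌈4 / θ⌉₊) + 1, fun N hN => ?_⟩
  have hN1 : max n₁ n₂ / θ ≤ N := (Nat.le_ceil _).trans (by
    exact_mod_cast ((le_max_left _ _).trans (Nat.le_succ _)).trans hN)
  have hN2 : 4 / θ ≤ N := (Nat.le_ceil _).trans (by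
    exact_mod_cast ((le_max_right _ _).trans (Nat.le_succ _)).trans hN)
  have hN0 : 0 < N := by omega
  have hN0' : (0 : ℝ) < N := by exact_mod_cast hN0
  rw [div_le_iff₀ hθ0] at hN1 hN2
  set m := ⌈θ * N⌉₊ with hm
  have hm0 : 0 < m := Nat.ceil_pos.2 (by positivity)
  have hmθ : θ * N ≤ m := Nat.le_ceil _
  have hmθ' : (m : ℝ) < θ * N + 1 := Nat.ceil_lt_add_one (by positivity)
  have hmn : max n₁ n₂ ≤ m := by
    have : ((max n₁ n₂ : ℕ) : ℝ) ≤ m := hN1.trans (by linarith)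
    exact_mod_cast this
  -- The factor `i + 1` keeps every length at least `m`, hence beyond the thresholds `n₁` and `n₂`;
  -- sums of length 0 need no control.
  set R : ℕ → ℕ → Set (Ensemble Set.univ) := fun i j =>
    {E | θ * ((i + 1) * m : ℕ) ≤ |∑ k ∈ Finset.range ((i + 1) * m),
      ((E.total (1 + k, (j * m : ℕ))).i₂.toNat : ℝ) - s * ((i + 1) * m : ℕ)|} with hRdef
  set C : ℕ → Set (Ensemble Set.univ) := fun j =>
    {E | θ * ((j + 1) * m : ℕ) ≤ |∑ k ∈ Finset.range ((j + 1) * m),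
      ((E.total (0, 1 + k)).j₂.toNat : ℝ) - t * ((j + 1) * m : ℕ)|} with hCdef
  have hle : ∀ i : ℕ, m ≤ (i + 1) * m := fun i => Nat.le_mul_of_pos_left m (by omega)
  have hR : ∀ i j, μ (R i j) ≤ ENNReal.ofReal δ' := fun i j =>
    hn₁ _ (((le_max_left _ _).trans hmn).trans (hle i)) 1 ((j * m : ℕ) : ℤ)
  have hC : ∀ j, μ (C j) ≤ ENNReal.ofReal δ' := fun j =>
    hn₂ _ (((le_max_right _ _).trans hmn).trans (hle j)) 0 1
  have hsub : {E | ¬ NearLinear s t (η * N) 0 N E} ⊆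
      ⋃ p ∈ Finset.range K ×ˢ Finset.range K, (R p.1 p.2 ∪ C p.2) := by
    intro E hE
    by_contra hcon
    apply hE
    simp only [Set.mem_iUnion, Finset.mem_product, Finset.mem_range, not_exists,
      Set.mem_union, not_or, Prod.forall] at hcon
    -- The box starts one step earlier because the heights along the two axes are read from arrows
    -- exiting the vertices of column 0 and of row 0.
    obtain ⟨h', hh', -, hf'⟩ := E.exists_height (-1) (N + 1) (Set.subset_univ _)
    obtain ⟨h, hh, h0, hf⟩ : ∃ h, IsHeight h ∧ h (0, 0) = 0 ∧
        ∀ v ∈ box (-1) (N + 1), Fits h v (E.total v) :=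
      ⟨fun p => h' p + (- h' (0, 0)), hh'.add_const _, by simp, fun v hv => (hf' v hv).add_const _⟩
    have hrow : ∀ i j : ℕ, i ≤ N → j ≤ N → (∑ k ∈ Finset.range i,
        ((E.total (1 + k, j)).i₂.toNat : ℝ)) = h (i, j) - h (0, j) := by
      intro i j hi hj
      have := sum_i₂_eq (h := h) (c := E.total) (a := 1) (b := j) (N := i) (by
        intro k hk
        apply hf
        rw [mem_box]
        refine ⟨⟨?_, ?_⟩, ?_, ?_⟩ <;> push_cast <;> omega)
      rw [show (1 : ℤ) + i - 1 = i by ring, show (1 : ℤ) - 1 = 0 by ring] at this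
      exact_mod_cast this
    have hcol : ∀ j : ℕ, j ≤ N → (∑ k ∈ Finset.range j,
        ((E.total (0, 1 + k)).j₂.toNat : ℝ)) = - h (0, j) := by
      intro j hj
      have := sum_j₂_eq (h := h) (c := E.total) (a := 0) (b := 1) (N := j) (by
        intro k hk
        apply hf
        rw [mem_box]
        refine ⟨⟨?_, ?_⟩, ?_, ?_⟩ <;> push_cast <;> omega)
      rw [show (1 : ℤ) + j - 1 = j by ring, show (1 : ℤ) - 1 = 0 by ring, h0, zero_sub] at this
      exact_mod_cast this
    have hiK : ∀ i : ℕ, i * m ≤ N → i < K := by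
      intro i hi
      have h1 : (i : ℝ) * m ≤ N := by exact_mod_cast hi
      have h2 : (i : ℝ) * (θ * N) ≤ N := le_trans (by gcongr) h1
      have h3 : (i : ℝ) ≤ 1 / θ := by
        rw [le_div_iff₀ hθ0]
        nlinarith
      have h4 : (i : ℝ) ≤ ⌈1 / θ⌉₊ := h3.trans (Nat.le_ceil _)
      have h5 : i ≤ ⌈1 / θ⌉₊ := by exact_mod_cast h4
      omega
    have hC' : ∀ j : ℕ, j * m ≤ N → |(h (0, (j * m : ℕ)) : ℝ) + t * (j * m : ℕ)| ≤ θ * N := by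
      intro j hj
      rcases j with _ | j
      · simp [h0]; positivity
      have h1 := (hcon 0 j ⟨hK0, (Nat.lt_succ_self j).trans (hiK _ hj)⟩).2
      simp only [hCdef, Set.mem_ofPred_eq, not_le] at h1
      rw [hcol _ hj] at h1
      rw [← abs_neg, neg_add']
      refine h1.le.trans ?_
      gcongr
    have hR' : ∀ i j : ℕ, i * m ≤ N → j * m ≤ N →
        |(h ((i * m : ℕ), (j * m : ℕ)) : ℝ) - h (0, (j * m : ℕ)) - s * (i * m : ℕ)| ≤ θ * N := by
      intro i j hi hj
      rcases i with _ | i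
      · simp; positivity
      have h1 := (hcon i j ⟨(Nat.lt_succ_self i).trans (hiK _ hi), hiK _ hj⟩).1
      simp only [hRdef, Set.mem_ofPred_eq, not_le] at h1
      rw [hrow _ _ hi hj] at h1
      refine h1.le.trans ?_
      gcongr
    refine ⟨h, hh, fun v hv => hf v ?_, fun p hp => ?_⟩
    · rw [mem_box] at hv ⊢
      push_cast
      omega
    · refine (near_linear_of_subgrid hs hs1 ht ht1 hh (r := 2 * (θ * N)) hm0 ?_ p hp).trans ?_
      · intro i j hi hj
        have h1 := hC' j hj
        have h2 := hR' i j hi hj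
        simp only [zero_add, Int.cast_zero]
        rw [abs_le] at *
        constructor <;> linarith
      · have : η = 7 * θ := by rw [hθ]; ring
        rw [this]
        linarith
  calc μ _ ≤ μ (⋃ p ∈ Finset.range K ×ˢ Finset.range K, (R p.1 p.2 ∪ C p.2)) := measure_mono hsub
    _ ≤ ∑ p ∈ Finset.range K ×ˢ Finset.range K, μ (R p.1 p.2 ∪ C p.2) :=
        measure_biUnion_finset_le _ _
    _ ≤ ∑ p ∈ Finset.range K ×ˢ Finset.range K, ENNReal.ofReal (2 * δ') := by
        refine Finset.sum_le_sum fun p _ => (measure_union_le _ _).trans ?_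
        rw [two_mul, ENNReal.ofReal_add hδ'0.le hδ'0.le]
        exact add_le_add (hR _ _) (hC _)
    _ = ENNReal.ofReal δ := by
        rw [Finset.sum_const, Finset.card_product, Finset.card_range, nsmul_eq_mul,
          ← ENNReal.ofReal_natCast, ← ENNReal.ofReal_mul (by positivity)]
        congr 1
        rw [hδ']
        push_cast
        field_simp

/-! ### Summation over ensembles, vertex by vertex -/

/-- The ensemble given by a consistent family of arrow configurations. -/
def Ensemble.ofTotal (f : ℤ × ℤ → ArrowConfig) (Λ : Set (ℤ × ℤ))
    (hup : ∀ v ∈ Λ, v + (0, 1) ∈ Λ → (f v).i₂ = (f (v + (0, 1))).i₁)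
    (hri : ∀ v ∈ Λ, v + (1, 0) ∈ Λ → (f v).j₂ = (f (v + (1, 0))).j₁) : Ensemble Λ :=
  ⟨fun v => f v, fun ⟨v, hv⟩ ⟨u, hu⟩ => ⟨by rintro rfl; exact hup v hv hu,
    by rintro rfl; exact hri v hv hu⟩⟩

theorem Ensemble.ofTotal_total {f : ℤ × ℤ → ArrowConfig} {Λ : Set (ℤ × ℤ)}
    (hup : ∀ v ∈ Λ, v + (0, 1) ∈ Λ → (f v).i₂ = (f (v + (0, 1))).i₁)
    (hri : ∀ v ∈ Λ, v + (1, 0) ∈ Λ → (f v).j₂ = (f (v + (1, 0))).j₁) {v : ℤ × ℤ} (hv : v ∈ Λ) :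
    (Ensemble.ofTotal f Λ hup hri).total v = f v := by
  rw [Ensemble.total_of_mem _ hv]
  rfl

theorem Ensemble.total_up' {Λ : Set (ℤ × ℤ)} (E : Ensemble Λ) {v : ℤ × ℤ} (hv : v ∈ Λ)
    (hu : v + (0, 1) ∈ Λ) : (E.total v).i₂ = (E.total (v + (0, 1))).i₁ := by
  rw [E.total_of_mem hv, E.total_of_mem hu]
  exact (E.2 ⟨_, hv⟩ ⟨_, hu⟩).1 rfl

theorem Ensemble.total_right' {Λ : Set (ℤ × ℤ)} (E : Ensemble Λ) {v : ℤ × ℤ} (hv : v ∈ Λ)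
    (hu : v + (1, 0) ∈ Λ) : (E.total v).j₂ = (E.total (v + (1, 0))).j₁ := by
  rw [E.total_of_mem hv, E.total_of_mem hu]
  exact (E.2 ⟨_, hv⟩ ⟨_, hu⟩).2 rfl

/-- The arrow configuration `c` at `v` is consistent with `E`. -/
def Compat (v : ℤ × ℤ) (c : ArrowConfig) {Γ : Finset (ℤ × ℤ)}
    (E : Ensemble (Γ : Set (ℤ × ℤ))) : Prop :=
  (v - (0, 1) ∈ Γ → (E.total (v - (0, 1))).i₂ = c.i₁) ∧
  (v - (1, 0) ∈ Γ → (E.total (v - (1, 0))).j₂ = c.j₁) ∧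
  (v + (0, 1) ∈ Γ → c.i₂ = (E.total (v + (0, 1))).i₁) ∧
  (v + (1, 0) ∈ Γ → c.j₂ = (E.total (v + (1, 0))).j₁)

open Classical in
theorem sum_prod_insert {v : ℤ × ℤ} {Γ : Finset (ℤ × ℤ)} (hv : v ∉ Γ)
    (W : ℤ × ℤ → ArrowConfig → ℝ) :
    ∑ E : Ensemble ((insert v Γ : Finset (ℤ × ℤ)) : Set (ℤ × ℤ)),
        ∏ u ∈ insert v Γ, W u (E.total u) =
      ∑ E : Ensemble (Γ : Set (ℤ × ℤ)), (∏ u ∈ Γ, W u (E.total u)) *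
        ∑ c : ArrowConfig, if Compat v c E then W v c else 0 := by
  simp_rw [Finset.mul_sum]
  rw [← Fintype.sum_prod_type' (f := fun (E : Ensemble (Γ : Set (ℤ × ℤ))) c =>
    (∏ u ∈ Γ, W u (E.total u)) * if Compat v c E then W v c else 0)]
  have : ∀ x : Ensemble (Γ : Set (ℤ × ℤ)) × ArrowConfig,
      ((∏ u ∈ Γ, W u (x.1.total u)) * if Compat v x.2 x.1 then W v x.2 else 0) =
      if Compat v x.2 x.1 then (∏ u ∈ Γ, W u (x.1.total u)) * W v x.2 else 0 := by
    intro x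
    rw [mul_ite, mul_zero]
  simp_rw [this]
  rw [← Finset.sum_filter]
  have hsub : (Γ : Set (ℤ × ℤ)) ⊆ ((insert v Γ : Finset (ℤ × ℤ)) : Set (ℤ × ℤ)) := by
    simp
  have hvm : v ∈ ((insert v Γ : Finset (ℤ × ℤ)) : Set (ℤ × ℤ)) := by simp
  have hr : ∀ (E : Ensemble ((insert v Γ : Finset (ℤ × ℤ)) : Set (ℤ × ℤ))), ∀ u ∈ Γ,
      (E.restrict hsub).total u = E.total u := by
    intro E u hu
    rw [Ensemble.total_of_mem _ (Finset.mem_coe.2 hu), E.total_of_mem (hsub hu)]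
    rfl
  refine Finset.sum_bij (fun E _ => (E.restrict hsub, E.total v)) ?_ ?_ ?_ ?_
  · intro E _
    refine Finset.mem_filter.2 ⟨Finset.mem_univ _, ?_, ?_, ?_, ?_⟩ <;> intro h <;> simp only
    · rw [hr E _ h]
      have := E.total_up' (hsub h) (by rwa [sub_add_cancel])
      rwa [sub_add_cancel] at this
    · rw [hr E _ h]
      have := E.total_right' (hsub h) (by rwa [sub_add_cancel])
      rwa [sub_add_cancel] at this
    · rw [hr E _ h]
      exact E.total_up' hvm (hsub h)
    · rw [hr E _ h]
      exact E.total_right' hvm (hsub h)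
  · intro E _ E' _ h
    rw [Prod.mk.injEq] at h
    apply Ensemble.total_ext
    intro u hu
    rcases Finset.mem_insert.1 (Finset.mem_coe.1 hu) with rfl | hu
    · exact h.2
    · rw [← hr E u hu, ← hr E' u hu, h.1]
  · rintro ⟨E, c⟩ hE
    obtain ⟨-, h1, h2, h3, h4⟩ := Finset.mem_filter.1 hE
    simp only at h1 h2 h3 h4
    have ne1 : v + (0, 1) ≠ v := by simp
    have ne2 : v + (1, 0) ≠ v := by simp
    set f : ℤ × ℤ → ArrowConfig := fun u => if u = v then c else E.total u with hf
    have hup : ∀ u ∈ ((insert v Γ : Finset (ℤ × ℤ)) : Set (ℤ × ℤ)), u + (0, 1) ∈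
        ((insert v Γ : Finset (ℤ × ℤ)) : Set (ℤ × ℤ)) → (f u).i₂ = (f (u + (0, 1))).i₁ := by
      intro u hu hu'
      rw [Finset.mem_coe, Finset.mem_insert] at hu hu'
      simp only [hf]
      rcases eq_or_ne u v with rfl | hne
      · rw [if_pos rfl, if_neg ne1]
        exact h3 (hu'.resolve_left ne1)
      · rw [if_neg hne]
        have hu := hu.resolve_left hne
        rcases eq_or_ne (u + (0, 1)) v with he | hne'
        · rw [if_pos he]
          have : u = v - (0, 1) := by rw [← he, add_sub_cancel_right]
          rw [this]
          exact h1 (this ▸ hu)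
        · rw [if_neg hne']
          exact E.total_up' hu (hu'.resolve_left hne')
    have hri : ∀ u ∈ ((insert v Γ : Finset (ℤ × ℤ)) : Set (ℤ × ℤ)), u + (1, 0) ∈
        ((insert v Γ : Finset (ℤ × ℤ)) : Set (ℤ × ℤ)) → (f u).j₂ = (f (u + (1, 0))).j₁ := by
      intro u hu hu'
      rw [Finset.mem_coe, Finset.mem_insert] at hu hu'
      simp only [hf]
      rcases eq_or_ne u v with rfl | hne
      · rw [if_pos rfl, if_neg ne2]
        exact h4 (hu'.resolve_left ne2)
      · rw [if_neg hne]
        have hu := hu.resolve_left hne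
        rcases eq_or_ne (u + (1, 0)) v with he | hne'
        · rw [if_pos he]
          have : u = v - (1, 0) := by rw [← he, add_sub_cancel_right]
          rw [this]
          exact h2 (this ▸ hu)
        · rw [if_neg hne']
          exact E.total_right' hu (hu'.resolve_left hne')
    refine ⟨Ensemble.ofTotal f _ hup hri, Finset.mem_univ _, ?_⟩
    rw [Prod.mk.injEq]
    constructor
    · apply Ensemble.total_ext
      intro u hu
      rw [hr _ u hu, Ensemble.ofTotal_total _ _ (hsub hu)]
      simp only [hf]
      rw [if_neg (by rintro rfl; exact hv hu)]
    · rw [Ensemble.ofTotal_total _ _ hvm]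
      simp [hf]
  · intro E _
    rw [Finset.prod_insert hv, mul_comm]
    congr 1
    exact Finset.prod_congr rfl fun u hu => by simp only [hr E u hu]

theorem sum_prod_empty (W : ℤ × ℤ → ArrowConfig → ℝ) :
    ∑ E : Ensemble ((∅ : Finset (ℤ × ℤ)) : Set (ℤ × ℤ)),
      ∏ u ∈ (∅ : Finset (ℤ × ℤ)), W u (E.total u) = 1 := by
  have : Unique (Ensemble ((∅ : Finset (ℤ × ℤ)) : Set (ℤ × ℤ))) :=
    { default := Ensemble.ofTotal (fun _ => ⟨(false, false, false, false), rfl⟩) _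
        (by simp) (by simp)
      uniq := fun E => Ensemble.total_ext (by simp) }
  rw [Fintype.sum_unique]
  simp

open Classical in
/-- If the weights at each vertex, given the configurations at the earlier vertices, sum to `C v`,
then the total weight of all ensembles is `∏ v, C v`. -/
theorem sum_prod_eq_of_order {β : Type*} [LinearOrder β] {f : ℤ × ℤ → β}
    (hf : Function.Injective f) (W : ℤ × ℤ → ArrowConfig → ℝ) (C : ℤ × ℤ → ℝ)
    (Λ : Finset (ℤ × ℤ))
    (h : ∀ v ∈ Λ, ∀ Γ : Finset (ℤ × ℤ), (∀ u, u ∈ Γ ↔ u ∈ Λ ∧ f u < f v) →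
      ∀ E : Ensemble (Γ : Set (ℤ × ℤ)), (∑ c, if Compat v c E then W v c else 0) = C v) :
    ∑ E : Ensemble (Λ : Set (ℤ × ℤ)), ∏ u ∈ Λ, W u (E.total u) = ∏ u ∈ Λ, C u := by
  induction Λ using Finset.induction_on_max_value f with
  | empty => rw [sum_prod_empty]; simp
  | insert v Γ hv hmax ih =>
    have hlt : ∀ u ∈ Γ, f u < f v := fun u hu =>
      (hmax u hu).lt_of_ne fun e => hv (hf e ▸ hu)
    rw [sum_prod_insert hv, Finset.prod_insert hv]
    have h1 : ∀ E : Ensemble (Γ : Set (ℤ × ℤ)),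
        (∑ c, if Compat v c E then W v c else 0) = C v := by
      refine h v (Finset.mem_insert_self _ _) Γ fun u => ?_
      rw [Finset.mem_insert]
      exact ⟨fun hu => ⟨Or.inr hu, hlt u hu⟩, fun hu => hu.1.resolve_left (by
        rintro rfl; exact lt_irrefl _ hu.2)⟩
    simp_rw [h1]
    rw [← Finset.sum_mul, ih, mul_comm]
    intro u hu Δ hΔ
    refine h u (Finset.mem_insert_of_mem hu) Δ fun x => ?_
    rw [hΔ, Finset.mem_insert]
    refine and_congr_left fun hx => ⟨Or.inr, fun h => h.resolve_left ?_⟩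
    rintro rfl
    exact lt_asymm hx (hlt u hu)

open Classical in
-- The last vertex in the order is peeled off as before; for subprobability weights, nonnegativity
-- of the remaining factors preserves the inequality.
theorem sum_prod_le_of_order {β : Type*} [LinearOrder β] {f : ℤ × ℤ → β}
    (hf : Function.Injective f) (W : ℤ × ℤ → ArrowConfig → ℝ) (hW : ∀ v c, 0 ≤ W v c)
    (Λ : Finset (ℤ × ℤ))
    (h : ∀ v ∈ Λ, ∀ Γ : Finset (ℤ × ℤ), (∀ u, u ∈ Γ ↔ u ∈ Λ ∧ f u < f v) →
      ∀ E : Ensemble (Γ : Set (ℤ × ℤ)), (∑ c, if Compat v c E then W v c else 0) ≤ 1) :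
    ∑ E : Ensemble (Λ : Set (ℤ × ℤ)), ∏ u ∈ Λ, W u (E.total u) ≤ 1 := by
  induction Λ using Finset.induction_on_max_value f with
  | empty => rw [sum_prod_empty]
  | insert v Γ hv hmax ih =>
    have hlt : ∀ u ∈ Γ, f u < f v := fun u hu =>
      (hmax u hu).lt_of_ne fun e => hv (hf e ▸ hu)
    rw [sum_prod_insert hv]
    have h1 : ∀ E : Ensemble (Γ : Set (ℤ × ℤ)),
        (∑ c, if Compat v c E then W v c else 0) ≤ 1 := by
      refine h v (Finset.mem_insert_self _ _) Γ fun u => ?_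
      rw [Finset.mem_insert]
      exact ⟨fun hu => ⟨Or.inr hu, hlt u hu⟩, fun hu => hu.1.resolve_left (by
        rintro rfl; exact lt_irrefl _ hu.2)⟩
    refine (Finset.sum_le_sum fun E _ => mul_le_of_le_one_right
      (Finset.prod_nonneg fun u _ => hW _ _) (h1 E)).trans (ih ?_)
    intro u hu Δ hΔ
    refine h u (Finset.mem_insert_of_mem hu) Δ fun x => ?_
    rw [hΔ, Finset.mem_insert]
    refine and_congr_left fun hx => ⟨Or.inr, fun h => h.resolve_left ?_⟩
    rintro rfl
    exact lt_asymm hx (hlt u hu)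

theorem sum_arrowConfig (G : ArrowConfig → ℝ) :
    ∑ c, G c = G ⟨(false, false, false, false), rfl⟩ + G ⟨(true, true, true, true), rfl⟩ +
      G ⟨(true, false, true, false), rfl⟩ + G ⟨(true, false, false, true), rfl⟩ +
      G ⟨(false, true, false, true), rfl⟩ + G ⟨(false, true, true, false), rfl⟩ := by
  have : (Finset.univ : Finset ArrowConfig) = {⟨(false, false, false, false), rfl⟩,
      ⟨(true, true, true, true), rfl⟩, ⟨(true, false, true, false), rfl⟩,
      ⟨(true, false, false, true), rfl⟩, ⟨(false, true, false, true), rfl⟩,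
      ⟨(false, true, true, false), rfl⟩} := by decide
  rw [this, Finset.sum_insert (by decide), Finset.sum_insert (by decide),
    Finset.sum_insert (by decide), Finset.sum_insert (by decide), Finset.sum_insert (by decide),
    Finset.sum_singleton]
  ring

/-- This is stochasticity of the weights: with both entering arrows fixed, the weights of the
possible exits sum to 1. `A` and `B` say whether an entering arrow is dictated by an earlier vertex;
if not, it is summed with its own weight `P` or `Q`. -/
theorem forward_sum (B₁ B₂ : ℝ) (A B : Prop) [Decidable A] [Decidable B] (i j : Bool)
    (P Q : Bool → ℝ) :
    (∑ c : ArrowConfig, if (A → i = c.i₁) ∧ (B → j = c.j₁) then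
      (if A then 1 else P c.i₁) * (if B then 1 else Q c.j₁) * stochasticWeight B₁ B₂ c else 0) =
      (if A then 1 else P true + P false) * (if B then 1 else Q true + Q false) := by
  rw [sum_arrowConfig]
  by_cases hA : A <;> by_cases hB : B <;> cases i <;> cases j <;>
    simp [hA, hB, ArrowConfig.i₁, ArrowConfig.j₁, ArrowConfig.i₂, ArrowConfig.j₂,
      stochasticWeight, sixVertexWeight] <;> ring

/-- The weights of the time-reversed stochastic six-vertex model. -/
def reversedWeight (B₁ B₂ : ℝ) : ArrowConfig → ℝ :=
  sixVertexWeight 1 1 B₁ B₂ (1 - B₂) (1 - B₁)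

/-- Exchanging the two turning weights makes the weights stochastic in the other direction: with the
exits fixed, the sum over the entrances is 1. -/
theorem backward_sum (B₁ B₂ : ℝ) (A B : Prop) [Decidable A] [Decidable B] (i j : Bool)
    (P Q : Bool → ℝ) :
    (∑ c : ArrowConfig, if (A → c.i₂ = i) ∧ (B → c.j₂ = j) then
      (if A then 1 else P c.i₂) * (if B then 1 else Q c.j₂) * reversedWeight B₁ B₂ c else 0) =
      (if A then 1 else P true + P false) * (if B then 1 else Q true + Q false) := by
  rw [sum_arrowConfig]
  by_cases hA : A <;> by_cases hB : B <;> cases i <;> cases j <;>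
    simp [hA, hB, ArrowConfig.i₁, ArrowConfig.j₁, ArrowConfig.i₂, ArrowConfig.j₂,
      reversedWeight, sixVertexWeight] <;> ring

/-! ### Stationary measures of the stochastic six-vertex model -/

/-- The probabilities of a Bernoulli random variable of mean `a`. -/
def bernoulliWeight (a : ℝ) (i : Bool) : ℝ := if i then a else 1 - a

/-- The weight of a vertex, including Bernoulli weights of the arrows that enter from outside. -/
noncomputable def entranceWeight (B₁ B₂ a b : ℝ) (Λ : Finset (ℤ × ℤ)) (v : ℤ × ℤ)
    (c : ArrowConfig) : ℝ :=
  (if v - (0, 1) ∈ Λ then 1 else bernoulliWeight a c.i₁) *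
    (if v - (1, 0) ∈ Λ then 1 else bernoulliWeight b c.j₁) * stochasticWeight B₁ B₂ c

/-- The probability of an ensemble of the stochastic six-vertex model in which vertical and
horizontal arrows enter independently with probabilities `a` and `b`. -/
noncomputable def entranceMass (B₁ B₂ a b : ℝ) {Λ : Finset (ℤ × ℤ)}
    (E : Ensemble (Λ : Set (ℤ × ℤ))) : ℝ :=
  ∏ v ∈ Λ, entranceWeight B₁ B₂ a b Λ v (E.total v)

theorem toLex_injective' : Function.Injective fun v : ℤ × ℤ => toLex v := fun _ _ h => h

theorem lex_lt_iff {x y : ℤ × ℤ} : toLex x < toLex y ↔ x.1 < y.1 ∨ x.1 = y.1 ∧ x.2 < y.2 :=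
  Prod.Lex.toLex_lt_toLex

/-- In the lexicographic order, the lower and left neighbours of a vertex precede it and the other
two follow it, so only the entering arrows are constrained. -/
theorem forward_compat {Λ Γ : Finset (ℤ × ℤ)} {v : ℤ × ℤ}
    (hΓ : ∀ u, u ∈ Γ ↔ u ∈ Λ ∧ toLex u < toLex v) (E : Ensemble (Γ : Set (ℤ × ℤ)))
    (c : ArrowConfig) : Compat v c E ↔
      (v - (0, 1) ∈ Λ → (E.total (v - (0, 1))).i₂ = c.i₁) ∧
      (v - (1, 0) ∈ Λ → (E.total (v - (1, 0))).j₂ = c.j₁) := by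
  simp only [Compat, hΓ, lex_lt_iff]
  simp

open Classical in
theorem sum_entrance (B₁ B₂ : ℝ) (Λ : Finset (ℤ × ℤ)) (P Q : ℤ × ℤ → Bool → ℝ) :
    ∑ E : Ensemble (Λ : Set (ℤ × ℤ)), ∏ v ∈ Λ,
      ((if v - (0, 1) ∈ Λ then 1 else P v (E.total v).i₁) *
        (if v - (1, 0) ∈ Λ then 1 else Q v (E.total v).j₁) * stochasticWeight B₁ B₂ (E.total v)) =
      ∏ v ∈ Λ, ((if v - (0, 1) ∈ Λ then 1 else P v true + P v false) *
        (if v - (1, 0) ∈ Λ then 1 else Q v true + Q v false)) := by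
  refine sum_prod_eq_of_order toLex_injective' (fun v c =>
    (if v - (0, 1) ∈ Λ then 1 else P v c.i₁) * (if v - (1, 0) ∈ Λ then 1 else Q v c.j₁) *
      stochasticWeight B₁ B₂ c) _ Λ fun v _ Γ hΓ E => ?_
  rw [← forward_sum B₁ B₂ _ _ (E.total (v - (0, 1))).i₂ (E.total (v - (1, 0))).j₂]
  exact Finset.sum_congr rfl fun c _ => if_congr (forward_compat hΓ E c) rfl rfl

theorem bernoulliWeight_sum (a : ℝ) : bernoulliWeight a true + bernoulliWeight a false = 1 := by
  simp [bernoulliWeight]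

theorem sum_entranceMass (B₁ B₂ a b : ℝ) (Λ : Finset (ℤ × ℤ)) :
    ∑ E : Ensemble (Λ : Set (ℤ × ℤ)), entranceMass B₁ B₂ a b E = 1 := by
  have := sum_entrance B₁ B₂ Λ (fun _ => bernoulliWeight a) fun _ => bernoulliWeight b
  simp only [bernoulliWeight_sum, ite_self, mul_one, Finset.prod_const_one] at this
  exact this

/-- As `G` is arbitrary, this expresses that the arrows entering from the left are independent
Bernoulli variables of mean `b`. -/
theorem sum_entranceMass_left (B₁ B₂ a b : ℝ) (Λ : Finset (ℤ × ℤ)) (G : ℤ × ℤ → Bool → ℝ) :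
    ∑ E : Ensemble (Λ : Set (ℤ × ℤ)), entranceMass B₁ B₂ a b E *
      ∏ v ∈ Λ.filter (fun v => v - (1, 0) ∉ Λ), G v (E.total v).j₁ =
      ∏ v ∈ Λ.filter (fun v => v - (1, 0) ∉ Λ), (b * G v true + (1 - b) * G v false) := by
  have := sum_entrance B₁ B₂ Λ (fun _ => bernoulliWeight a) fun v i => bernoulliWeight b i * G v i
  convert this using 1
  · refine Finset.sum_congr rfl fun E _ => ?_
    rw [Finset.prod_filter, entranceMass, ← Finset.prod_mul_distrib]
    refine Finset.prod_congr rfl fun v _ => ?_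
    rw [entranceWeight]
    by_cases h : v - (1, 0) ∈ Λ <;> simp only [h, not_true, not_false_eq_true, if_true, if_false]
      <;> ring
  · rw [Finset.prod_filter]
    refine Finset.prod_congr rfl fun v _ => ?_
    rw [bernoulliWeight_sum, ite_self, one_mul]
    by_cases h : v - (1, 0) ∈ Λ <;> simp [h, bernoulliWeight]

theorem prod_shift {Γ : Finset (ℤ × ℤ)} (e : ℤ × ℤ) (F G : ℤ × ℤ → ℝ)
    (h : ∀ v ∈ Γ, v + e ∈ Γ → F (v + e) = G v) :
    ∏ v ∈ Γ, (if v - e ∈ Γ then F v else 1) = ∏ v ∈ Γ, (if v + e ∈ Γ then G v else 1) := by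
  rw [← Finset.prod_filter, ← Finset.prod_filter]
  refine Finset.prod_nbij' (fun v => v - e) (fun v => v + e) ?_ ?_ ?_ ?_ ?_
  · intro v hv
    rw [Finset.mem_filter] at *
    simpa using hv.symm
  · intro v hv
    rw [Finset.mem_filter] at *
    simpa using hv.symm
  · intro v _
    simp
  · intro v _
    simp
  · intro v hv
    rw [Finset.mem_filter] at hv
    rw [← h (v - e) hv.2 (by simpa using hv.1), sub_add_cancel]

/-- Detailed balance. It is immediate unless the path turns, and for both turns it is exactly the
relation `hab`, that is, `b = φ(a)`. -/
theorem reversible {B₁ B₂ a b : ℝ} (hab : a * (1 - b) * (1 - B₁) = (1 - a) * b * (1 - B₂))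
    (c : ArrowConfig) :
    bernoulliWeight a c.i₁ * bernoulliWeight b c.j₁ * stochasticWeight B₁ B₂ c =
      bernoulliWeight a c.i₂ * bernoulliWeight b c.j₂ * reversedWeight B₁ B₂ c := by
  obtain ⟨⟨i, j, k, l⟩, hc⟩ := c
  revert hc
  cases i <;> cases j <;> cases k <;> cases l <;> intro hc <;>
    simp [ArrowConfig.i₁, ArrowConfig.j₁, ArrowConfig.i₂, ArrowConfig.j₂,
      stochasticWeight, reversedWeight, sixVertexWeight, bernoulliWeight] at hc ⊢ <;> linarith

theorem bernoulliWeight_pos {a : ℝ} (h₀ : 0 < a) (h₁ : a < 1) (i : Bool) :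
    0 < bernoulliWeight a i := by
  cases i <;> simp [bernoulliWeight, h₀, h₁]

/-- Detailed balance is multiplied over all vertices. The Bernoulli factor of an interior edge
appears on both sides, as an exit and as an entrance, and cancels since it is positive; only the
boundary factors survive. -/
theorem prod_reversed {B₁ B₂ a b : ℝ} (ha : 0 < a) (ha1 : a < 1) (hb : 0 < b) (hb1 : b < 1)
    (hab : a * (1 - b) * (1 - B₁) = (1 - a) * b * (1 - B₂)) (Γ : Finset (ℤ × ℤ))
    (c : ℤ × ℤ → ArrowConfig)
    (hup : ∀ v ∈ Γ, v + (0, 1) ∈ Γ → (c v).i₂ = (c (v + (0, 1))).i₁)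
    (hri : ∀ v ∈ Γ, v + (1, 0) ∈ Γ → (c v).j₂ = (c (v + (1, 0))).j₁) :
    ∏ v ∈ Γ, entranceWeight B₁ B₂ a b Γ v (c v) =
      ∏ v ∈ Γ, ((if v + (0, 1) ∈ Γ then 1 else bernoulliWeight a (c v).i₂) *
        (if v + (1, 0) ∈ Γ then 1 else bernoulliWeight b (c v).j₂) *
          reversedWeight B₁ B₂ (c v)) := by
  have hA := prod_shift (Γ := Γ) (0, 1) (fun v => bernoulliWeight a (c v).i₁)
    (fun v => bernoulliWeight a (c v).i₂) (fun v hv hv' => by simp only [hup v hv hv'])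
  have hB := prod_shift (Γ := Γ) (1, 0) (fun v => bernoulliWeight b (c v).j₁)
    (fun v => bernoulliWeight b (c v).j₂) (fun v hv hv' => by simp only [hri v hv hv'])
  have hApos : 0 < ∏ v ∈ Γ, (if v - (0, 1) ∈ Γ then bernoulliWeight a (c v).i₁ else 1) :=
    Finset.prod_pos fun v _ => by split_ifs; exacts [bernoulliWeight_pos ha ha1 _, one_pos]
  have hBpos : 0 < ∏ v ∈ Γ, (if v - (1, 0) ∈ Γ then bernoulliWeight b (c v).j₁ else 1) :=
    Finset.prod_pos fun v _ => by split_ifs; exacts [bernoulliWeight_pos hb hb1 _, one_pos]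
  refine mul_left_cancel₀ (mul_pos hApos hBpos).ne' ?_
  conv_rhs => rw [hA, hB]
  simp only [← Finset.prod_mul_distrib]
  refine Finset.prod_congr rfl fun v _ => ?_
  have := reversible hab (c v)
  rw [entranceWeight]
  calc _ = bernoulliWeight a (c v).i₁ * bernoulliWeight b (c v).j₁ *
        stochasticWeight B₁ B₂ (c v) := by split_ifs <;> ring
    _ = _ := by rw [this]; split_ifs <;> ring

/-- An enumeration of vertices, first downwards and leftwards from the row `y`, and then upwards
and rightwards. -/
def rowOrder (y : ℤ) (v : ℤ × ℤ) : ℤ × ℤ :=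
  if v.2 ≤ y then (2 * (y - v.2), -v.1) else (2 * (v.2 - y) - 1, v.1)

theorem rowOrder_injective (y : ℤ) : Function.Injective fun v => toLex (rowOrder y v) := by
  intro u v h
  have h : rowOrder y u = rowOrder y v := h
  simp only [rowOrder] at h
  split_ifs at h <;> simp only [Prod.mk.injEq] at h <;> ext <;> omega

/-- Time is reversed up to row `y`: this part is then a stochastic model started from independent
Bernoulli arrows exiting that row. Above the row the model runs forwards and its weights sum to 1.
Hence the arrows exiting row `y` are independent Bernoulli variables of mean `a`. -/
theorem sum_entranceMass_row {B₁ B₂ a b : ℝ} (ha : 0 < a) (ha1 : a < 1) (hb : 0 < b)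
    (hb1 : b < 1) (hab : a * (1 - b) * (1 - B₁) = (1 - a) * b * (1 - B₂)) (Λ : Finset (ℤ × ℤ))
    (y : ℤ) (G : ℤ × ℤ → Bool → ℝ) :
    ∑ E : Ensemble (Λ : Set (ℤ × ℤ)), entranceMass B₁ B₂ a b E *
      ∏ v ∈ Λ.filter (fun v => v.2 = y), G v (E.total v).i₂ =
      ∏ v ∈ Λ.filter (fun v => v.2 = y), (a * G v true + (1 - a) * G v false) := by
  classical
  set Γ := Λ.filter fun v => v.2 ≤ y with hΓ
  have memΓ : ∀ v, v ∈ Γ ↔ v ∈ Λ ∧ v.2 ≤ y := fun v => by rw [hΓ, Finset.mem_filter]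
  set P : ℤ × ℤ → Bool → ℝ := fun v i => bernoulliWeight a i * if v.2 = y then G v i else 1 with hP
  set W : ℤ × ℤ → ArrowConfig → ℝ := fun v c =>
    if v.2 ≤ y then (if v + (0, 1) ∈ Γ then 1 else P v c.i₂) *
      (if v + (1, 0) ∈ Γ then 1 else bernoulliWeight b c.j₂) * reversedWeight B₁ B₂ c
    else entranceWeight B₁ B₂ a b Λ v c with hW
  have hsum := sum_prod_eq_of_order (rowOrder_injective y) W
    (fun v => if v.2 = y then a * G v true + (1 - a) * G v false else 1) Λ (by
      intro v hv Δ hΔ E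
      simp only [hW]
      by_cases hy : v.2 ≤ y
      · have hc : ∀ c, Compat v c E ↔ (v + (0, 1) ∈ Γ → c.i₂ = (E.total (v + (0, 1))).i₁) ∧
            (v + (1, 0) ∈ Γ → c.j₂ = (E.total (v + (1, 0))).j₁) := by
          intro c
          have n1 : v - (0, 1) ∉ Δ := by
            rw [hΔ, lex_lt_iff]; simp only [rowOrder, Prod.fst_sub, Prod.snd_sub]
            split_ifs <;> simp only <;> omega
          have n2 : v - (1, 0) ∉ Δ := by
            rw [hΔ, lex_lt_iff]; simp only [rowOrder, Prod.fst_sub, Prod.snd_sub]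
            split_ifs <;> simp only <;> omega
          have n3 : v + (0, 1) ∈ Δ ↔ v + (0, 1) ∈ Γ := by
            rw [hΔ, memΓ, lex_lt_iff]
            refine and_congr_right fun _ => ?_
            simp only [rowOrder, Prod.fst_add, Prod.snd_add]
            split_ifs <;> simp only <;> omega
          have n4 : v + (1, 0) ∈ Δ ↔ v + (1, 0) ∈ Γ := by
            rw [hΔ, memΓ, lex_lt_iff]
            refine and_congr_right fun _ => ?_
            simp only [rowOrder, Prod.fst_add, Prod.snd_add]
            split_ifs <;> simp only <;> omega
          simp only [Compat, n1, n2, n3, n4, false_implies, true_and]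
        simp only [hy, if_true, hc]
        rw [backward_sum, bernoulliWeight_sum, ite_self, mul_one]
        by_cases hyy : v.2 = y
        · have : v + (0, 1) ∉ Γ := by rw [memΓ]; simp only [Prod.snd_add]; omega
          simp [this, hyy, hP, bernoulliWeight]
        · simp [hyy, hP, bernoulliWeight_sum]
      · have hc : ∀ c, Compat v c E ↔ (v - (0, 1) ∈ Λ → (E.total (v - (0, 1))).i₂ = c.i₁) ∧
            (v - (1, 0) ∈ Λ → (E.total (v - (1, 0))).j₂ = c.j₁) := by
          intro c
          have n1 : v + (0, 1) ∉ Δ := by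
            rw [hΔ, lex_lt_iff]; simp only [rowOrder, Prod.fst_add, Prod.snd_add]
            split_ifs <;> simp only <;> omega
          have n2 : v + (1, 0) ∉ Δ := by
            rw [hΔ, lex_lt_iff]; simp only [rowOrder, Prod.fst_add, Prod.snd_add]
            split_ifs <;> simp only <;> omega
          have n3 : v - (0, 1) ∈ Δ ↔ v - (0, 1) ∈ Λ := by
            rw [hΔ, lex_lt_iff]
            refine and_iff_left ?_
            simp only [rowOrder, Prod.fst_sub, Prod.snd_sub]
            split_ifs <;> simp only <;> omega
          have n4 : v - (1, 0) ∈ Δ ↔ v - (1, 0) ∈ Λ := by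
            rw [hΔ, lex_lt_iff]
            refine and_iff_left ?_
            simp only [rowOrder, Prod.fst_sub, Prod.snd_sub]
            split_ifs <;> simp only <;> omega
          simp only [Compat, n1, n2, n3, n4, false_implies, and_true]
        have hyy : v.2 ≠ y := by omega
        simp only [hy, if_false, hc, entranceWeight, hyy]
        rw [forward_sum]
        simp [bernoulliWeight_sum])
  rw [Finset.prod_filter, ← hsum]
  refine Finset.sum_congr rfl fun E _ => ?_
  rw [entranceMass, Finset.prod_filter, ← Finset.prod_filter_mul_prod_filter_not Λ (fun v => v.2 ≤ y),
    ← Finset.prod_filter_mul_prod_filter_not Λ (fun v => v.2 ≤ y) (fun v => W v (E.total v))]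
  have h1 : ∏ v ∈ Λ.filter (fun v => v.2 ≤ y), entranceWeight B₁ B₂ a b Λ v (E.total v) =
      ∏ v ∈ Γ, entranceWeight B₁ B₂ a b Γ v (E.total v) := by
    refine Finset.prod_congr rfl fun v hv => ?_
    have hv' := (memΓ v).1 hv
    have n1 : v - (0, 1) ∈ Γ ↔ v - (0, 1) ∈ Λ := by
      rw [memΓ]; refine and_iff_left ?_; simp only [Prod.snd_sub]; omega
    have n2 : v - (1, 0) ∈ Γ ↔ v - (1, 0) ∈ Λ := by
      rw [memΓ]; refine and_iff_left ?_; simp only [Prod.snd_sub]; omega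
    simp only [entranceWeight, n1, n2]
  have hsubΓ : ∀ v, v ∈ Γ → v ∈ (Λ : Set (ℤ × ℤ)) := fun v hv => ((memΓ v).1 hv).1
  rw [h1, prod_reversed ha ha1 hb hb1 hab Γ E.total
    (fun v hv hv' => E.total_up' (hsubΓ v hv) (hsubΓ _ hv'))
    (fun v hv hv' => E.total_right' (hsubΓ v hv) (hsubΓ _ hv')),
    ← Finset.prod_filter_mul_prod_filter_not Λ (fun v => v.2 ≤ y)
      (fun v => if v.2 = y then G v (E.total v).i₂ else 1)]
  have h2 : ∏ v ∈ Λ.filter (fun v => ¬ v.2 ≤ y), (if v.2 = y then G v (E.total v).i₂ else 1) = 1 :=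
    Finset.prod_eq_one fun v hv => by
      rw [Finset.mem_filter] at hv
      rw [if_neg (by omega)]
  have h3 : ∏ v ∈ Λ.filter (fun v => ¬ v.2 ≤ y), W v (E.total v) =
      ∏ v ∈ Λ.filter (fun v => ¬ v.2 ≤ y), entranceWeight B₁ B₂ a b Λ v (E.total v) :=
    Finset.prod_congr rfl fun v hv => by
      rw [Finset.mem_filter] at hv
      simp only [hW, if_neg hv.2]
  rw [h2, h3, mul_one, mul_right_comm, ← hΓ, ← Finset.prod_mul_distrib]
  congr 1
  refine Finset.prod_congr rfl fun v hv => ?_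
  have hv' := (memΓ v).1 hv
  simp only [hW, if_pos hv'.2, hP]
  by_cases hyy : v.2 = y
  · have : v + (0, 1) ∉ Γ := by rw [memΓ]; simp only [Prod.snd_add]; omega
    simp only [this, hyy, if_true, if_false]
    ring
  · simp only [hyy, if_false, mul_one]

/-! ### Concentration of the stationary measure on linear profiles -/

/-- The second moment of a sum of independent centred Bernoulli variables. -/
theorem second_moment_le {Ω ι : Type*} [Fintype Ω] [DecidableEq ι] {a : ℝ} (ha : 0 ≤ a)
    (ha1 : a ≤ 1) (P : Ω → ℝ) (X : ι → Ω → Bool) (S : Finset ι)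
    (h : ∀ G : ι → Bool → ℝ, ∑ ω, P ω * ∏ v ∈ S, G v (X v ω) =
      ∏ v ∈ S, (a * G v true + (1 - a) * G v false)) {S' : Finset ι} (hS : S' ⊆ S) :
    ∑ ω, P ω * (∑ v ∈ S', (((X v ω).toNat : ℝ) - a)) ^ 2 ≤ S'.card := by
  have key : ∀ u ∈ S', ∀ v ∈ S', ∑ ω, P ω * ((((X u ω).toNat : ℝ) - a) *
      (((X v ω).toNat : ℝ) - a)) = if u = v then a * (1 - a) else 0 := by
    intro u hu v hv
    -- This test function extracts the covariance at `u` and `v`: the factors at all other sites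
    -- average to 1.
    have h1 := h fun x i => (if x = u then (i.toNat : ℝ) - a else 1) *
      (if x = v then (i.toNat : ℝ) - a else 1)
    have e1 : ∀ ω, ∏ x ∈ S, ((if x = u then ((X x ω).toNat : ℝ) - a else 1) *
        (if x = v then ((X x ω).toNat : ℝ) - a else 1)) =
        (((X u ω).toNat : ℝ) - a) * (((X v ω).toNat : ℝ) - a) := by
      intro ω
      rw [Finset.prod_mul_distrib, Finset.prod_ite_eq', Finset.prod_ite_eq', if_pos (hS hu),
        if_pos (hS hv)]
    simp only [e1] at h1
    rw [h1]
    by_cases huv : u = v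
    · subst huv
      rw [if_pos rfl]
      have : ∀ x ∈ S, (a * ((if x = u then ((true.toNat : ℕ) : ℝ) - a else 1) *
          (if x = u then ((true.toNat : ℕ) : ℝ) - a else 1)) +
          (1 - a) * ((if x = u then ((false.toNat : ℕ) : ℝ) - a else 1) *
          (if x = u then ((false.toNat : ℕ) : ℝ) - a else 1))) =
          if x = u then a * (1 - a) else 1 := by
        intro x _
        by_cases hx : x = u
        · simp [hx]; ring
        · simp [hx]
      rw [Finset.prod_congr rfl this, Finset.prod_ite_eq', if_pos (hS hu)]
    · rw [if_neg huv]
      refine Finset.prod_eq_zero (hS hu) ?_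
      simp [huv]
      ring
  calc _ = ∑ u ∈ S', ∑ v ∈ S', ∑ ω, P ω * ((((X u ω).toNat : ℝ) - a) *
        (((X v ω).toNat : ℝ) - a)) := by
        simp only [sq, Finset.sum_mul_sum]
        simp only [Finset.mul_sum]
        rw [Finset.sum_comm]
        exact Finset.sum_congr rfl fun u _ => Finset.sum_comm
    _ = ∑ u ∈ S', ∑ v ∈ S', (if u = v then a * (1 - a) else 0) :=
        Finset.sum_congr rfl fun u hu => Finset.sum_congr rfl fun v hv => key u hu v hv
    _ = ∑ u ∈ S', a * (1 - a) := Finset.sum_congr rfl fun u hu => by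
        rw [Finset.sum_ite_eq, if_pos hu]
    _ ≤ ∑ u ∈ S', 1 := Finset.sum_le_sum fun u _ => by nlinarith
    _ = _ := by simp

open Classical in
theorem chebyshev_sum {Ω : Type*} [Fintype Ω] {P X : Ω → ℝ} (hP : ∀ ω, 0 ≤ P ω) {V r : ℝ}
    (hr : 0 < r) (h : ∑ ω, P ω * X ω ^ 2 ≤ V) :
    ∑ ω ∈ Finset.univ.filter (fun ω => r < |X ω|), P ω ≤ V / r ^ 2 := by
  rw [le_div_iff₀ (by positivity), Finset.sum_mul]
  refine le_trans ?_ h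
  refine (Finset.sum_le_sum (g := fun ω => P ω * X ω ^ 2) fun ω hω => ?_).trans
    (Finset.sum_le_sum_of_subset_of_nonneg (Finset.filter_subset _ _) fun ω _ _ =>
      mul_nonneg (hP ω) (sq_nonneg _))
  refine mul_le_mul_of_nonneg_left ?_ (hP ω)
  rw [← sq_abs (X ω)]
  exact pow_le_pow_left₀ hr.le (Finset.mem_filter.1 hω).2.le 2

/-- The height function of an ensemble on a box, normalized at the south-west corner. -/
noncomputable def boxHeight {m : ℤ} {n : ℕ} (E : Ensemble (box m n : Set (ℤ × ℤ))) : ℤ × ℤ → ℤ :=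
  (E.exists_height m n subset_rfl).choose

theorem boxHeight_spec {m : ℤ} {n : ℕ} (E : Ensemble (box m n : Set (ℤ × ℤ))) :
    IsHeight (boxHeight E) ∧ boxHeight E (m, m) = 0 ∧ ∀ v ∈ box m n, Fits (boxHeight E) v (E.total v) :=
  (E.exists_height m n subset_rfl).choose_spec

theorem sum_j₁_eq {h : ℤ × ℤ → ℤ} {c : ℤ × ℤ → ArrowConfig} {a b : ℤ} {N : ℕ}
    (hf : ∀ k : ℕ, k < N → Fits h (a, b + k) (c (a, b + k))) :
    ∑ k ∈ Finset.range N, ((c (a, b + k)).j₁.toNat : ℤ) =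
      h (a - 1, b - 1) - h (a - 1, b + N - 1) := by
  induction N with
  | zero => simp
  | succ N ih =>
    rw [Finset.sum_range_succ, ih fun k hk => hf k (by omega), (hf N (by omega)).2.1]
    simp only
    push_cast
    rw [← add_assoc, add_sub_cancel_right]
    ring

theorem stochasticWeight_nonneg {B₁ B₂ : ℝ} (h₁ : 0 ≤ B₁) (h₁' : B₁ ≤ 1) (h₂ : 0 ≤ B₂)
    (h₂' : B₂ ≤ 1) (c : ArrowConfig) : 0 ≤ stochasticWeight B₁ B₂ c := by
  simp only [stochasticWeight, sixVertexWeight]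
  split <;> linarith

theorem bernoulliWeight_nonneg {a : ℝ} (h₀ : 0 ≤ a) (h₁ : a ≤ 1) (i : Bool) :
    0 ≤ bernoulliWeight a i := by
  cases i <;> simp [bernoulliWeight, h₀, h₁]

theorem bernoulliWeight_le_one {a : ℝ} (h₀ : 0 ≤ a) (h₁ : a ≤ 1) (i : Bool) :
    bernoulliWeight a i ≤ 1 := by
  cases i <;> simp [bernoulliWeight, h₀, h₁]

theorem entranceWeight_nonneg {B₁ B₂ a b : ℝ} (h₁ : 0 ≤ B₁) (h₁' : B₁ ≤ 1) (h₂ : 0 ≤ B₂)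
    (h₂' : B₂ ≤ 1) (ha : 0 ≤ a) (ha1 : a ≤ 1) (hb : 0 ≤ b) (hb1 : b ≤ 1) (Λ : Finset (ℤ × ℤ))
    (v : ℤ × ℤ) (c : ArrowConfig) : 0 ≤ entranceWeight B₁ B₂ a b Λ v c := by
  have := stochasticWeight_nonneg h₁ h₁' h₂ h₂' c
  have := bernoulliWeight_nonneg ha ha1 c.i₁
  have := bernoulliWeight_nonneg hb hb1 c.j₁
  rw [entranceWeight]
  split_ifs <;> positivity

open Classical in
-- Chebyshev's inequality for the arrows exiting one row of vertices, whose number is the height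
-- increment above that row. Level `j = 0` is excluded, as no row of the box lies below it.
theorem sum_entranceMass_row_deviation {B₁ B₂ a b : ℝ} (h₁ : 0 ≤ B₁) (h₁' : B₁ ≤ 1) (h₂ : 0 ≤ B₂)
    (h₂' : B₂ ≤ 1) (ha : 0 < a) (ha1 : a < 1) (hb : 0 < b)
    (hb1 : b < 1) (hab : a * (1 - b) * (1 - B₁) = (1 - a) * b * (1 - B₂)) {r : ℝ} (hr : 0 < r)
    (m : ℤ) {n i j : ℕ} (hi : i ≤ n) (hj : j ≤ n) (hj0 : 0 < j) :
    ∑ E : Ensemble (box m n : Set (ℤ × ℤ)) with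
      r < |((boxHeight E (m + i, m + j) - boxHeight E (m, m + j) : ℤ) : ℝ) - a * i|,
      entranceMass B₁ B₂ a b E ≤ n / r ^ 2 := by
  set S := (box m n).filter fun v => v.2 = m + j with hS
  set g : ℕ → ℤ × ℤ := fun k => (m + 1 + k, m + j) with hg
  have hginj : Function.Injective g := fun k l h => by simpa [hg] using h
  have hmem : ∀ k : ℕ, k < i → g k ∈ box m n := fun k hk => by
    rw [mem_box]; simp only [hg]; omega
  have hSub : (Finset.range i).image g ⊆ S := by
    intro v hv
    obtain ⟨k, hk, rfl⟩ := Finset.mem_image.1 hv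
    exact Finset.mem_filter.2 ⟨hmem k (Finset.mem_range.1 hk), rfl⟩
  have h1 := second_moment_le ha.le ha1.le
    (fun E : Ensemble (box m n : Set (ℤ × ℤ)) => entranceMass B₁ B₂ a b E)
    (fun v E => (E.total v).i₂) S
    (fun G => sum_entranceMass_row ha ha1 hb hb1 hab (box m n) (m + j) G) hSub
  have h2 : ∀ E : Ensemble (box m n : Set (ℤ × ℤ)), ∑ v ∈ (Finset.range i).image g,
      (((E.total v).i₂.toNat : ℝ) - a) =
      ((boxHeight E (m + i, m + j) - boxHeight E (m, m + j) : ℤ) : ℝ) - a * i := by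
    intro E
    rw [Finset.sum_image fun _ _ _ _ h => hginj h, Finset.sum_sub_distrib]
    have := sum_i₂_eq (h := boxHeight E) (c := E.total) (a := m + 1) (b := m + j) (N := i)
      fun k hk => (boxHeight_spec E).2.2 _ (hmem k hk)
    rw [show m + 1 + i - 1 = m + i by ring, show m + 1 - 1 = m by ring] at this
    rw [← this]
    simp [hg, mul_comm]
  simp only [h2, Finset.card_image_of_injective _ hginj, Finset.card_range] at h1
  refine (chebyshev_sum (fun E => Finset.prod_nonneg fun v _ => entranceWeight_nonneg h₁ h₁' h₂ h₂'
    ha.le ha1.le hb.le hb1.le _ _ _) hr h1).trans ?_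
  gcongr

open Classical in
theorem sum_entranceMass_left_deviation {B₁ B₂ a b : ℝ} (h₁ : 0 ≤ B₁) (h₁' : B₁ ≤ 1) (h₂ : 0 ≤ B₂)
    (h₂' : B₂ ≤ 1) (ha : 0 < a) (ha1 : a < 1) (hb : 0 < b) (hb1 : b < 1) {r : ℝ} (hr : 0 < r)
    (m : ℤ) {n j : ℕ} (hj : j ≤ n) :
    ∑ E : Ensemble (box m n : Set (ℤ × ℤ)) with
      r < |((- boxHeight E (m, m + j) : ℤ) : ℝ) - b * j|,
      entranceMass B₁ B₂ a b E ≤ n / r ^ 2 := by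
  set S := (box m n).filter fun v => v - (1, 0) ∉ box m n with hS
  set g : ℕ → ℤ × ℤ := fun k => (m + 1, m + 1 + k) with hg
  have hginj : Function.Injective g := fun k l h => by simpa [hg] using h
  have hmem : ∀ k : ℕ, k < j → g k ∈ box m n := fun k hk => by
    rw [mem_box]; simp only [hg]; omega
  have hSub : (Finset.range j).image g ⊆ S := by
    intro v hv
    obtain ⟨k, hk, rfl⟩ := Finset.mem_image.1 hv
    refine Finset.mem_filter.2 ⟨hmem k (Finset.mem_range.1 hk), ?_⟩
    rw [mem_box]
    simp [hg]
  have h1 := second_moment_le hb.le hb1.le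
    (fun E : Ensemble (box m n : Set (ℤ × ℤ)) => entranceMass B₁ B₂ a b E)
    (fun v E => (E.total v).j₁) S
    (fun G => sum_entranceMass_left B₁ B₂ a b (box m n) G) hSub
  have h2 : ∀ E : Ensemble (box m n : Set (ℤ × ℤ)), ∑ v ∈ (Finset.range j).image g,
      (((E.total v).j₁.toNat : ℝ) - b) = ((- boxHeight E (m, m + j) : ℤ) : ℝ) - b * j := by
    intro E
    rw [Finset.sum_image fun _ _ _ _ h => hginj h, Finset.sum_sub_distrib]
    have := sum_j₁_eq (h := boxHeight E) (c := E.total) (a := m + 1) (b := m + 1) (N := j)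
      fun k hk => (boxHeight_spec E).2.2 _ (hmem k hk)
    rw [show m + 1 + j - 1 = m + j by ring, show m + 1 - 1 = m by ring, (boxHeight_spec E).2.1,
      zero_sub] at this
    rw [← this]
    simp [hg, mul_comm]
  simp only [h2, Finset.card_image_of_injective _ hginj, Finset.card_range] at h1
  refine (chebyshev_sum (fun E => Finset.prod_nonneg fun v _ => entranceWeight_nonneg h₁ h₁' h₂ h₂'
    ha.le ha1.le hb.le hb1.le _ _ _) hr h1).trans ?_
  gcongr

open Classical in
/-- The stationary measure is concentrated on nearly linear ensembles. -/
theorem sum_entranceMass_deviation_le {B₁ B₂ a b : ℝ} (h₁ : 0 ≤ B₁) (h₁' : B₁ ≤ 1) (h₂ : 0 ≤ B₂)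
    (h₂' : B₂ ≤ 1) (ha : 0 < a) (ha1 : a < 1) (hb : 0 < b)
    (hb1 : b < 1) (hab : a * (1 - b) * (1 - B₁) = (1 - a) * b * (1 - B₂)) {ε : ℝ} (hε : 0 < ε) :
    ∃ n₀ : ℕ, ∀ n ≥ n₀, ∀ m : ℤ, ∑ E : Ensemble (box m n : Set (ℤ × ℤ)) with
      ∃ p ∈ grid m n, ε * n < |(boxHeight E p : ℝ) - (a * (p.1 - m) - b * (p.2 - m))|,
      entranceMass B₁ B₂ a b E ≤ 1 / 2 := by
  -- The budget is `2θn` for row and column, `2M` to reach level 0 and `4M` for interpolation, with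
  -- `6M ≤ 6θn + 6 ≤ 7θn`. The minimum with 1 ensures `M ≤ n`.
  set θ := min ε 1 / 9 with hθ
  have hθ0 : 0 < θ := by positivity
  have hθ1 : θ ≤ 1 / 9 := by
    have := min_le_right ε 1
    rw [hθ]; linarith
  have hθε : 9 * θ ≤ ε := by
    have := min_le_left ε 1
    rw [hθ]; linarith
  set K := ⌈1 / θ⌉₊ + 1 with hK
  have hK0 : 0 < K := by omega
  refine ⟨max (⌈6 / θ⌉₊) (⌈4 * (K * K) / θ ^ 2⌉₊) + 2, fun n hn m => ?_⟩
  have hn1 : 6 / θ ≤ n := (Nat.le_ceil _).trans (by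
    exact_mod_cast ((le_max_left _ _).trans (Nat.le_add_right _ 2)).trans hn)
  have hn2 : 4 * (K * K) / θ ^ 2 ≤ n := (Nat.le_ceil _).trans (by
    exact_mod_cast ((le_max_right _ _).trans (Nat.le_add_right _ 2)).trans hn)
  have hn3 : 2 ≤ n := by omega
  have hn3' : (2 : ℝ) ≤ n := by exact_mod_cast hn3
  have hn0' : (0 : ℝ) < n := by linarith
  rw [div_le_iff₀ hθ0] at hn1
  rw [div_le_iff₀ (by positivity)] at hn2
  set M := ⌈θ * n⌉₊ with hM
  have hM0 : 0 < M := Nat.ceil_pos.2 (by positivity)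
  have hMθ : θ * n ≤ M := Nat.le_ceil _
  have hMθ' : (M : ℝ) < θ * n + 1 := Nat.ceil_lt_add_one (by positivity)
  have hMn : M ≤ n := by
    have : (M : ℝ) ≤ n := by nlinarith
    exact_mod_cast this
  set μ : Ensemble (box m n : Set (ℤ × ℤ)) → ℝ := entranceMass B₁ B₂ a b with hμ
  have hμ0 : ∀ E, 0 ≤ μ E := fun E => Finset.prod_nonneg fun v _ =>
    entranceWeight_nonneg h₁ h₁' h₂ h₂' ha.le ha1.le hb.le hb1.le _ _ _
  set R : ℕ × ℕ → Ensemble (box m n : Set (ℤ × ℤ)) → Prop := fun p E =>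
    p.1 * M ≤ n ∧ p.2 * M ≤ n ∧ 0 < p.2 * M ∧ θ * n < |((boxHeight E (m + (p.1 * M : ℕ), m + (p.2 * M : ℕ)) -
      boxHeight E (m, m + (p.2 * M : ℕ)) : ℤ) : ℝ) - a * (p.1 * M : ℕ)| with hR
  set C : ℕ × ℕ → Ensemble (box m n : Set (ℤ × ℤ)) → Prop := fun p E =>
    p.2 * M ≤ n ∧ θ * n < |((- boxHeight E (m, m + (p.2 * M : ℕ)) : ℤ) : ℝ) -
      b * (p.2 * M : ℕ)| with hC
  have hr : 0 < θ * n := by positivity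
  -- There are `2K²` bad events; each must have mass at most `1/(4K²)` for the total to be `1/2`.
  have hVle : (n : ℝ) / (θ * n) ^ 2 ≤ 1 / (4 * (K * K)) := by
    rw [div_le_div_iff₀ (by positivity) (by positivity)]
    nlinarith
  have hVpos : (0 : ℝ) ≤ 1 / (4 * (K * K)) := by positivity
  have hRb : ∀ p, ∑ E, (if R p E then μ E else 0) ≤ 1 / (4 * (K * K)) := by
    intro p
    by_cases hp : p.1 * M ≤ n ∧ p.2 * M ≤ n ∧ 0 < p.2 * M
    · rw [← Finset.sum_filter]
      simp only [hR, hp, true_and]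
      exact (sum_entranceMass_row_deviation h₁ h₁' h₂ h₂' ha ha1 hb hb1 hab hr m hp.1 hp.2.1
        hp.2.2).trans hVle
    · rw [Finset.sum_eq_zero]
      · exact hVpos
      · intro E _
        rw [if_neg]
        rintro ⟨q1, q2, q3, -⟩
        exact hp ⟨q1, q2, q3⟩
  have hCb : ∀ p, ∑ E, (if C p E then μ E else 0) ≤ 1 / (4 * (K * K)) := by
    intro p
    by_cases hp : p.2 * M ≤ n
    · rw [← Finset.sum_filter]
      simp only [hC, hp, true_and]
      exact (sum_entranceMass_left_deviation h₁ h₁' h₂ h₂' ha ha1 hb hb1 hr m hp).trans hVle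
    · rw [Finset.sum_eq_zero]
      · exact hVpos
      · intro E _
        rw [if_neg]
        rintro ⟨q1, -⟩
        exact hp q1
  have hiK : ∀ i : ℕ, i * M ≤ n → i < K := by
    intro i hi
    have h1 : (i : ℝ) * M ≤ n := by exact_mod_cast hi
    have h2 : (i : ℝ) * (θ * n) ≤ n := le_trans (by gcongr) h1
    have h3 : (i : ℝ) ≤ 1 / θ := by
      rw [le_div_iff₀ hθ0]
      nlinarith
    have h4 : (i : ℝ) ≤ ⌈1 / θ⌉₊ := h3.trans (Nat.le_ceil _)
    have h5 : i ≤ ⌈1 / θ⌉₊ := by exact_mod_cast h4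
    omega
  have main : ∀ E : Ensemble (box m n : Set (ℤ × ℤ)),
      (∀ p ∈ Finset.range K ×ˢ Finset.range K, ¬ R p E ∧ ¬ C p E) →
      ∀ p ∈ grid m n, |(boxHeight E p : ℝ) - (a * (p.1 - m) - b * (p.2 - m))| ≤ ε * n := by
    intro E hE p hp
    obtain ⟨hh, h0, hf⟩ := boxHeight_spec E
    set h := boxHeight E with hh_def
    have key : ∀ i j : ℕ, i * M ≤ n → j * M ≤ n → 0 < j →
        |(h (m + (i * M : ℕ), m + (j * M : ℕ)) : ℝ) - (a * (i * M : ℕ) - b * (j * M : ℕ))|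
          ≤ 2 * (θ * n) := by
      intro i j hi hj hj0
      obtain ⟨q1, q2⟩ := hE (i, j) (Finset.mem_product.2
        ⟨Finset.mem_range.2 (hiK i hi), Finset.mem_range.2 (hiK j hj)⟩)
      simp only [hR, hC, not_and, not_lt] at q1 q2
      have q1 := q1 hi hj (Nat.mul_pos hj0 hM0)
      have q2 := q2 hj
      push_cast at q1 q2 ⊢
      rw [abs_le] at *
      constructor <;> linarith
    have hsh : IsHeight fun p => h (m + p.1, m + p.2) := by
      intro x y
      have := hh (m + x) (m + y)
      rwa [add_assoc, add_assoc] at this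
    have hp' : (p.1 - m, p.2 - m) ∈ grid 0 n := by
      rw [mem_grid] at *
      simp only
      omega
    have := near_linear_of_subgrid ha.le ha1.le hb.le hb1.le hsh (c := 0) (m := M) (n := n)
      (r := 2 * (θ * n) + 2 * M) hM0 (by
        intro i j hi hj
        simp only [zero_add, Int.cast_zero]
        -- Level 0 has no row estimate; it is compared with level `M`, over which both the height
        -- and the linear profile change by at most `M`.
        rcases Nat.eq_zero_or_pos j with rfl | hj0
        · have k1 := key i 1 hi (by omega) one_pos
          have k2 := hh.le_add_gap (m + (i * M : ℕ), m + (0 * M : ℕ))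
            (m + (i * M : ℕ), m + (1 * M : ℕ))
          have k3 := hh.le_add_gap (m + (i * M : ℕ), m + (1 * M : ℕ))
            (m + (i * M : ℕ), m + (0 * M : ℕ))
          simp only [gap, one_mul, zero_mul] at k1 k2 k3 ⊢
          have k4 : |h (m + (i * M : ℕ), m + (M : ℕ)) - h (m + (i * M : ℕ), m + (0 : ℕ))| ≤ M := by
            rw [abs_le]
            push_cast at *
            constructor <;> omega
          have k5 : |(h (m + (i * M : ℕ), m + (M : ℕ)) : ℝ) - h (m + (i * M : ℕ), m + (0 : ℕ))|
              ≤ M := by exact_mod_cast k4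
          have k6 : 0 ≤ b * M := by positivity
          have k7 : b * M ≤ M := mul_le_of_le_one_left (by positivity) hb1.le
          simp only [Nat.cast_zero] at *
          rw [abs_le] at *
          constructor <;> linarith
        · have := key i j hi hj hj0
          have k6 : (0 : ℝ) ≤ M := by positivity
          linarith) _ hp'
    simp only [add_sub_cancel] at this
    push_cast at this
    refine this.trans ?_
    have : 9 * (θ * n) ≤ ε * n := by nlinarith
    linarith
  calc ∑ E with ∃ p ∈ grid m n, ε * n < |(boxHeight E p : ℝ) - (a * (p.1 - m) - b * (p.2 - m))|, μ E
      ≤ ∑ E, ∑ p ∈ Finset.range K ×ˢ Finset.range K,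
        ((if R p E then μ E else 0) + (if C p E then μ E else 0)) := by
        rw [Finset.sum_filter]
        refine Finset.sum_le_sum fun E _ => ?_
        have hnn : ∀ p ∈ Finset.range K ×ˢ Finset.range K,
            0 ≤ (if R p E then μ E else 0) + (if C p E then μ E else 0) := fun p _ => by
          have := hμ0 E
          split_ifs <;> simp [this]
        split_ifs with hE
        · obtain ⟨p, hp, hlt⟩ := hE
          obtain ⟨q, hq, hq'⟩ : ∃ q ∈ Finset.range K ×ˢ Finset.range K, R q E ∨ C q E := by
            by_contra hcon
            push Not at hcon
            exact absurd (main E hcon p hp) (not_le.2 hlt)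
          refine le_trans ?_ (Finset.single_le_sum hnn hq)
          have := hμ0 E
          rcases hq' with h | h
          · rw [if_pos h]; split_ifs <;> linarith
          · rw [if_pos h]; split_ifs <;> linarith
        · exact Finset.sum_nonneg hnn
    _ = ∑ p ∈ Finset.range K ×ˢ Finset.range K,
        (∑ E, (if R p E then μ E else 0) + ∑ E, (if C p E then μ E else 0)) := by
        rw [Finset.sum_comm]
        exact Finset.sum_congr rfl fun p _ => Finset.sum_add_distrib
    _ ≤ ∑ p ∈ Finset.range K ×ˢ Finset.range K, (1 / (4 * (K * K)) + 1 / (4 * (K * K)) : ℝ) :=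
        Finset.sum_le_sum fun p _ => add_le_add (hRb p) (hCb p)
    _ = 1 / 2 := by
        rw [Finset.sum_const, Finset.card_product, Finset.card_range, nsmul_eq_mul]
        push_cast
        field_simp
        norm_num

/-! ### Removing paths periodically -/

/-- The monotone map that, in every period of length `M`, increases on the first `K` steps and is
constant on the others. -/
def levelMap (M K : ℕ) (z : ℤ) : ℤ := K * (z / M) + min (z % M) K

/-- Whether `levelMap M K` increases between `z` and `z + 1`. -/
def Rises (M K : ℕ) (z : ℤ) : Prop := z % M < K

/-- Whether `levelMap M K` changes between increasing and constant near `z`. -/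
def Breaks (M K : ℕ) (z : ℤ) : Prop :=
  ¬(Rises M K (z - 2) ↔ Rises M K (z - 1)) ∨ ¬(Rises M K (z - 1) ↔ Rises M K z) ∨
    ¬(Rises M K z ↔ Rises M K (z + 1))

theorem add_one_div_mod {M : ℕ} (hM : 0 < M) (z : ℤ) :
    (z % M + 1 < M ∧ (z + 1) % M = z % M + 1 ∧ (z + 1) / M = z / M) ∨
      (z % M + 1 = M ∧ (z + 1) % M = 0 ∧ (z + 1) / M = z / M + 1) := by
  have hM' : (0 : ℤ) < M := by exact_mod_cast hM
  have h1 := Int.emod_nonneg z hM'.ne'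
  have h2 := Int.emod_lt_of_pos z hM'
  have h3 := Int.emod_add_mul_ediv z M
  rcases lt_or_eq_of_le (Int.add_one_le_iff.2 h2) with h | h
  · left
    have := Int.ediv_emod_unique hM' (a := z + 1) (q := z / M) (r := z % M + 1)
    obtain ⟨e1, e2⟩ := this.2 ⟨by linarith, by omega, h⟩
    exact ⟨h, e2, e1⟩
  · right
    have := Int.ediv_emod_unique hM' (a := z + 1) (q := z / M + 1) (r := 0)
    obtain ⟨e1, e2⟩ := this.2 ⟨by linarith, le_rfl, hM'⟩
    exact ⟨h, e2, e1⟩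

theorem levelMap_add_one {M K : ℕ} (hM : 0 < M) (hK : K ≤ M) (z : ℤ) [Decidable (Rises M K z)] :
    levelMap M K (z + 1) = levelMap M K z + if Rises M K z then 1 else 0 := by
  have hM' : (0 : ℤ) < M := by exact_mod_cast hM
  have h1 := Int.emod_nonneg z hM'.ne'
  have hK' : (K : ℤ) ≤ M := by exact_mod_cast hK
  simp only [levelMap, Rises] at *
  rcases add_one_div_mod hM z with ⟨h, e1, e2⟩ | ⟨h, e1, e2⟩
  · rw [e1, e2]
    split_ifs <;> omega
  · rw [e1, e2, mul_add]
    split_ifs <;> omega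

theorem levelMap_of_rises {M K : ℕ} (hM : 0 < M) (hK : K ≤ M) {z : ℤ} (h : Rises M K z) :
    levelMap M K (z + 1) = levelMap M K z + 1 := by
  classical
  rw [levelMap_add_one hM hK, if_pos h]

theorem levelMap_of_not_rises {M K : ℕ} (hM : 0 < M) (hK : K ≤ M) {z : ℤ} (h : ¬ Rises M K z) :
    levelMap M K (z + 1) = levelMap M K z := by
  classical
  rw [levelMap_add_one hM hK, if_neg h, add_zero]

theorem levelMap_mono {M K : ℕ} (hM : 0 < M) (hK : K ≤ M) : Monotone (levelMap M K) := by
  classical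
  refine monotone_int_of_le_succ fun z => ?_
  rw [levelMap_add_one hM hK]
  split_ifs <;> omega

theorem levelMap_succ_le {M K : ℕ} (hM : 0 < M) (hK : K ≤ M) (z : ℤ) :
    levelMap M K (z + 1) ≤ levelMap M K z + 1 := by
  classical
  rw [levelMap_add_one hM hK]
  split_ifs <;> omega

/-- `levelMap` is monotone with steps at most 1, so height functions are preserved. The level lines
at which it rises are the paths that are kept. -/
theorem IsHeight.comp_levelMap {M K : ℕ} (hM : 0 < M) (hK : K ≤ M) {h : ℤ × ℤ → ℤ}
    (hh : IsHeight h) (θ : ℤ) : IsHeight fun p => levelMap M K (h p + θ) := by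
  intro x y
  obtain ⟨h1, h2, h3, h4⟩ := hh x y
  have mono := levelMap_mono hM hK
  refine ⟨mono (by omega), (mono (b := h (x, y) + θ + 1) (by omega)).trans (levelMap_succ_le hM hK _),
    mono (by omega), (mono (b := h (x, y + 1) + θ + 1) (by omega)).trans (levelMap_succ_le hM hK _)⟩

theorem abs_levelMap_sub_le {M K : ℕ} (hM : 0 < M) (hK : K ≤ M) (z : ℤ) :
    |(levelMap M K z : ℝ) - K / M * z| ≤ M := by
  have hM' : (0 : ℤ) < M := by exact_mod_cast hM
  have hMr : (0 : ℝ) < M := by exact_mod_cast hM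
  have hKr : (K : ℝ) ≤ M := by exact_mod_cast hK
  have h1 : (0 : ℝ) ≤ (z % M : ℤ) := by exact_mod_cast Int.emod_nonneg z hM'.ne'
  have h2 : ((z % M : ℤ) : ℝ) ≤ M := by exact_mod_cast (Int.emod_lt_of_pos z hM').le
  have h3 : (z : ℝ) = (z % M : ℤ) + M * (z / M : ℤ) := by
    exact_mod_cast (Int.emod_add_mul_ediv z M).symm
  have h4 : (levelMap M K z : ℝ) - K / M * z =
      min ((z % M : ℤ) : ℝ) K - K / M * (z % M : ℤ) := by
    rw [h3, levelMap]
    push_cast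
    field_simp
    ring
  rw [h4, abs_le]
  have h5 : K / M * ((z % M : ℤ) : ℝ) ≤ M := by
    rw [div_mul_eq_mul_div, div_le_iff₀ hMr]
    exact mul_le_mul hKr h2 h1 hMr.le
  have h6 : 0 ≤ K / M * ((z % M : ℤ) : ℝ) := by positivity
  have h7 : min ((z % M : ℤ) : ℝ) K ≤ M := (min_le_right _ _).trans hKr
  have h8 : 0 ≤ min ((z % M : ℤ) : ℝ) K := le_min h1 (by positivity)
  constructor <;> linarith

theorem emod_of_rises_ne {M K : ℕ} (hM : 0 < M) {z : ℤ} (h : ¬(Rises M K z ↔ Rises M K (z + 1))) :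
    z % M = K - 1 ∨ z % M = M - 1 := by
  simp only [Rises] at h
  rcases add_one_div_mod hM z with ⟨h1, e1, e2⟩ | ⟨h1, e1, e2⟩
  · rw [e1] at h
    left
    omega
  · right
    omega

theorem card_emod_eq_le_one {M : ℕ} (c ρ : ℤ) :
    ((Finset.range M).filter fun θ : ℕ => (c + θ) % M = ρ).card ≤ 1 := by
  rw [Finset.card_le_one]
  intro i hi j hj
  rw [Finset.mem_filter, Finset.mem_range] at hi hj
  have h1 : (c + i) % M = (c + j) % M := hi.2.trans hj.2.symm
  have h2 := Int.ModEq.dvd h1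
  have h3 := Int.eq_zero_of_abs_lt_dvd h2 (by rw [abs_lt]; omega)
  omega

open Classical in
-- A break is a change after one of three consecutive integers, and a change forces the residue `K -
-- 1` or `M - 1` modulo `M`. Each of these six congruences holds for at most one shift in a period.
theorem card_breaks_le {M K : ℕ} (hM : 0 < M) (z : ℤ) :
    ((Finset.range M).filter fun θ : ℕ => Breaks M K (z + θ)).card ≤ 6 := by
  set A : ℤ → ℤ → Finset ℕ := fun c ρ =>
    (Finset.range M).filter fun θ : ℕ => (c + θ) % M = ρ with hA
  have hsub : ((Finset.range M).filter fun θ : ℕ => Breaks M K (z + θ)) ⊆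
      (A (z - 2) (K - 1) ∪ A (z - 2) (M - 1)) ∪ ((A (z - 1) (K - 1) ∪ A (z - 1) (M - 1)) ∪
        (A z (K - 1) ∪ A z (M - 1))) := by
    intro θ hθ
    rw [Finset.mem_filter] at hθ
    obtain ⟨hθM, h⟩ := hθ
    simp only [hA, Finset.mem_union, Finset.mem_filter, hθM, true_and]
    rcases h with h | h | h
    · left
      rw [show z + (θ : ℤ) - 2 = z - 2 + θ by ring,
        show z + (θ : ℤ) - 1 = z - 2 + θ + 1 by ring] at h
      exact emod_of_rises_ne hM h
    · right; left
      rw [show z + (θ : ℤ) - 1 = z - 1 + θ by ring,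
        show z + (θ : ℤ) = z - 1 + θ + 1 by ring] at h
      exact emod_of_rises_ne hM h
    · right; right
      exact emod_of_rises_ne hM h
  refine (Finset.card_le_card hsub).trans ?_
  have one : ∀ c ρ, (A c ρ).card ≤ 1 := fun c ρ => card_emod_eq_le_one c ρ
  have u : ∀ c ρ ρ', (A c ρ ∪ A c ρ').card ≤ 1 + 1 := fun c ρ ρ' =>
    (Finset.card_union_le _ _).trans (add_le_add (one c ρ) (one c ρ'))
  refine (Finset.card_union_le _ _).trans (le_trans (add_le_add (u _ _ _)
    ((Finset.card_union_le _ _).trans (add_le_add (u _ _ _) (u _ _ _)))) (by norm_num))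

/-- Where `levelMap` rises on both sides, it is injective. -/
theorem eq_of_levelMap_eq {M K : ℕ} (hM : 0 < M) (hK : K ≤ M) {x y : ℤ} (h₁ : Rises M K (x - 1))
    (h₂ : Rises M K x) (h : levelMap M K y = levelMap M K x) : y = x := by
  have e1 := levelMap_of_rises hM hK h₁
  have e2 := levelMap_of_rises hM hK h₂
  rw [sub_add_cancel] at e1
  by_contra hne
  rcases lt_or_gt_of_ne hne with hlt | hlt
  · have := levelMap_mono hM hK (Int.le_sub_one_of_lt hlt)
    omega
  · have := levelMap_mono hM hK (Int.add_one_le_of_lt hlt)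
    omega

section Fibre

variable {m : ℤ} {n M K : ℕ}

/-- The ensemble obtained by removing paths periodically. -/
noncomputable def thin (hM : 0 < M) (hK : K ≤ M) (θ : ℤ) (E : Ensemble (box m n : Set (ℤ × ℤ))) :
    Ensemble (box m n : Set (ℤ × ℤ)) :=
  ((boxHeight_spec E).1.comp_levelMap hM hK θ).ensemble _

open Classical in
/-- The vertices near which paths start to be removed or to be kept. -/
noncomputable def breakSet (M K : ℕ) (θ : ℤ) (E : Ensemble (box m n : Set (ℤ × ℤ))) :
    Finset (ℤ × ℤ) :=
  (box m n).filter fun v => Breaks M K (boxHeight E (v.1 - 1, v.2 - 1) + θ)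

theorem thin_fits (hM : 0 < M) (hK : K ≤ M) (θ : ℤ) (E : Ensemble (box m n : Set (ℤ × ℤ)))
    {v : ℤ × ℤ} (hv : v ∈ box m n) :
    Fits (fun p => levelMap M K (boxHeight E p + θ)) v ((thin hM hK θ E).total v) :=
  IsHeight.fits_ensemble _ (Finset.mem_coe.2 hv)

theorem mem_grid_of_mem_box {v : ℤ × ℤ} (hv : v ∈ box m n) :
    (v.1, v.2) ∈ grid m n ∧ (v.1 - 1, v.2) ∈ grid m n ∧ (v.1, v.2 - 1) ∈ grid m n ∧
      (v.1 - 1, v.2 - 1) ∈ grid m n := by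
  simp only [mem_grid]
  rw [mem_box] at hv
  omega

/-- Both thinned heights equal `levelMap M K θ` at the south-west corner, so uniqueness of heights
applies. -/
theorem levelMap_boxHeight_eq (hM : 0 < M) (hK : K ≤ M) {θ : ℤ}
    {E E' : Ensemble (box m n : Set (ℤ × ℤ))} (h : thin hM hK θ E = thin hM hK θ E') :
    ∀ p ∈ grid m n, levelMap M K (boxHeight E p + θ) = levelMap M K (boxHeight E' p + θ) := by
  refine height_unique (c := (thin hM hK θ E).total) (fun v hv => thin_fits hM hK θ E hv)
    (fun v hv => ?_) ?_
  · rw [h]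
    exact thin_fits hM hK θ E' hv
  · simp only [(boxHeight_spec E).2.1, (boxHeight_spec E').2.1]

/-- Vertices around which no path is removed keep their configurations. -/
theorem total_eq_thin (hM : 0 < M) (hK : K ≤ M) {θ : ℤ}
    {E E' : Ensemble (box m n : Set (ℤ × ℤ))} (h : thin hM hK θ E = thin hM hK θ E')
    {v : ℤ × ℤ} (hv : v ∈ box m n)
    (hr : ∀ e : ℤ, -2 ≤ e → e ≤ 1 → Rises M K (boxHeight E' (v.1 - 1, v.2 - 1) + θ + e)) :
    E.total v = (thin hM hK θ E').total v := by
  set k := boxHeight E' with hk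
  obtain ⟨g1, g2, g3, g4⟩ := mem_grid_of_mem_box hv
  have hkh := (boxHeight_spec E').1
  have b1 := hkh (v.1 - 1) (v.2 - 1)
  have b2 := hkh (v.1 - 1) v.2
  have b3 := hkh v.1 (v.2 - 1)
  simp only [sub_add_cancel] at b1 b2 b3
  rw [← hk] at b1 b2 b3
  have heq := levelMap_boxHeight_eq hM hK h
  set z := k (v.1 - 1, v.2 - 1) + θ with hz
  -- All corners of `v` have heights within 1 of the south-west one, and injectivity of `levelMap`
  -- at `x` uses the steps starting at `x - 1` and at `x`; this is why `e` runs from -2 to 1.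
  have hinj : ∀ p ∈ grid m n, z - 1 ≤ k p + θ → k p + θ ≤ z + 1 → k p = boxHeight E p := by
    intro p hp h1 h2
    have r1 := hr (k p + θ - 1 - z) (by omega) (by omega)
    have r2 := hr (k p + θ - z) (by omega) (by omega)
    rw [add_sub_cancel] at r1 r2
    have := eq_of_levelMap_eq hM hK r1 r2 (heq p hp)
    omega
  have hE : Fits k v (E.total v) := ((boxHeight_spec E).2.2 v hv).congr
    (hinj _ g1 (by omega) (by omega)).symm (hinj _ g2 (by omega) (by omega)).symm
    (hinj _ g3 (by omega) (by omega)).symm (hinj _ g4 (by omega) (by omega)).symm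
  have hstep : ∀ x y : ℤ, z - 1 ≤ x → x ≤ z + 1 → z - 1 ≤ y → y ≤ z + 1 →
      levelMap M K x - levelMap M K y = x - y := by
    have hval : ∀ x : ℤ, z - 1 ≤ x → x ≤ z + 1 → levelMap M K x = levelMap M K (z - 1) + (x - (z - 1)) := by
      intro x hx1 hx2
      have s1 := levelMap_of_rises hM hK (hr (-1) (by norm_num) (by norm_num))
      have s2 := levelMap_of_rises hM hK (hr 0 (by norm_num) (by norm_num))
      rw [show z + -1 + 1 = z by ring, ← sub_eq_add_neg] at s1
      rw [add_zero] at s2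
      obtain rfl | rfl | rfl : x = z - 1 ∨ x = z ∨ x = z + 1 := by omega
      · ring
      · rw [s1]; ring
      · rw [s2, s1]; ring
    intro x y h1 h2 h3 h4
    rw [hval x h1 h2, hval y h3 h4]
    ring
  refine Fits.unique (h := fun p => levelMap M K (k p + θ)) ?_ (thin_fits hM hK θ E' hv)
  obtain ⟨f1, f2, f3, f4⟩ := hE
  refine ⟨?_, ?_, ?_, ?_⟩ <;> simp only
  · rw [hstep _ _ (by omega) (by omega) (by omega) (by omega)]; omega
  · rw [hstep _ _ (by omega) (by omega) (by omega) (by omega)]; omega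
  · rw [hstep _ _ (by omega) (by omega) (by omega) (by omega)]; omega
  · rw [hstep _ _ (by omega) (by omega) (by omega) (by omega)]; omega

/-- Vertices around which all paths are removed become empty. -/
theorem thin_eq_empty (hM : 0 < M) (hK : K ≤ M) {θ : ℤ}
    {E : Ensemble (box m n : Set (ℤ × ℤ))} {v : ℤ × ℤ} (hv : v ∈ box m n)
    (hr : ∀ e : ℤ, -2 ≤ e → e ≤ 1 → ¬ Rises M K (boxHeight E (v.1 - 1, v.2 - 1) + θ + e)) :
    (thin hM hK θ E).total v = ⟨(false, false, false, false), rfl⟩ := by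
  set k := boxHeight E with hk
  have hkh := (boxHeight_spec E).1
  have b1 := hkh (v.1 - 1) (v.2 - 1)
  have b2 := hkh (v.1 - 1) v.2
  have b3 := hkh v.1 (v.2 - 1)
  simp only [sub_add_cancel] at b1 b2 b3
  rw [← hk] at b1 b2 b3
  set z := k (v.1 - 1, v.2 - 1) + θ with hz
  have hval : ∀ x : ℤ, z - 1 ≤ x → x ≤ z + 1 → levelMap M K x = levelMap M K z := by
    intro x hx1 hx2
    have s1 := levelMap_of_not_rises hM hK (hr (-1) (by norm_num) (by norm_num))
    have s2 := levelMap_of_not_rises hM hK (hr 0 (by norm_num) (by norm_num))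
    rw [show z + -1 + 1 = z by ring, ← sub_eq_add_neg] at s1
    rw [add_zero] at s2
    obtain rfl | rfl | rfl : x = z - 1 ∨ x = z ∨ x = z + 1 := by omega
    · rw [s1]
    · rfl
    · rw [s2]
  refine (thin_fits hM hK θ E hv).unique ?_
  have c1 := hval (k (v.1, v.2) + θ) (by omega) (by omega)
  have c2 := hval (k (v.1 - 1, v.2) + θ) (by omega) (by omega)
  have c3 := hval (k (v.1, v.2 - 1) + θ) (by omega) (by omega)
  refine ⟨?_, ?_, ?_, ?_⟩ <;> simp only [← hk, c1, c2, c3, ← hz] <;>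
    simp [ArrowConfig.i₁, ArrowConfig.j₁, ArrowConfig.i₂, ArrowConfig.j₂]

end Fibre

/-! ### Weight lost by thinning, and nearly linear ensembles of smaller slope -/

theorem stochasticWeight_pos_bound {B₁ B₂ w₀ : ℝ} (h1 : w₀ ≤ B₁) (h2 : w₀ ≤ 1 - B₁) (h3 : w₀ ≤ B₂)
    (h4 : w₀ ≤ 1 - B₂) (c : ArrowConfig) : w₀ ≤ stochasticWeight B₁ B₂ c := by
  obtain ⟨⟨i, j, k, l⟩, hc⟩ := c
  revert hc
  cases i <;> cases j <;> cases k <;> cases l <;> intro hc <;>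
    simp [ArrowConfig.i₁, ArrowConfig.j₁, ArrowConfig.i₂, ArrowConfig.j₂,
      stochasticWeight, sixVertexWeight] at hc ⊢ <;> linarith

open Classical in
/-- The total probability of the ensembles with given configurations on `D`. -/
theorem sum_entranceMass_le_of_fixed {B₁ B₂ a b : ℝ} (h₁ : 0 ≤ B₁) (h₁' : B₁ ≤ 1) (h₂ : 0 ≤ B₂)
    (h₂' : B₂ ≤ 1) (ha : 0 ≤ a) (ha1 : a ≤ 1) (hb : 0 ≤ b) (hb1 : b ≤ 1) (Λ D : Finset (ℤ × ℤ))
    (hD : D ⊆ Λ) (c₀ : ℤ × ℤ → ArrowConfig) (F : Finset (Ensemble (Λ : Set (ℤ × ℤ))))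
    (hF : ∀ E ∈ F, ∀ v ∈ D, E.total v = c₀ v) :
    ∑ E ∈ F, entranceMass B₁ B₂ a b E ≤ ∏ v ∈ D, stochasticWeight B₁ B₂ (c₀ v) := by
  have hw := stochasticWeight_nonneg h₁ h₁' h₂ h₂'
  have hp := bernoulliWeight_nonneg ha ha1
  have hq := bernoulliWeight_nonneg hb hb1
  -- On `D` the vertex weight is factored out and the configuration forced to be `c₀ v`. One
  -- configuration then contributes, with factor at most 1, so these remain subprobability weights.
  set W : ℤ × ℤ → ArrowConfig → ℝ := fun v c =>
    if v ∈ D then ((if v - (0, 1) ∈ Λ then 1 else bernoulliWeight a c.i₁) *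
      (if v - (1, 0) ∈ Λ then 1 else bernoulliWeight b c.j₁)) * (if c = c₀ v then 1 else 0)
    else entranceWeight B₁ B₂ a b Λ v c with hW
  have hfac : ∀ v (c : ArrowConfig), 0 ≤ (if v - (0, 1) ∈ Λ then 1 else bernoulliWeight a c.i₁) *
      (if v - (1, 0) ∈ Λ then 1 else bernoulliWeight b c.j₁) := by
    intro v c
    have := hp c.i₁
    have := hq c.j₁
    split_ifs <;> positivity
  have hfac1 : ∀ v (c : ArrowConfig), (if v - (0, 1) ∈ Λ then 1 else bernoulliWeight a c.i₁) *
      (if v - (1, 0) ∈ Λ then 1 else bernoulliWeight b c.j₁) ≤ 1 := by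
    intro v c
    have := hp c.i₁
    have := hq c.j₁
    have := bernoulliWeight_le_one ha ha1 c.i₁
    have := bernoulliWeight_le_one hb hb1 c.j₁
    refine mul_le_one₀ ?_ ?_ ?_ <;> split_ifs <;> simp [*]
  have hW0 : ∀ v c, 0 ≤ W v c := by
    intro v c
    by_cases hv : v ∈ D
    · simp only [hW, if_pos hv]
      exact mul_nonneg (hfac v c) (by split_ifs <;> norm_num)
    · simp only [hW, if_neg hv]
      exact entranceWeight_nonneg h₁ h₁' h₂ h₂' ha ha1 hb hb1 _ _ _
  have hsum : ∑ E : Ensemble (Λ : Set (ℤ × ℤ)), ∏ v ∈ Λ, W v (E.total v) ≤ 1 := by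
    refine sum_prod_le_of_order toLex_injective' W hW0 Λ fun v _ Γ hΓ E => ?_
    by_cases hv : v ∈ D
    · calc _ ≤ ∑ c, W v c := Finset.sum_le_sum fun c _ => by
            split_ifs
            exacts [le_rfl, hW0 v c]
        _ = (if v - (0, 1) ∈ Λ then 1 else bernoulliWeight a (c₀ v).i₁) *
            (if v - (1, 0) ∈ Λ then 1 else bernoulliWeight b (c₀ v).j₁) := by
            simp [hW, hv]
        _ ≤ 1 := hfac1 v _
    · refine le_of_eq ?_
      simp only [hW, hv, if_false, entranceWeight]
      calc _ = ∑ c : ArrowConfig, if (v - (0, 1) ∈ Λ → (E.total (v - (0, 1))).i₂ = c.i₁) ∧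
              (v - (1, 0) ∈ Λ → (E.total (v - (1, 0))).j₂ = c.j₁) then
            (if v - (0, 1) ∈ Λ then 1 else bernoulliWeight a c.i₁) *
            (if v - (1, 0) ∈ Λ then 1 else bernoulliWeight b c.j₁) *
              stochasticWeight B₁ B₂ c else 0 :=
            Finset.sum_congr rfl fun c _ => if_congr (forward_compat hΓ E c) rfl rfl
        _ = 1 := by
          rw [forward_sum, bernoulliWeight_sum, bernoulliWeight_sum, ite_self, ite_self, mul_one]
  have hterm : ∀ E ∈ F, entranceMass B₁ B₂ a b E =
      (∏ v ∈ D, stochasticWeight B₁ B₂ (c₀ v)) * ∏ v ∈ Λ, W v (E.total v) := by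
    intro E hE
    rw [entranceMass, ← Finset.prod_sdiff hD, ← Finset.prod_sdiff hD (f := fun v => W v (E.total v)),
      mul_left_comm, ← Finset.prod_mul_distrib]
    congr 1
    · refine Finset.prod_congr rfl fun v hv => ?_
      simp only [hW, if_neg (Finset.mem_sdiff.1 hv).2]
    · refine Finset.prod_congr rfl fun v hv => ?_
      simp only [hW, if_pos hv, hF E hE v hv, entranceWeight]
      simp only [if_true]
      ring
  rw [Finset.sum_congr rfl hterm, ← Finset.mul_sum]
  refine mul_le_of_le_one_right (Finset.prod_nonneg fun v _ => hw _) (le_trans ?_ hsum)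
  exact Finset.sum_le_sum_of_subset_of_nonneg (Finset.subset_univ _) fun E _ _ =>
    Finset.prod_nonneg fun v _ => hW0 _ _

open Classical in
/-- Thinning loses only a small part of the total weight. -/
theorem sum_entranceMass_le_sum_thin {B₁ B₂ a b w₀ : ℝ} (h₁ : 0 ≤ B₁) (h₁' : B₁ ≤ 1)
    (h₂ : 0 ≤ B₂) (h₂' : B₂ ≤ 1) (ha : 0 ≤ a) (ha1 : a ≤ 1) (hb : 0 ≤ b) (hb1 : b ≤ 1)
    (hw0 : 0 ≤ w₀) (hw1 : w₀ ≤ 1) (hw : ∀ c, w₀ ≤ stochasticWeight B₁ B₂ c)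
    {m : ℤ} {n M K : ℕ} (hM : 0 < M) (hK : K ≤ M) (θ : ℤ) {τ : ℕ}
    (F : Finset (Ensemble (box m n : Set (ℤ × ℤ)))) (hF : ∀ E ∈ F, (breakSet M K θ E).card ≤ τ) :
    w₀ ^ τ * ∑ E ∈ F, entranceMass B₁ B₂ a b E ≤
      ∑ G ∈ F.image (thin hM hK θ), G.weight (stochasticWeight B₁ B₂) := by
  rw [← Finset.sum_fiberwise_of_maps_to (t := F.image (thin hM hK θ)) (g := thin hM hK θ)
    (fun E hE => Finset.mem_image_of_mem _ hE), Finset.mul_sum]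
  refine Finset.sum_le_sum fun G hG => ?_
  obtain ⟨E', hE', rfl⟩ := Finset.mem_image.1 hG
  -- On `D` all ensembles with the same thinning agree with the thinned one, so the whole fibre has
  -- mass at most the weight of the thinned ensemble on `D`.
  set D := (box m n).filter fun v => ∀ e : ℤ, -2 ≤ e → e ≤ 1 →
    Rises M K (boxHeight E' (v.1 - 1, v.2 - 1) + θ + e) with hD
  have h3 := sum_entranceMass_le_of_fixed h₁ h₁' h₂ h₂' ha ha1 hb hb1 (box m n) D
    (Finset.filter_subset _ _) (thin hM hK θ E').total
    (F.filter fun E => thin hM hK θ E = thin hM hK θ E') (by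
      intro E hE v hv
      rw [Finset.mem_filter] at hE hv
      exact total_eq_thin hM hK hE.2 hv.1 hv.2)
  refine (mul_le_mul_of_nonneg_left h3 (pow_nonneg hw0 _)).trans ?_
  rw [Ensemble.weight_eq_prod_total, ← Finset.prod_sdiff (Finset.filter_subset _ _ : D ⊆ box m n)]
  refine mul_le_mul_of_nonneg_right ?_ (Finset.prod_nonneg fun v _ => hw0.trans (hw _))
  calc w₀ ^ τ ≤ w₀ ^ ((box m n \ D) ∩ breakSet M K θ E').card :=
        pow_le_pow_of_le_one hw0 hw1 ((Finset.card_le_card Finset.inter_subset_right).trans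
          (hF E' hE'))
    _ = ∏ v ∈ box m n \ D, if v ∈ breakSet M K θ E' then w₀ else 1 := by
        rw [← Finset.prod_filter, Finset.prod_const, Finset.filter_mem_eq_inter]
    _ ≤ _ := by
        refine Finset.prod_le_prod (fun v _ => by split_ifs <;> positivity) fun v hv => ?_
        split_ifs with hb
        · exact hw _
        -- Outside `D` and away from breaks, `levelMap` is flat on all four steps; the thinned
        -- vertex is empty and has weight 1.
        · obtain ⟨hvb, hvD⟩ := Finset.mem_sdiff.1 hv
          have hnb : ¬ Breaks M K (boxHeight E' (v.1 - 1, v.2 - 1) + θ) := fun h =>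
            hb (Finset.mem_filter.2 ⟨hvb, h⟩)
          set z := boxHeight E' (v.1 - 1, v.2 - 1) + θ with hz
          simp only [Breaks, not_or, not_not] at hnb
          obtain ⟨n1, n2, n3⟩ := hnb
          have hall : ∀ e : ℤ, -2 ≤ e → e ≤ 1 → (Rises M K (z + e) ↔ Rises M K z) := by
            intro e he he'
            obtain rfl | rfl | rfl | rfl : e = -2 ∨ e = -1 ∨ e = 0 ∨ e = 1 := by omega
            · rw [← sub_eq_add_neg, n1, n2]
            · rw [← sub_eq_add_neg, n2]
            · rw [add_zero]
            · exact n3.symm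
          have hnr : ¬ Rises M K z := fun h =>
            hvD (Finset.mem_filter.2 ⟨hvb, fun e he he' => (hall e he he').2 h⟩)
          rw [thin_eq_empty hM hK hvb fun e he he' h => hnr ((hall e he he').1 h)]
          simp [stochasticWeight, sixVertexWeight, ArrowConfig.i₁, ArrowConfig.j₁, ArrowConfig.i₂,
            ArrowConfig.j₂]

/-- Averaging over the `M` shifts: each of the `n²` vertices is a break for at most 6 of them. -/
theorem exists_shift_few_breaks {m : ℤ} {n M K : ℕ} (hM : 0 < M)
    (E : Ensemble (box m n : Set (ℤ × ℤ))) :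
    ∃ θ ∈ Finset.range M, (breakSet M K θ E).card ≤ 6 * n ^ 2 / M := by
  classical
  by_contra hcon
  push Not at hcon
  have h1 : ∑ θ ∈ Finset.range M, (breakSet M K θ E).card ≤ 6 * n ^ 2 := by
    simp only [breakSet, Finset.card_filter]
    rw [Finset.sum_comm]
    calc _ ≤ ∑ v ∈ box m n, 6 := Finset.sum_le_sum fun v _ => by
          rw [← Finset.card_filter]
          exact card_breaks_le hM _
      _ = _ := by rw [Finset.sum_const, card_box, smul_eq_mul, mul_comm]
  have h2 : ∑ θ ∈ Finset.range M, (6 * n ^ 2 / M + 1) ≤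
      ∑ θ ∈ Finset.range M, (breakSet M K θ E).card := Finset.sum_le_sum fun θ hθ => hcon θ hθ
  rw [Finset.sum_const, Finset.card_range, smul_eq_mul] at h2
  have h3 := Nat.div_add_mod (6 * n ^ 2) M
  have h4 := Nat.mod_lt (6 * n ^ 2) hM
  rw [mul_add] at h2
  omega

/-- Besides `r`, the errors are `2n/M` from replacing `l` by `⌊lM⌋/M` at heights up to `2n`, `M`
from `levelMap` against its linear trend, `M` from the shift `θ`, and 1 from rounding the additive
constant. -/
theorem thin_nearLinear {a b l : ℝ} (hl : 0 ≤ l) (hl1 : l ≤ 1) {m : ℤ} {n M : ℕ} (hM : 0 < M)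
    (hK : ⌊l * M⌋₊ ≤ M) {θ : ℕ} (hθ : θ < M) {r r' : ℝ} {E : Ensemble (box m n : Set (ℤ × ℤ))}
    (hE : ∀ p ∈ grid m n, |(boxHeight E p : ℝ) - (a * (p.1 - m) - b * (p.2 - m))| ≤ r)
    (hr : r + 2 * n / M + 2 * M + 1 ≤ r') :
    NearLinear (l * a) (l * b) r' m n (thin hM hK θ E) := by
  obtain ⟨hh, h0, -⟩ := boxHeight_spec E
  -- `boxHeight` vanishes at `(m, m)`, whereas `NearLinear` measures from the origin; the correcting
  -- constant has to be an integer.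
  set k := ⌊(l * a - l * b) * m⌋ with hk
  refine ⟨fun p => levelMap M ⌊l * M⌋₊ (boxHeight E p + θ) + k,
    (hh.comp_levelMap hM hK θ).add_const k, fun v hv => (thin_fits hM hK θ E hv).add_const k,
    fun p hp => ?_⟩
  have hMr : (0 : ℝ) < M := by exact_mod_cast hM
  have e1 := abs_le.1 (abs_levelMap_sub_le hM hK (boxHeight E p + θ))
  have hL : |boxHeight E p| ≤ 2 * n := by
    have := hh.abs_sub_le p (m, m)
    rw [h0, sub_zero] at this
    refine this.trans ?_
    rw [mem_grid] at hp
    rw [abs_of_nonneg (by simp only; omega), abs_of_nonneg (by simp only; omega)]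
    simp only
    omega
  have hLr : |(boxHeight E p : ℝ)| ≤ 2 * n := by exact_mod_cast hL
  have k1 : (k : ℝ) ≤ (l * a - l * b) * m := Int.floor_le _
  have k2 : (l * a - l * b) * m < k + 1 := Int.lt_floor_add_one _
  set H : ℝ := (boxHeight E p : ℝ) with hH
  set κ : ℝ := (⌊l * M⌋₊ : ℝ) / M with hκ
  have q1 : κ ≤ l := by
    rw [hκ, div_le_iff₀ hMr]
    exact Nat.floor_le (by positivity)
  have q2 : l ≤ κ + 1 / M := by
    rw [hκ, ← add_div, le_div_iff₀ hMr]
    exact (Nat.lt_floor_add_one _).le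
  have hκ0 : 0 ≤ κ := by positivity
  have d1 : |(κ - l) * H| ≤ 2 * n / M := by
    rw [abs_mul]
    have : |κ - l| ≤ 1 / M := by
      rw [abs_le]
      constructor <;> linarith [show (0 : ℝ) < 1 / M by positivity]
    calc _ ≤ 1 / M * (2 * n : ℝ) := mul_le_mul this hLr (abs_nonneg _) (by positivity)
      _ = _ := by ring
  have d2 : |l * (H - (a * (p.1 - m) - b * (p.2 - m)))| ≤ r := by
    rw [abs_mul, abs_of_nonneg hl]
    exact (mul_le_of_le_one_left (abs_nonneg _) hl1).trans (hE p hp)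
  have d3 : 0 ≤ κ * θ := by positivity
  have d4 : κ * θ ≤ M := by
    have : (θ : ℝ) ≤ M := by exact_mod_cast hθ.le
    exact (mul_le_of_le_one_left (by positivity) (q1.trans hl1)).trans this
  have d1' := abs_le.1 d1
  have d2' := abs_le.1 d2
  push_cast at e1 ⊢
  rw [abs_le]
  constructor <;> nlinarith

open Classical in
-- At least half of the stationary mass is nearly linear. It is covered by `M` classes according to
-- a shift with few breaks, and thinning a class loses at most `w₀^τ`, with `τ ≤ 6n²/M`.
theorem exp_le_sum_weight_nearLinear {B₁ B₂ a b l w₀ : ℝ} (h₁ : 0 ≤ B₁) (h₁' : B₁ ≤ 1)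
    (h₂ : 0 ≤ B₂) (h₂' : B₂ ≤ 1) (ha : 0 < a) (ha1 : a < 1) (hb : 0 < b) (hb1 : b < 1)
    (hab : a * (1 - b) * (1 - B₁) = (1 - a) * b * (1 - B₂)) (hl : 0 ≤ l) (hl1 : l ≤ 1)
    (hw0 : 0 < w₀) (hw1 : w₀ ≤ 1) (hw : ∀ c, w₀ ≤ stochasticWeight B₁ B₂ c)
    {ε δ : ℝ} (hε : 0 < ε) (hδ : 0 < δ) :
    ∃ n₀ : ℕ, ∀ n ≥ n₀, ∀ m : ℤ, Real.exp (-δ * (n : ℝ) ^ 2) ≤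
      ∑ E : Ensemble (box m n : Set (ℤ × ℤ)), if NearLinear (l * a) (l * b) (ε * n) m n E then
        E.weight (stochasticWeight B₁ B₂) else 0 := by
  set L := - Real.log w₀ with hL
  have hL0 : 0 ≤ L := by
    rw [hL, neg_nonneg]
    exact Real.log_nonpos hw0.le hw1
  -- The first bound makes the slope error `2n/M` at most `εn/4`; the second makes the loss `6n²L/M`
  -- in the exponent at most `δn²/2`.
  set M := max ⌈8 / ε⌉₊ ⌈12 * L / δ⌉₊ + 1 with hMdef
  have hM : 0 < M := by omega
  have hMr : (0 : ℝ) < M := by exact_mod_cast hM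
  have hM1 : 8 / ε ≤ M := (Nat.le_ceil _).trans (by
    exact_mod_cast (le_max_left _ _).trans (Nat.le_succ _))
  have hM2 : 12 * L / δ ≤ M := (Nat.le_ceil _).trans (by
    exact_mod_cast (le_max_right _ _).trans (Nat.le_succ _))
  rw [div_le_iff₀ hε] at hM1
  rw [div_le_iff₀ hδ] at hM2
  have hK : ⌊l * M⌋₊ ≤ M := Nat.floor_le_of_le (mul_le_of_le_one_left hMr.le hl1)
  obtain ⟨n₁, hn₁⟩ := sum_entranceMass_deviation_le h₁ h₁' h₂ h₂' ha ha1 hb hb1 hab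
    (ε := ε / 4) (by positivity)
  refine ⟨max n₁ (max ⌈4 * (2 * M + 1) / ε⌉₊ ⌈4 * M / δ⌉₊) + 1, fun n hn m => ?_⟩
  have hna : n₁ ≤ n := ((le_max_left _ _).trans (Nat.le_succ _)).trans hn
  have hnb : 4 * (2 * M + 1) / ε ≤ n := (Nat.le_ceil _).trans (by
    exact_mod_cast (((le_max_left _ _).trans (le_max_right _ _)).trans (Nat.le_succ _)).trans hn)
  have hnc : 4 * M / δ ≤ n := (Nat.le_ceil _).trans (by
    exact_mod_cast (((le_max_right _ _).trans (le_max_right _ _)).trans (Nat.le_succ _)).trans hn)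
  have hn1 : (1 : ℝ) ≤ n := by
    have : 1 ≤ n := by omega
    exact_mod_cast this
  rw [div_le_iff₀ hε] at hnb
  rw [div_le_iff₀ hδ] at hnc
  set μ : Ensemble (box m n : Set (ℤ × ℤ)) → ℝ := entranceMass B₁ B₂ a b with hμ
  have hμ0 : ∀ E, 0 ≤ μ E := fun E => Finset.prod_nonneg fun v _ =>
    entranceWeight_nonneg h₁ h₁' h₂ h₂' ha.le ha1.le hb.le hb1.le _ _ _
  set τ := 6 * n ^ 2 / M with hτ
  set good : Ensemble (box m n : Set (ℤ × ℤ)) → Prop := fun E => ∀ p ∈ grid m n,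
    |(boxHeight E p : ℝ) - (a * (p.1 - m) - b * (p.2 - m))| ≤ ε / 4 * n with hgood
  set F : ℕ → Finset (Ensemble (box m n : Set (ℤ × ℤ))) := fun θ =>
    Finset.univ.filter fun E => good E ∧ (breakSet M ⌊l * M⌋₊ θ E).card ≤ τ with hFdef
  set S := ∑ E : Ensemble (box m n : Set (ℤ × ℤ)),
    if NearLinear (l * a) (l * b) (ε * n) m n E then E.weight (stochasticWeight B₁ B₂) else 0
    with hS
  have hwt : ∀ E : Ensemble (box m n : Set (ℤ × ℤ)), 0 ≤ E.weight (stochasticWeight B₁ B₂) :=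
    fun E => Finset.prod_nonneg fun v _ => hw0.le.trans (hw _)
  have hhalf : 1 / 2 ≤ ∑ E with good E, μ E := by
    have h1 := hn₁ n hna m
    have h2 := sum_entranceMass B₁ B₂ a b (box m n)
    rw [← Finset.sum_filter_add_sum_filter_not Finset.univ good] at h2
    have h3 : (Finset.univ.filter fun E => ¬ good E) = Finset.univ.filter
        fun E : Ensemble (box m n : Set (ℤ × ℤ)) => ∃ p ∈ grid m n,
          ε / 4 * n < |(boxHeight E p : ℝ) - (a * (p.1 - m) - b * (p.2 - m))| := by
      ext E
      simp only [hgood, Finset.mem_filter, not_forall, not_le, exists_prop]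
    rw [h3] at h2
    linarith
  have hcover : ∑ E with good E, μ E ≤ ∑ θ ∈ Finset.range M, ∑ E ∈ F θ, μ E := by
    rw [Finset.sum_filter]
    simp only [hFdef, Finset.sum_filter]
    rw [Finset.sum_comm]
    refine Finset.sum_le_sum fun E _ => ?_
    have hnn : ∀ θ ∈ Finset.range M,
        0 ≤ if good E ∧ (breakSet M ⌊l * M⌋₊ θ E).card ≤ τ then μ E else 0 := fun θ _ => by
      split_ifs
      exacts [hμ0 E, le_rfl]
    split_ifs with hg
    · obtain ⟨θ, hθ, hb⟩ := exists_shift_few_breaks (K := ⌊l * M⌋₊) hM E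
      refine le_trans ?_ (Finset.single_le_sum hnn hθ)
      rw [if_pos ⟨hg, hb⟩]
    · exact Finset.sum_nonneg hnn
  have hθ : ∀ θ ∈ Finset.range M, w₀ ^ τ * ∑ E ∈ F θ, μ E ≤ S := by
    intro θ hθ
    refine (sum_entranceMass_le_sum_thin h₁ h₁' h₂ h₂' ha.le ha1.le hb.le hb1.le hw0.le hw1 hw hM hK
      θ (F θ) fun E hE => (Finset.mem_filter.1 hE).2.2).trans ?_
    rw [hS, ← Finset.sum_filter]
    refine Finset.sum_le_sum_of_subset_of_nonneg ?_ fun E _ _ => hwt E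
    intro G hG
    obtain ⟨E, hE, rfl⟩ := Finset.mem_image.1 hG
    refine Finset.mem_filter.2 ⟨Finset.mem_univ _, ?_⟩
    refine thin_nearLinear hl hl1 hM hK (Finset.mem_range.1 hθ) (Finset.mem_filter.1 hE).2.1 ?_
    have : 2 * (n : ℝ) / M ≤ ε / 4 * n := by
      rw [div_le_iff₀ hMr]
      nlinarith
    linarith
  have hmain : w₀ ^ τ * (1 / 2) ≤ M * S := by
    calc _ ≤ w₀ ^ τ * ∑ θ ∈ Finset.range M, ∑ E ∈ F θ, μ E :=
          mul_le_mul_of_nonneg_left (hhalf.trans hcover) (pow_nonneg hw0.le _)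
      _ ≤ ∑ θ ∈ Finset.range M, S := by
          rw [Finset.mul_sum]
          exact Finset.sum_le_sum hθ
      _ = _ := by rw [Finset.sum_const, Finset.card_range, nsmul_eq_mul]
  have hexp : Real.exp (-(δ / 2) * (n : ℝ) ^ 2) ≤ w₀ ^ τ := by
    have h1 : w₀ ^ τ = Real.exp (-(L * τ)) := by
      rw [hL, neg_mul, neg_neg, mul_comm, Real.exp_nat_mul, Real.exp_log hw0]
    rw [h1]
    apply Real.exp_le_exp.2
    have h2 : (τ : ℝ) ≤ 6 * n ^ 2 / M := by
      have := @Nat.cast_div_le ℝ _ _ _ (6 * n ^ 2) M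
      rw [hτ]
      refine this.trans (le_of_eq ?_)
      push_cast
      rfl
    have h3 : L * τ ≤ L * (6 * n ^ 2 / M) := mul_le_mul_of_nonneg_left h2 hL0
    have h4 : L * (6 * n ^ 2 / M) ≤ δ / 2 * n ^ 2 := by
      rw [← mul_div_assoc, div_le_iff₀ hMr]
      nlinarith [sq_nonneg (n : ℝ)]
    linarith
  have hM4 : 2 * M ≤ Real.exp (δ / 2 * (n : ℝ) ^ 2) := by
    have h1 := Real.add_one_le_exp (δ / 2 * (n : ℝ) ^ 2)
    have h2 : 2 * (M : ℝ) ≤ δ / 2 * (n : ℝ) ^ 2 := by nlinarith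
    linarith
  have hpos := Real.exp_pos (-δ * (n : ℝ) ^ 2)
  have hprod : Real.exp (-(δ / 2) * (n : ℝ) ^ 2) =
      Real.exp (-δ * (n : ℝ) ^ 2) * Real.exp (δ / 2 * (n : ℝ) ^ 2) := by
    rw [← Real.exp_add]
    congr 1
    ring
  have h5 : Real.exp (-δ * (n : ℝ) ^ 2) * (2 * M) ≤ w₀ ^ τ := by
    calc _ ≤ Real.exp (-δ * (n : ℝ) ^ 2) * Real.exp (δ / 2 * (n : ℝ) ^ 2) :=
          mul_le_mul_of_nonneg_left hM4 hpos.le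
      _ ≤ _ := by rw [← hprod]; exact hexp
  have h6 : M * Real.exp (-δ * (n : ℝ) ^ 2) ≤ M * S := by linarith
  exact le_of_mul_le_mul_left h6 hMr

/-! ### Scaling of slopes, and the lower bound for one boundary condition -/

/-- A slope between the diagonal and the graph of `φ` is, up to a small error, a multiple of a
slope on the graph. -/
theorem exists_scaling {B₁ B₂ s t ε : ℝ} (hB₁₂ : B₁ < B₂) (hB₂ : B₂ < 1) (hs : 0 < s)
    (hs1 : s < 1) (hst : s ≤ t) (htφ : t ≤ phi B₁ B₂ s) (hε : 0 < ε) :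
    ∃ a b l : ℝ, 0 < a ∧ a < 1 ∧ 0 < b ∧ b < 1 ∧
      a * (1 - b) * (1 - B₁) = (1 - a) * b * (1 - B₂) ∧ 0 ≤ l ∧ l ≤ 1 ∧ l * a = s ∧
      |l * b - t| ≤ ε := by
  have hq : 0 < 1 - B₂ := by linarith
  have hpq : 1 - B₂ < 1 - B₁ := by linarith
  rw [phi, kappa] at htφ
  set p := 1 - B₁
  set q := 1 - B₂
  have hp : 0 < p := hq.trans hpq
  have hD : ∀ a, 0 < a → 0 < q + (p - q) * a := fun a ha =>
    add_pos hq (mul_pos (by linarith) ha)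
  have htφ' : t * (q + (p - q) * s) ≤ p * s := by
    have e : p / q * s / ((p / q - 1) * s + 1) = p * s / (q + (p - q) * s) := by
      have h1 := hD s hs
      have h2 : (p / q - 1) * s + 1 = (q + (p - q) * s) / q := by
        field_simp
        ring
      rw [h2]
      field_simp
    rw [e, le_div_iff₀ (hD s hs)] at htφ
    exact htφ
  -- With `b = φ(a)` and `l = s/a`, the product `l b` equals `p s / (q + (p - q) a)`, so only `a`
  -- has to be chosen.
  have key : ∀ a, s ≤ a → a < 1 → |p * s / (q + (p - q) * a) - t| ≤ ε →
      ∃ a b l : ℝ, 0 < a ∧ a < 1 ∧ 0 < b ∧ b < 1 ∧ a * (1 - b) * p = (1 - a) * b * q ∧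
        0 ≤ l ∧ l ≤ 1 ∧ l * a = s ∧ |l * b - t| ≤ ε := by
    intro a hsa ha1 hat
    have ha : 0 < a := hs.trans_le hsa
    have hDa := hD a ha
    refine ⟨a, p * a / (q + (p - q) * a), s / a, ha, ha1, by positivity, ?_, ?_, by positivity,
      (div_le_one ha).2 hsa, div_mul_cancel₀ _ ha.ne', ?_⟩
    · rw [div_lt_one hDa]
      nlinarith
    · have h1 : 1 - p * a / (q + (p - q) * a) = q * (1 - a) / (q + (p - q) * a) := by
        rw [eq_div_iff hDa.ne', sub_mul, div_mul_cancel₀ _ hDa.ne']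
        ring
      rw [h1]
      ring
    · convert hat using 3
      field_simp
  have ht : 0 < t := hs.trans_le hst
  obtain hlt | rfl := hst.lt_or_eq
  · have hpq' : 0 < p - q := by linarith
    refine key ((p * s / t - q) / (p - q)) ?_ ?_ ?_
    · rw [le_div_iff₀ hpq', le_sub_iff_add_le, le_div_iff₀ ht]
      linarith
    · rw [div_lt_one hpq', sub_lt_sub_iff_right, div_lt_iff₀ ht]
      exact mul_lt_mul_of_pos_left hlt hp
    · have : q + (p - q) * ((p * s / t - q) / (p - q)) = p * s / t := by
        field_simp
        ring
      rw [this, div_div_cancel₀ (mul_pos hp hs).ne', sub_self, abs_zero]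
      exact hε.le
  -- On the diagonal the exact solution would be `a = 1`, which is not allowed; `a = 1 - x` produces
  -- an error of at most `p x / q ≤ ε`.
  · have hmin : 0 < min (1 - s) (q * ε / p) := lt_min (by linarith) (by positivity)
    set x := min (1 - s) (q * ε / p) with hx
    have hx1 : x ≤ 1 - s := min_le_left _ _
    have hx2 : x ≤ q * ε / p := min_le_right _ _
    rw [le_div_iff₀ hp] at hx2
    have ha : 0 < 1 - x := by linarith
    have hDa := hD _ ha
    refine key (1 - x) (by linarith) (by linarith) ?_
    have e : p * s / (q + (p - q) * (1 - x)) - s = s * ((p - q) * x) / (q + (p - q) * (1 - x)) := by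
      field_simp
      ring
    have h3 : 0 ≤ (p - q) * x := mul_nonneg (by linarith) hmin.le
    rw [e, abs_of_nonneg (by positivity), div_le_iff₀ hDa]
    have h4 : s * ((p - q) * x) ≤ (p - q) * x := mul_le_of_le_one_left h3 hs1.le
    have h5 : 0 ≤ (p - q) * (1 - x) := mul_nonneg (by linarith) ha.le
    nlinarith [mul_nonneg hε.le h5, mul_nonneg hq.le hmin.le]

theorem NearLinear.mono {s t t' r r' η : ℝ} {m : ℤ} {n : ℕ} {Λ : Set (ℤ × ℤ)} {E : Ensemble Λ}
    (h : NearLinear s t r m n E) (ht : |t - t'| ≤ η) (hm : |m| ≤ n) (hr : r + 2 * η * n ≤ r') :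
    NearLinear s t' r' m n E := by
  obtain ⟨k, hk, hf, hl⟩ := h
  refine ⟨k, hk, hf, fun p hp => ?_⟩
  have h1 := hl p hp
  have h2 : |(p.2 : ℝ)| ≤ 2 * n := by
    rw [mem_grid] at hp
    rw [abs_le] at hm
    have : |p.2| ≤ 2 * n := abs_le.2 ⟨by omega, by omega⟩
    exact_mod_cast this
  have h3 : |(t' - t) * p.2| ≤ η * (2 * n) := by
    rw [abs_mul, abs_sub_comm]
    exact mul_le_mul ht h2 (abs_nonneg _) ((abs_nonneg _).trans ht)
  have h4 : (k p : ℝ) - (s * p.1 - t' * p.2) = (k p - (s * p.1 - t * p.2)) + (t' - t) * p.2 := by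
    ring
  rw [h4]
  refine (abs_add_le _ _).trans ?_
  linarith

open Classical in
/-- In a box, the ensembles close to a linear profile with slope between the diagonal and the graph
of `φ` have a total weight that is not exponentially small in the area. -/
theorem exp_le_sum_weight_of_slope {B₁ B₂ s t w₀ : ℝ} (hB₁ : 0 < B₁) (hB₁₂ : B₁ < B₂)
    (hB₂ : B₂ < 1) (hs : 0 < s) (hs1 : s < 1) (hst : s ≤ t) (htφ : t ≤ phi B₁ B₂ s)
    (hw0 : 0 < w₀) (hw1 : w₀ ≤ 1) (hw : ∀ c, w₀ ≤ stochasticWeight B₁ B₂ c)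
    {ε δ : ℝ} (hε : 0 < ε) (hδ : 0 < δ) :
    ∃ n₀ : ℕ, ∀ n ≥ n₀, ∀ m : ℤ, |m| ≤ n → Real.exp (-δ * (n : ℝ) ^ 2) ≤
      ∑ E : Ensemble (box m n : Set (ℤ × ℤ)), if NearLinear s t (ε * n) m n E then
        E.weight (stochasticWeight B₁ B₂) else 0 := by
  obtain ⟨a, b, l, ha, ha1, hb, hb1, hab, hl, hl1, rfl, hlb⟩ :=
    exists_scaling hB₁₂ hB₂ hs hs1 hst htφ (ε := ε / 4) (by positivity)
  obtain ⟨n₀, h⟩ := exp_le_sum_weight_nearLinear hB₁.le (by linarith) (by linarith) hB₂.le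
    ha ha1 hb hb1 hab hl hl1 hw0 hw1 hw (ε := ε / 2) (by positivity) hδ
  refine ⟨n₀, fun n hn m hm => (h n hn m).trans (Finset.sum_le_sum fun E _ => ?_)⟩
  have hE : 0 ≤ E.weight (stochasticWeight B₁ B₂) :=
    Finset.prod_nonneg fun v _ => hw0.le.trans (hw _)
  split_ifs with h1 h2
  · exact le_rfl
  · exact absurd (h1.mono hlb hm (by linarith)) h2
  · exact hE
  · exact le_rfl

/-- Gluing with a frame of width about `βN`: the tolerance `cβN/2` fits into the slack `cm`, and
half of `δ` pays for the frame, the other half for the inner box. -/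
theorem exp_le_partitionFunction {B₁ B₂ s t : ℝ} (hB₁ : 0 < B₁) (hB₁₂ : B₁ < B₂)
    (hB₂ : B₂ < 1) (hs : 0 < s) (hst : s ≤ t) (ht1 : t < 1) (htφ : t ≤ phi B₁ B₂ s)
    {δ : ℝ} (hδ : 0 < δ) :
    ∃ η > 0, ∃ N₀ : ℕ, ∀ N ≥ N₀, ∀ ω : Ensemble Set.univ, NearLinear s t (η * N) 0 N ω →
      Real.exp (-δ * (N : ℝ) ^ 2) ≤
        partitionFunction (stochasticWeight B₁ B₂) (N := N) (ω.restrict Set.sdiff_subset) := by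
  obtain ⟨w₀, hw0, hw1, hw⟩ : ∃ w₀ : ℝ, 0 < w₀ ∧ w₀ ≤ 1 ∧ ∀ c, w₀ ≤ stochasticWeight B₁ B₂ c := by
    have h1 : min B₁ (1 - B₂) ≤ B₁ := min_le_left _ _
    have h2 : min B₁ (1 - B₂) ≤ 1 - B₂ := min_le_right _ _
    exact ⟨min B₁ (1 - B₂), lt_min hB₁ (by linarith), by linarith, stochasticWeight_pos_bound h1
      (by linarith) (by linarith) h2⟩
  obtain ⟨c, hc, hcs, hct⟩ : ∃ c : ℝ, 0 < c ∧ c ≤ s ∧ c ≤ 1 - t :=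
    ⟨min s (1 - t), lt_min hs (by linarith), min_le_left _ _, min_le_right _ _⟩
  set L := - Real.log w₀ with hL
  have hL0 : 0 ≤ L := by
    rw [hL, neg_nonneg]
    exact Real.log_nonpos hw0.le hw1
  -- The condition on `16Lβ` bounds the frame cost `4LβN²` by `δN²/4`; rounding `m` up costs another
  -- `4LN ≤ δN²/4` for large `N`. The bound `1/8` gives `4m ≤ N`, hence `n ≥ N/2` and `m ≤ n`.
  obtain ⟨β, hβ, hβL, hβ8⟩ : ∃ β : ℝ, 0 < β ∧ 16 * L * β ≤ δ ∧ β ≤ 1 / 8 := by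
    refine ⟨min (δ / (16 * (L + 1))) (1 / 8), by positivity, ?_, min_le_right _ _⟩
    have h1 : min (δ / (16 * (L + 1))) (1 / 8) ≤ δ / (16 * (L + 1)) := min_le_left _ _
    rw [le_div_iff₀ (by positivity)] at h1
    have h2 : 0 < min (δ / (16 * (L + 1))) (1 / 8 : ℝ) := by positivity
    linarith
  have hη : 0 < c * β / 2 := by positivity
  obtain ⟨n₀, hn₀⟩ := exp_le_sum_weight_of_slope hB₁ hB₁₂ hB₂ hs (hst.trans_lt ht1) hst htφ hw0 hw1
    hw hη (half_pos hδ)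
  refine ⟨c * β / 2, hη, max (2 * n₀) (max 8 ⌈16 * L / δ⌉₊), fun N hN ω hω => ?_⟩
  have hN1 : 2 * n₀ ≤ N := (le_max_left _ _).trans hN
  have hN2 : 8 ≤ N := ((le_max_left _ _).trans (le_max_right _ _)).trans hN
  have hN3 : 16 * L / δ ≤ N := (Nat.le_ceil _).trans (by
    exact_mod_cast ((le_max_right _ _).trans (le_max_right _ _)).trans hN)
  rw [div_le_iff₀ hδ] at hN3
  have hN2' : (8 : ℝ) ≤ N := by exact_mod_cast hN2
  set m := ⌈β * N⌉₊ with hm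
  have hm1 : β * N ≤ m := Nat.le_ceil _
  have hm2 : (m : ℝ) ≤ β * N + 1 := (Nat.ceil_lt_add_one (by positivity)).le
  have hm4 : 4 * m ≤ N := by
    have : 4 * (m : ℝ) ≤ N := by nlinarith
    exact_mod_cast this
  obtain ⟨n, hn⟩ : ∃ n, N = n + 2 * m := ⟨N - 2 * m, by omega⟩
  have h1 := partitionFunction_ge (c := c) hcs (by linarith) (by linarith) hct hc.le hn
    (r := c * β / 2 * N) (by nlinarith) hw0.le hw1 hw ω hω
  refine le_trans ?_ h1
  have hnN : (n : ℝ) ≤ N := by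
    have : n ≤ N := by omega
    exact_mod_cast this
  have h2 := hn₀ n (by omega) m (by rw [abs_of_nonneg (by positivity)]; norm_cast; omega)
  have h3 : Real.exp (-δ * (N : ℝ) ^ 2) ≤
      w₀ ^ (4 * m * N) * Real.exp (-(δ / 2) * (n : ℝ) ^ 2) := by
    have e : w₀ ^ (4 * m * N) = Real.exp (-(L * (4 * m * N : ℕ))) := by
      rw [hL, neg_mul, neg_neg, mul_comm (Real.log w₀), Real.exp_nat_mul, Real.exp_log hw0]
    rw [e, ← Real.exp_add]
    apply Real.exp_le_exp.2
    push_cast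
    have e1 : (n : ℝ) ^ 2 ≤ (N : ℝ) ^ 2 := pow_le_pow_left₀ (by positivity) hnN 2
    have e2 : L * (4 * m * N) ≤ L * (4 * (β * N + 1) * N) := by gcongr
    have e3 : L * (4 * (β * N + 1) * N) ≤ δ / 2 * N ^ 2 := by
      have i1 : 16 * L * β * (N : ℝ) ^ 2 ≤ δ * N ^ 2 := by gcongr
      have i2 : 16 * L * (N : ℝ) ≤ N * δ * N := by gcongr
      nlinarith
    have e4 : δ / 2 * (n : ℝ) ^ 2 ≤ δ / 2 * N ^ 2 := by gcongr
    linarith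
  refine h3.trans (mul_le_mul_of_nonneg_left (h2.trans ?_) (by positivity))
  classical
  refine Finset.sum_le_sum fun E _ => ?_
  have hE : 0 ≤ E.weight (stochasticWeight B₁ B₂) :=
    Finset.prod_nonneg fun v _ => hw0.le.trans (hw _)
  split_ifs with h4 h5
  · exact le_rfl
  · refine absurd ?_ h5
    obtain ⟨k, hk, hf, hl⟩ := h4
    exact ⟨k, hk, hf, fun p hp => (hl p hp).trans (by gcongr)⟩
  · exact hE
  · exact le_rfl

/-! ### Conclusion for pure states -/

/-- The bound `Measure.le_map_apply` holds for every set, so the event transfers to the outer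
marginal without a proof of its measurability. -/
theorem partitionFunctionStochasticLowerBound_of_measure {B₁ B₂ : ℝ}
    {μ : Measure (Ensemble Set.univ)} [IsProbabilityMeasure μ]
    (h : ∀ δ : ℝ, 0 < δ → ∃ N₀ : ℕ, ∀ N ≥ N₀, μ {ω | ¬ Real.exp (-δ * (N : ℝ) ^ 2) ≤
      partitionFunction (stochasticWeight B₁ B₂) (N := N) (ω.restrict Set.sdiff_subset)}
        ≤ ENNReal.ofReal δ) :
    PartitionFunctionStochasticLowerBound B₁ B₂ μ := by
  intro δ hδ
  obtain ⟨N₀, hN₀⟩ := h δ hδ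
  refine ⟨N₀ + 2, by linarith [Nat.cast_nonneg (α := ℝ) N₀], fun N hN => ?_⟩
  have hN' : N₀ ≤ N := by
    have : (N₀ : ℝ) ≤ N := by linarith
    exact_mod_cast this
  have hmeas := Ensemble.measurable_restrict
    (Set.sdiff_subset : Set.univ \ (square N : Set (ℤ × ℤ)) ⊆ Set.univ)
  set A := {H | Real.exp (-δ * (N : ℝ) ^ 2) ≤
    partitionFunction (stochasticWeight B₁ B₂) (N := N) H} with hA
  have h1 : μ.real (Ensemble.restrict Set.sdiff_subset ⁻¹' A) ≤ (outerMarginal μ N).real A := by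
    have : IsProbabilityMeasure (outerMarginal μ N) :=
      Measure.isProbabilityMeasure_map hmeas.aemeasurable
    exact ENNReal.toReal_mono (measure_ne_top _ _) (Measure.le_map_apply hmeas.aemeasurable A)
  have h2 : μ.real (Ensemble.restrict Set.sdiff_subset ⁻¹' A)ᶜ ≤ δ :=
    ENNReal.toReal_le_of_le_ofReal hδ.le (hN₀ N hN')
  have h3 := measureReal_union_le (μ := μ) (Ensemble.restrict Set.sdiff_subset ⁻¹' A)
    (Ensemble.restrict Set.sdiff_subset ⁻¹' A)ᶜ
  rw [Set.union_compl_self, probReal_univ] at h3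
  linarith

/-- A variable with values 0 and 1 and mean 1 is almost surely 1; translation invariance and
countability of the lattice extend this to all vertices at once. -/
theorem IsTranslationInvariant.ae_forall_total {μ : Measure (Ensemble Set.univ)}
    [IsProbabilityMeasure μ] (hμ : IsTranslationInvariant μ) (f : ArrowConfig → Bool)
    (h : ∫ E, ((f (E.total (0, 0))).toNat : ℝ) ∂μ = 1) : ∀ᵐ E ∂μ, ∀ v, f (E.total v) = true := by
  have hm : Measurable fun E : Ensemble Set.univ => ((f (E.total (0, 0))).toNat : ℝ) :=
    measurable_of_total (0, 0) fun c => ((f c).toNat : ℝ)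
  have hb : ∀ E : Ensemble Set.univ, 0 ≤ 1 - ((f (E.total (0, 0))).toNat : ℝ) := fun E => by
    cases f (E.total (0, 0)) <;> simp
  have hint : Integrable (fun E : Ensemble Set.univ => ((f (E.total (0, 0))).toNat : ℝ)) μ :=
    Integrable.of_bound hm.aestronglyMeasurable 1 (by
      filter_upwards with E
      cases f (E.total (0, 0)) <;> simp)
  have h0 : ∫ E, (1 - ((f (E.total (0, 0))).toNat : ℝ)) ∂μ = 0 := by
    rw [integral_sub (integrable_const _) hint, h]
    simp
  rw [integral_eq_zero_iff_of_nonneg hb ((integrable_const _).sub hint)] at h0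
  rw [ae_all_iff]
  intro v
  filter_upwards [(hμ.measurePreserving v).quasiMeasurePreserving.ae h0] with E hE
  simp only [Ensemble.translate_total, Prod.mk_zero_zero, zero_add, Pi.zero_apply] at hE
  cases hf : f (E.total v)
  · simp [hf] at hE
  · rfl

/-- The restriction of `ω` to the square is itself a term of the sum, and all its vertices are `(1,
1; 1, 1)`, of weight 1. -/
theorem one_le_partitionFunction_of_full {B₁ B₂ : ℝ} (hB₁ : 0 ≤ B₁) (hB₁' : B₁ ≤ 1)
    (hB₂ : 0 ≤ B₂) (hB₂' : B₂ ≤ 1) (N : ℕ) {ω : Ensemble Set.univ}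
    (h : ∀ v, (ω.total v).i₂ = true ∧ (ω.total v).j₂ = true) :
    1 ≤ partitionFunction (stochasticWeight B₁ B₂) (N := N) (ω.restrict Set.sdiff_subset) := by
  classical
  have hone : ∀ c : ArrowConfig, c.i₂ = true → c.j₂ = true → stochasticWeight B₁ B₂ c = 1 := by
    rintro ⟨⟨i, j, k, l⟩, hc⟩ hi hj
    revert hc hi hj
    cases i <;> cases j <;> cases k <;> cases l <;> intro hc hi hj <;>
      simp [ArrowConfig.i₁, ArrowConfig.j₁, ArrowConfig.i₂, ArrowConfig.j₂,
        stochasticWeight, sixVertexWeight] at hc hi hj ⊢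
  set E : Ensemble (square N : Set (ℤ × ℤ)) := ω.restrict (Set.subset_univ _) with hE
  have htot : ∀ v ∈ (square N : Set (ℤ × ℤ)), E.total v = ω.total v := fun v hv => by
    rw [E.total_of_mem hv, ω.total_of_mem (Set.mem_univ _)]
    rfl
  have hbd : E.boundaryData = (ω.restrict (Set.sdiff_subset :
      Set.univ \ (square N : Set (ℤ × ℤ)) ⊆ Set.univ)).inducedBoundaryData :=
    boundaryData_eq E ω (fun v hv _ => by rw [htot v hv]) (fun v hv _ => by rw [htot v hv])
      (fun v hv _ => by rw [htot v hv]) (fun v hv _ => by rw [htot v hv])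
  have hwt : E.weight (stochasticWeight B₁ B₂) = 1 := by
    rw [Ensemble.weight_eq_prod_total]
    exact Finset.prod_eq_one fun v hv => by
      rw [htot v hv]
      exact hone _ (h v).1 (h v).2
  rw [partitionFunction]
  have hle := Finset.single_le_sum (f := fun E : Ensemble (square N : Set (ℤ × ℤ)) =>
    if E.boundaryData = (ω.restrict (Set.sdiff_subset :
      Set.univ \ (square N : Set (ℤ × ℤ)) ⊆ Set.univ)).inducedBoundaryData then
        E.weight (stochasticWeight B₁ B₂) else 0) (fun F _ => by
      split_ifs
      exacts [Finset.prod_nonneg fun v _ => stochasticWeight_nonneg hB₁ hB₁' hB₂ hB₂' _, le_rfl])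
    (Finset.mem_univ E)
  simp only [if_pos hbd, hwt] at hle
  convert hle

theorem IsPureState.partitionFunctionStochasticLowerBound {B₁ B₂ : ℝ} (hB₁ : 0 < B₁)
    (hB₁₂ : B₁ < B₂) (hB₂ : B₂ < 1) {s t : ℝ} (hs : s ∈ Set.Ioc (0 : ℝ) 1)
    (ht : t ∈ Set.Ioc (0 : ℝ) 1) {μ : Measure (Ensemble Set.univ)}
    (hμ : IsPureState (stochasticWeight B₁ B₂) μ) (hslope : slope μ = (s, t))
    (hst : s ≤ t) (htφ : t ≤ phi B₁ B₂ s) :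
    PartitionFunctionStochasticLowerBound B₁ B₂ μ := by
  have := hμ.isProbabilityMeasure
  have hs' : (slope μ).1 = s := by rw [hslope]
  have ht' : (slope μ).2 = t := by rw [hslope]
  refine partitionFunctionStochasticLowerBound_of_measure fun δ hδ => ?_
  obtain ht1 | ht1 := ht.2.lt_or_eq
  · obtain ⟨η, hη, N₁, h₁⟩ := exp_le_partitionFunction hB₁ hB₁₂ hB₂ hs.1 hst ht1 htφ hδ
    obtain ⟨N₂, h₂⟩ := hμ.measure_not_nearLinear (hs'.symm ▸ hs.1.le) (hs'.symm ▸ hs.2)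
      (ht'.symm ▸ ht.1.le) (ht'.symm ▸ ht.2) hη hδ
    rw [hs', ht'] at h₂
    exact ⟨max N₁ N₂, fun N hN => (measure_mono (Set.ofPred_subset_ofPred.2 fun ω hω hnl =>
      hω (h₁ N ((le_max_left _ _).trans hN) ω hnl))).trans (h₂ N ((le_max_right _ _).trans hN))⟩
  -- For `t = 1` the gluing has no slack, but since `κ > 1` the inequality `φ(s) ≥ 1` forces `s ≥
  -- 1`.
  · have hs1 : s = 1 := by
      have hq : 0 < 1 - B₂ := by linarith
      have hκ : 1 < kappa B₁ B₂ := by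
        rw [kappa, one_lt_div hq]
        linarith
      have hs0 := hs.1
      have hD : 0 < (kappa B₁ B₂ - 1) * s + 1 := by
        have := mul_pos (sub_pos.2 hκ) hs0
        linarith
      rw [ht1, phi, le_div_iff₀ hD] at htφ
      linarith [hs.2]
    have hV := hμ.isTranslationInvariant.ae_forall_total ArrowConfig.i₂ (by
      rw [← hs1, ← hs']
      exact integral_congr_ae (by filter_upwards with E; exact (E.chiV_eq _).symm))
    have hH := hμ.isTranslationInvariant.ae_forall_total ArrowConfig.j₂ (by
      rw [← ht1, ← ht']
      exact integral_congr_ae (by filter_upwards with E; exact (E.chiH_eq _).symm))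
    refine ⟨0, fun N _ => le_of_eq_of_le ?_ zero_le⟩
    rw [← ae_iff]
    filter_upwards [hV, hH] with ω h1 h2
    refine le_trans (Real.exp_le_one_iff.2 ?_) (one_le_partitionFunction_of_full hB₁.le
      (by linarith) (by linarith) hB₂.le N fun v => ⟨h1 v, h2 v⟩)
    nlinarith [sq_nonneg (N : ℝ)]

end SixVertex

theorem mainTheorem3 (B₁ B₂ : ℝ) (hB₁ : 0 < B₁) (hB₁₂ : B₁ < B₂) (hB₂ : B₂ < 1)
    (s t : ℝ) (hs : s ∈ Set.Ioc (0 : ℝ) 1) (ht : t ∈ Set.Ioc (0 : ℝ) 1)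
    (μ : MeasureTheory.Measure (SixVertex.Ensemble Set.univ))
    (hμ : SixVertex.IsPureState (SixVertex.stochasticWeight B₁ B₂) μ)
    (hslope : SixVertex.slope μ = (s, t))
    (hst : s ≤ t) (htφ : t ≤ SixVertex.phi B₁ B₂ s) :
    SixVertex.PartitionFunctionStochasticLowerBound B₁ B₂ μ :=
  hμ.partitionFunctionStochasticLowerBound hB₁ hB₁₂ hB₂ hs ht hslope hst htφ
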